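/- **Cellular algebras.** Let $R$ be an integral domain. A cell datum for a unital $R$-algebra $A$ consists of an $R$-linear anti-automorphism $*$ of $A$ with $(x^*)^*=x$, a finite partially ordered set $(\widehat A,\unrhd)$, for each $\lambda\in\widehat A$ a finite non-empty index set $I(\lambda)$, and an $R$-basis $\{c^\lambda_{st} : \lambda\in\widehat A,\ s,t\in I(\lambda)\}$ of $A$ such that, writing $A^{\rhd\lambda}$ (resp. $A^{\unrhd\lambda}$) for the span of the $c^\mu_{st}$ with $\mu\rhd\lambda$ (resp. $\mu\unrhd\lambda$): for all $\lambda,t$ and $a\in A$ there are $r(a;t,v)\in R$ with $c^\lambda_{st}a\equiv\sum_v r(a;t,v)c^\lambda_{sv}$ mod $A^{\rhd\lambda}$ for all $s$; and $(c^\lambda_{st})^*\equiv c^\lambda_{ts}$ mod $A^{\rhd\lambda}$. The cell module $\Delta(\lambda)$ is the right $A$-module, free over $R$ on $\{c_t: t\in I(\lambda)\}$, with $c_ta=\sum_v r(a;t,v)c_v$. An order preserving cell filtration of a right $A$-module $M$ is a chain of submodules $0=M_0\subseteq\dots\subseteq M_n=M$ with isomorphisms $M_i/M_{i-1}\cong\Delta(\lambda^{(i)})$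 and $\lambda^{(1)}\rhd\lambda^{(2)}\rhd\cdots$. **Towers of diagram algebras.** Let $(A_r)_{r\ge0}$ be an increasing sequence of $R$-algebras (unital inclusions) with cell data whose involutions are consistent with the inclusions, and let $\mathbb F$ be the field of fractions of $R$. Consider the following axioms. * (D1) $A_0=R$. * (D2) Each cell module $\Delta_r(\lambda)$ is cyclic. One fixes generators $\delta_r(\lambda)$, bimodule isomorphisms $\alpha_\lambda:A_r^{\unrhd\lambda}/A_r^{\rhd\lambda}\to\Delta_r(\lambda)^*\otimes_R\Delta_r(\lambda)$, and cell generators $m_\lambda\in A_r^{\unrhd\lambda}$ with $\alpha_\lambda(m_\lambda+A_r^{\rhd\lambda})=\delta_r(\lambda)^*\otimes\delta_r(\lambda)$. * (D3) $m_\lambda^*=m_\lambda$. * (D4) $A_r\otimes_R\mathbb F$ is split semisimple (a finite product of full matrix algebras over $\mathbb F$). * (D5) The restriction to $A_{r}$ of each cell module $\Delta_{r+1}(\mu)$ has an order preserving cell filtration. The branching diagram has vertices $\widehat A_r$ on level $r$ and an edge $\lambda\to\mu$, for $\lambda\in\widehat A_{r-1}$ and $\mu\in\widehat A_r$, iff $\Delta_{r-1}(\lambda)$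 occurs as a subquotient of an order preserving cell filtration of the restriction of $\Delta_r(\mu)$. The down-branching factors $d_{\lambda\to\mu}\in A_r$ are elements such that, for each $\mu$, there is an order preserving cell filtration $(M_i)$ of the restriction of $\Delta_r(\mu)$ with labels $\lambda^{(i)}$ in which $\delta_r(\mu)d_{\lambda^{(i)}\to\mu}\in M_i$ and its class is mapped to $\delta_{r-1}(\lambda^{(i)})$ by $M_i/M_{i-1}\cong\Delta_{r-1}(\lambda^{(i)})$. * (D6) There are up-branching factors $u_{\lambda\to\mu}\in A_r$ with $m_\mu d_{\lambda\to\mu}=(u_{\lambda\to\mu})^*m_\lambda$ for every edge $\lambda\to\mu$. Let $\varnothing$ be the unique element of $\widehat A_0$, and let $\mathrm{Std}_r(\nu)$ be the set of directed paths $t=(\varnothing=t(0)\to\dots\to t(r)=\nu)$. Put $d_t=d_{t(r-1)\to t(r)}\cdots d_{t(0)\to t(1)}$ and $m^\nu_{st}=d_s^*m_\nu d_t$. **Quotient towers.** Let $(A_r)$ satisfy (D1)–(D6). Let $\pi:R\to S$ be a surjective homomorphism onto an integral domain with field of fractions $\mathbb K$, let $A_r^S=A_r\otimes_RS$ and $A_r^{\mathbb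 K}=A_r\otimes_R\mathbb K$, let $(Q_r^{\mathbb K})$ be an increasing sequence of unital $\mathbb K$-algebras with common identity, and let $\phi=\phi_r:A_r^{\mathbb K}\to Q_r^{\mathbb K}$ be surjective unital homomorphisms consistent with the inclusions. Put $Q_r^S=\phi(A_r^S)$. Assume: * (Q1) There are subsets $\widehat A_{r,\mathrm{perm}}\subseteq\widehat A_r$ of permissible points such that $\varnothing$ is permissible, and for every permissible $\mu\in\widehat A_r$ there are a permissible $\nu\in\widehat A_{r+1}$ with $\mu\to\nu$ and, if $r\ge1$, a permissible $\lambda\in\widehat A_{r-1}$ with $\lambda\to\mu$. A path is called permissible if all its vertices are; $\mathrm{Std}_{r,\mathrm{perm}}(\nu)\subseteq\mathrm{Std}_r(\nu)$ is the set of permissible paths. * (Q2) If a path $t$ is not permissible and $\mu=t(k)$ is its first non-permissible vertex, then there are $\mathfrak b_\mu,\mathfrak b'_\mu\in A_k^S$ with $m_\mu=\mathfrak b_\mu-\mathfrak b'_\mu$, $\mathfrak b_\mu\in\ker\phi$, and $\mathfrak b'_\mu\in m_\mu A_k^{\mathbb K}\cap(A_k^S)^{\rhd\mu}$. * (Q3)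 $\dim_{\overline{\mathbb K}}(Q_r^{\mathbb K}\otimes_{\mathbb K}\overline{\mathbb K})=\sum_{\nu\in\widehat A_{r,\mathrm{perm}}}(\sharp\,\mathrm{Std}_{r,\mathrm{perm}}(\nu))^2$ for all $r$, where $\overline{\mathbb K}$ is the algebraic closure of $\mathbb K$. **Proposition.** Suppose moreover that $Q_r^{\mathbb K}$ is split semisimple for all $r$. Then each $Q_r^S$ has a cell datum over $S$ with involution $\phi(a)^*=\phi(a^*)$ for $a\in A_r^S$, partially ordered set $(\widehat A_{r,\mathrm{perm}},\unrhd)$, index sets $\mathrm{Std}_{r,\mathrm{perm}}(\lambda)$, and cellular basis $\{\phi(m^\lambda_{st}):\lambda\in\widehat A_{r,\mathrm{perm}},\ s,t\in\mathrm{Std}_{r,\mathrm{perm}}(\lambda)\}$. With these cell data the tower $(Q_r^S)_{r\ge0}$ is an increasing sequence of cellular algebras with consistent involutions and satisfies (D1)–(D6) over $S$ (with field of fractions $\mathbb K$). Here the generator of $\Delta_{Q_r}(\lambda)$ is the class of $\phi(m_\lambda)$ (where the basis element of $\Delta_{Q_r}(\lambda)$ indexed by $t$ is the class of $\phi(m_\lambda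 d_t)$), the cell generators are $\phi(m_\lambda)$, and the down- and up-branching factors are $\phi(d_{\mu\to\nu})$ and $\phi(u_{\mu\to\nu})$. The branching diagram of $(Q_r^S)$ is the permissible part of that of $(A_r)$: for permissible $\mu\in\widehat A_{r-1}$ and $\nu\in\widehat A_r$ one has $\mu\to\nu$ in it iff $\mu\to\nu$ in $\widehat A$. -/

import Mathlib

open scoped TensorProduct

/-! ### Cellular algebras -/

/-- The `R`-span of the basis elements `c^μ_{st}` with `μ ∈ Γ`. -/
def cellSpan {R A Λ : Type*} [CommRing R] [Ring A] [Algebra R A] {Std : Λ → Type*}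
    (b : Module.Basis (Σ l : Λ, Std l × Std l) R A) (Γ : Set Λ) : Submodule R A :=
  Submodule.span R (b '' {i | i.1 ∈ Γ})

/-- A cell datum for the `R`-algebra `A`, with partially ordered set `Λ` and index sets `Std l`.
The order `μ ⊵ l` is written `l ≤ μ`, so that `A^{▷ l}` is the span of the `c^μ_{st}` with
`μ ∈ Set.Ioi l`. -/
structure CellDatum (R A Λ : Type*) [CommRing R] [Ring A] [Algebra R A] [PartialOrder Λ]
    (Std : Λ → Type*) where
  /-- the algebra involution `*` -/
  invol : A →ₗ[R] A
  invol_mul : ∀ a b, invol (a * b) = invol b * invol a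
  invol_invol : ∀ a, invol (invol a) = a
  finite_shapes : Finite Λ
  finite_std : ∀ l, Finite (Std l)
  nonempty_std : ∀ l, Nonempty (Std l)
  /-- the cellular basis `c^l_{st}` -/
  basis : Module.Basis (Σ l : Λ, Std l × Std l) R A
  mul_mod : ∀ (l : Λ) (t : Std l) (a : A), ∃ r : Std l →₀ R, ∀ s : Std l,
    basis ⟨l, s, t⟩ * a - r.sum (fun v x => x • basis ⟨l, s, v⟩) ∈ cellSpan basis (Set.Ioi l)
  invol_mod : ∀ (l : Λ) (s t : Std l),
    invol (basis ⟨l, s, t⟩) - basis ⟨l, t, s⟩ ∈ cellSpan basis (Set.Ioi l)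

namespace CellDatum

variable {R A Λ : Type*} [CommRing R] [Ring A] [Algebra R A] [PartialOrder Λ] {Std : Λ → Type*}

/-- `A^{⊵ l}`. -/
def upper (C : CellDatum R A Λ Std) (l : Λ) : Submodule R A := cellSpan C.basis (Set.Ici l)

/-- `A^{▷ l}`. -/
def strictUpper (C : CellDatum R A Λ Std) (l : Λ) : Submodule R A := cellSpan C.basis (Set.Ioi l)

/-- The coefficients `v ↦ r(a; t, v)`. -/
noncomputable def coeff (C : CellDatum R A Λ Std) (l : Λ) (t : Std l) (a : A) : Std l →₀ R :=
  (C.mul_mod l t a).choose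

/-- The cell module `Δ(l)` is the free `R`-module `Std l →₀ R`, with `a ∈ A` acting from the right
by `c_t a = ∑ v, r(a; t, v) c_v`; `C.act l a` is the endomorphism `x ↦ x a`. -/
noncomputable def act (C : CellDatum R A Λ Std) (l : Λ) (a : A) : Module.End R (Std l →₀ R) :=
  Finsupp.linearCombination R (fun t => C.coeff l t a)

/-- `δ` generates the right `A`-module `Δ(l)`. -/
def IsCyclicGenerator (C : CellDatum R A Λ Std) (l : Λ) (δ : Std l →₀ R) : Prop :=
  ∀ x : Std l →₀ R, ∃ a : A, C.act l a δ = x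

/-- `m ∈ A^{⊵ l}` is a cell generator belonging to `δ ∈ Δ(l)`: there is an isomorphism
`α : A^{⊵ l} / A^{▷ l} → Δ(l)^* ⊗ Δ(l)` of `A`-`A`-bimodules with `α (m + A^{▷ l}) = δ^* ⊗ δ`.
As an `R`-module `Δ(l)^*` is `Δ(l)`, and its left action is `a x^* = (x a^*)^*`. -/
def IsCellGenerator (C : CellDatum R A Λ Std) (l : Λ) (δ : Std l →₀ R) (m : A) : Prop :=
  ∃ (hm : m ∈ C.upper l)
    (α : (C.upper l ⧸ (C.strictUpper l).submoduleOf (C.upper l)) ≃ₗ[R]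
      (Std l →₀ R) ⊗[R] (Std l →₀ R)),
    (∀ (a b : A) (x y : C.upper l), (y : A) = a * x * b →
      α (Submodule.Quotient.mk y) =
        TensorProduct.map (C.act l (C.invol a)) (C.act l b) (α (Submodule.Quotient.mk x))) ∧
    α (Submodule.Quotient.mk ⟨m, hm⟩) = δ ⊗ₜ[R] δ

/-- A cell filtration `0 = N 0 ⊆ N 1 ⊆ ⋯ ⊆ N len = M` of an `R`-module `M` on which `a ∈ A` acts
from the right by `ρ a`, with isomorphisms of right `A`-modules `N (j+1) / N j ≅ Δ(label j)`. -/
structure Filtration (C : CellDatum R A Λ Std) {M : Type*} [AddCommGroup M] [Module R M]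
    (ρ : A → Module.End R M) where
  len : ℕ
  N : Fin (len + 1) → Submodule R M
  N_zero : N 0 = ⊥
  N_last : N (Fin.last len) = ⊤
  mono : Monotone N
  stable : ∀ j a, ∀ x ∈ N j, ρ a x ∈ N j
  label : Fin len → Λ
  iso : ∀ j : Fin len,
    (N j.succ ⧸ (N j.castSucc).submoduleOf (N j.succ)) ≃ₗ[R] (Std (label j) →₀ R)
  iso_act : ∀ (j : Fin len) (a : A) (x y : N j.succ), (y : M) = ρ a x →
    iso j (Submodule.Quotient.mk y) = C.act (label j) a (iso j (Submodule.Quotient.mk x))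

/-- The filtration is order preserving: `label 0 ▷ label 1 ▷ ⋯`. -/
def Filtration.OrderPreserving {C : CellDatum R A Λ Std} {M : Type*} [AddCommGroup M] [Module R M]
    {ρ : A → Module.End R M} (f : C.Filtration ρ) : Prop :=
  StrictAnti f.label

end CellDatum

/-- A split semisimple algebra: a finite product of full matrix algebras over `K`. -/
def IsSplitSemisimple (K B : Type*) [Field K] [Ring B] [Algebra K B] : Prop :=
  ∃ (n : ℕ) (k : Fin n → ℕ), (∀ i, 0 < k i) ∧
    Nonempty (B ≃ₐ[K] ((i : Fin n) → Matrix (Fin (k i)) (Fin (k i)) K))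

/-! ### Towers of diagram algebras -/

section Tower

variable {R : Type*} [CommRing R] {A : ℕ → Type*} [∀ r, Ring (A r)] [∀ r, Algebra R (A r)]
  {Λ : ℕ → Type*} [∀ r, PartialOrder (Λ r)] {Std : ∀ r, Λ r → Type*}

/-- Cell filtrations of the restriction to `A r` of the cell module `Δ(μ)` of `A (r+1)`. -/
abbrev ResFiltration (ι : ∀ r, A r →ₐ[R] A (r + 1)) (C : ∀ r, CellDatum R (A r) (Λ r) (Std r))
    (r : ℕ) (μ : Λ (r + 1)) :=
  (C r).Filtration (fun a : A r => (C (r + 1)).act μ (ι r a))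

/-- Every restricted cell module has an order preserving cell filtration. -/
def RestrictionCoherent (ι : ∀ r, A r →ₐ[R] A (r + 1))
    (C : ∀ r, CellDatum R (A r) (Λ r) (Std r)) : Prop :=
  ∀ r μ, ∃ f : ResFiltration ι C r μ, f.OrderPreserving

/-- The branching diagram: there is an edge `l → μ` if `Δ(l)` appears as a subquotient of an order
preserving cell filtration of the restriction of `Δ(μ)`. -/
def Edge (ι : ∀ r, A r →ₐ[R] A (r + 1)) (C : ∀ r, CellDatum R (A r) (Λ r) (Std r))
    (r : ℕ) (l : Λ r) (μ : Λ (r + 1)) : Prop :=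
  ∃ f : ResFiltration ι C r μ, f.OrderPreserving ∧ ∃ j, f.label j = l

/-- Directed paths on the branching diagram from level `0` to the vertex `ν` on level `r`, that is,
standard tableaux of shape `ν`. -/
inductive StdPath (ι : ∀ r, A r →ₐ[R] A (r + 1)) (C : ∀ r, CellDatum R (A r) (Λ r) (Std r)) :
    (r : ℕ) → Λ r → Type _
  | nil (l : Λ 0) : StdPath ι C 0 l
  | snoc {r : ℕ} {l : Λ r} {μ : Λ (r + 1)} (t : StdPath ι C r l) (e : Edge ι C r l μ) :
      StdPath ι C (r + 1) μ

/-- All vertices of the path are permissible. -/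
def StdPath.IsPermissible {ι : ∀ r, A r →ₐ[R] A (r + 1)}
    {C : ∀ r, CellDatum R (A r) (Λ r) (Std r)} (perm : ∀ r, Set (Λ r)) :
    {r : ℕ} → {ν : Λ r} → StdPath ι C r ν → Prop
  | _, ν, .nil _ => ν ∈ perm 0
  | _, ν, .snoc t _ => t.IsPermissible perm ∧ ν ∈ perm _

/-- The elements chosen for a tower of cellular algebras: generators `δ l` of the cell modules, cell
generators `m l`, and branching factors `d l μ`, `u l μ`, which matter only for edges `l → μ`. -/
structure BranchingData (C : ∀ r, CellDatum R (A r) (Λ r) (Std r)) where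
  δ : ∀ r (l : Λ r), Std r l →₀ R
  m : ∀ r, Λ r → A r
  d : ∀ r, Λ r → Λ (r + 1) → A (r + 1)
  u : ∀ r, Λ r → Λ (r + 1) → A (r + 1)

/-- `d_t = d_{t(r-1) → t(r)} ⋯ d_{t(0) → t(1)}`. -/
def StdPath.d {ι : ∀ r, A r →ₐ[R] A (r + 1)} {C : ∀ r, CellDatum R (A r) (Λ r) (Std r)}
    (B : BranchingData C) : {r : ℕ} → {ν : Λ r} → StdPath ι C r ν → A r
  | _, _, .nil _ => 1
  | _, _, .snoc (r := r) (l := l) (μ := μ) t _ => B.d r l μ * ι r (t.d B)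

/-- The Murphy basis element `m^ν_{st} = d_s^* m_ν d_t`. -/
def murphy {ι : ∀ r, A r →ₐ[R] A (r + 1)} {C : ∀ r, CellDatum R (A r) (Λ r) (Std r)}
    (B : BranchingData C) {r : ℕ} {ν : Λ r} (s t : StdPath ι C r ν) : A r :=
  (C r).invol (s.d B) * B.m r ν * t.d B

/-- The elements `d l μ` are down-branching factors: for every `μ` there is an order preserving cell
filtration of the restriction of `Δ(μ)` such that, for each `j` and `l = label j`, the isomorphism
`N (j+1) / N j ≅ Δ(l)` maps the class of `δ(μ) d_{l → μ}` to `δ(l)`. -/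
def IsDownBranching (ι : ∀ r, A r →ₐ[R] A (r + 1)) (C : ∀ r, CellDatum R (A r) (Λ r) (Std r))
    (B : BranchingData C) : Prop :=
  ∀ r μ, ∃ f : ResFiltration ι C r μ, f.OrderPreserving ∧ ∀ j,
    ∃ h : (C (r + 1)).act μ (B.d r (f.label j) μ) (B.δ (r + 1) μ) ∈ f.N j.succ,
      f.iso j (Submodule.Quotient.mk ⟨_, h⟩) = B.δ r (f.label j)

/-- An increasing sequence of cellular algebras over `R` with consistent involutions is a sequence
of diagram algebras, with respect to the cell data `C` and the chosen elements `B`; `F` is the field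
of fractions of `R`. -/
structure IsDiagramTower (F : Type*) [Field F] [Algebra R F] (ι : ∀ r, A r →ₐ[R] A (r + 1))
    (C : ∀ r, CellDatum R (A r) (Λ r) (Std r)) (B : BranchingData C) : Prop where
  injective : ∀ r, Function.Injective (ι r)
  invol_comm : ∀ r a, ι r ((C r).invol a) = (C (r + 1)).invol (ι r a)
  /-- (D1): `A 0 = R` -/
  base : Function.Bijective (algebraMap R (A 0))
  /-- (D2): the algebras are cyclic cellular -/
  cyclic : ∀ r l, (C r).IsCyclicGenerator l (B.δ r l)
  cellGenerator : ∀ r l, (C r).IsCellGenerator l (B.δ r l) (B.m r l)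
  /-- (D3): `m_l = m_l^*` -/
  symmetric : ∀ r l, (C r).invol (B.m r l) = B.m r l
  /-- (D4): `A r ⊗ F` is split semisimple -/
  semisimple : ∀ r, IsSplitSemisimple F (F ⊗[R] A r)
  /-- (D5): the tower is restriction-coherent -/
  coherent : RestrictionCoherent ι C
  down : IsDownBranching ι C B
  /-- (D6): `m_μ d_{l → μ} = u_{l → μ}^* m_l` -/
  compatible : ∀ r l μ, Edge ι C r l μ →
    B.m (r + 1) μ * B.d r l μ = (C (r + 1)).invol (B.u r l μ) * ι r (B.m r l)

/-! ### Quotient towers -/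

section Quotient

variable {S K : Type*} [CommRing S] [Field K] [Algebra R S] [Algebra S K] [Algebra R K]
  [IsScalarTower R S K] {Q : ℕ → Type*} [∀ r, Ring (Q r)] [∀ r, Algebra K (Q r)]
  [∀ r, Algebra S (Q r)] [∀ r, IsScalarTower S K (Q r)]

/-- The canonical map from `S ⊗ A` to `K ⊗ A`. -/
noncomputable def toGeneric (R S K A : Type*) [CommRing R] [CommRing S] [Field K] [Algebra R S]
    [Algebra S K] [Algebra R K] [IsScalarTower R S K] [Ring A] [Algebra R A] :
    S ⊗[R] A →ₐ[S] K ⊗[R] A :=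
  Algebra.TensorProduct.map (Algebra.ofId S K) (AlgHom.id R A)

/-- The restriction of `φ r` to `S ⊗ A r`. -/
noncomputable def integralMap (S : Type*) [CommRing S] [Algebra R S] [Algebra S K]
    [IsScalarTower R S K] [∀ r, Algebra S (Q r)] [∀ r, IsScalarTower S K (Q r)]
    (φ : ∀ r, K ⊗[R] A r →ₐ[K] Q r) (r : ℕ) : S ⊗[R] A r →ₐ[S] Q r :=
  ((φ r).restrictScalars S).comp (toGeneric R S K (A r))

/-- `Q_r^S = φ (A_r^S)`. -/
noncomputable abbrev IntegralQuotient (S : Type*) [CommRing S] [Algebra R S] [Algebra S K]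
    [IsScalarTower R S K] [∀ r, Algebra S (Q r)] [∀ r, IsScalarTower S K (Q r)]
    (φ : ∀ r, K ⊗[R] A r →ₐ[K] Q r) (r : ℕ) : Subalgebra S (Q r) :=
  (integralMap S φ r).range

/-- `φ r` as a surjection from `S ⊗ A r` onto `Q_r^S`. -/
noncomputable abbrev integralProj (S : Type*) [CommRing S] [Algebra R S] [Algebra S K]
    [IsScalarTower R S K] [∀ r, Algebra S (Q r)] [∀ r, IsScalarTower S K (Q r)]
    (φ : ∀ r, K ⊗[R] A r →ₐ[K] Q r) (r : ℕ) : S ⊗[R] A r →ₐ[S] IntegralQuotient S φ r :=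
  (integralMap S φ r).rangeRestrict

/-- The homomorphisms `φ r` are consistent with the inclusions. -/
def IsConsistent (ι : ∀ r, A r →ₐ[R] A (r + 1)) (j : ∀ r, Q r →ₐ[K] Q (r + 1))
    (φ : ∀ r, K ⊗[R] A r →ₐ[K] Q r) : Prop :=
  ∀ r x, φ (r + 1) (Algebra.TensorProduct.map (AlgHom.id K K) (ι r) x) = j r (φ r x)

theorem integralMap_consistent {ι : ∀ r, A r →ₐ[R] A (r + 1)} {j : ∀ r, Q r →ₐ[K] Q (r + 1)}
    {φ : ∀ r, K ⊗[R] A r →ₐ[K] Q r} (h : IsConsistent ι j φ) (r : ℕ) (x : S ⊗[R] A r) :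
    integralMap S φ (r + 1) (Algebra.TensorProduct.map (AlgHom.id S S) (ι r) x) =
      j r (integralMap S φ r x) := by
  refine Eq.trans ?_ (h r (toGeneric R S K (A r) x))
  simp only [integralMap, AlgHom.comp_apply, AlgHom.restrictScalars_apply]
  congr 1
  induction x with
  | zero => simp
  | add a b ha hb => simp [ha, hb]
  | tmul s a => simp [toGeneric]

/-- The inclusion of `Q_r^S` in `Q_{r+1}^S`. -/
noncomputable def integralIncl (S : Type*) [CommRing S] [Algebra R S] [Algebra S K]
    [IsScalarTower R S K] [∀ r, Algebra S (Q r)] [∀ r, IsScalarTower S K (Q r)]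
    {ι : ∀ r, A r →ₐ[R] A (r + 1)} {j : ∀ r, Q r →ₐ[K] Q (r + 1)}
    {φ : ∀ r, K ⊗[R] A r →ₐ[K] Q r} (h : IsConsistent ι j φ) (r : ℕ) :
    IntegralQuotient S φ r →ₐ[S] IntegralQuotient S φ (r + 1) :=
  (((j r).restrictScalars S).comp (IntegralQuotient S φ r).val).codRestrict
    (IntegralQuotient S φ (r + 1)) (by
      rintro ⟨_, x, rfl⟩
      exact ⟨_, integralMap_consistent h r x⟩)

/-- (Q1) -/
structure IsPermissibleSet (ι : ∀ r, A r →ₐ[R] A (r + 1))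
    (C : ∀ r, CellDatum R (A r) (Λ r) (Std r)) (perm : ∀ r, Set (Λ r)) : Prop where
  root : ∀ l : Λ 0, l ∈ perm 0
  above : ∀ r, ∀ μ ∈ perm r, ∃ ν ∈ perm (r + 1), Edge ι C r μ ν
  below : ∀ r, ∀ μ ∈ perm (r + 1), ∃ l ∈ perm r, Edge ι C r l μ

/-- `μ` is not permissible, and it is the end of a path whose earlier vertices are all permissible.
These are the points `t(k)`, for `t` a path that is not permissible and `k` the first index such
that `t(k)` is not permissible. -/
def IsMarginal (ι : ∀ r, A r →ₐ[R] A (r + 1)) (C : ∀ r, CellDatum R (A r) (Λ r) (Std r))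
    (perm : ∀ r, Set (Λ r)) (r : ℕ) (μ : Λ (r + 1)) : Prop :=
  μ ∉ perm (r + 1) ∧ ∃ (l : Λ r) (t : StdPath ι C r l), t.IsPermissible perm ∧ Edge ι C r l μ

/-- `(Q_r^S)` is a quotient tower of `(A_r^S)`. -/
structure IsQuotientTower (S : Type*) [CommRing S] [Algebra R S] [Algebra S K]
    [IsScalarTower R S K] [∀ r, Algebra S (Q r)] [∀ r, IsScalarTower S K (Q r)]
    (ι : ∀ r, A r →ₐ[R] A (r + 1))
    (C : ∀ r, CellDatum R (A r) (Λ r) (Std r)) (B : BranchingData C)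
    (φ : ∀ r, K ⊗[R] A r →ₐ[K] Q r) (perm : ∀ r, Set (Λ r)) : Prop where
  /-- (Q1) -/
  permissible : IsPermissibleSet ι C perm
  /-- (Q2): `m_μ = b - b'` with `b ∈ ker φ` and `b' ∈ m_μ A_k^K ∩ (A_k^S)^{▷ μ}` -/
  marginal : ∀ r μ, IsMarginal ι C perm r μ →
    ∃ b b' : S ⊗[R] A (r + 1),
      1 ⊗ₜ[R] B.m (r + 1) μ = b - b' ∧
      integralMap S φ (r + 1) b = 0 ∧
      (∃ β : K ⊗[R] A (r + 1),
        toGeneric R S K (A (r + 1)) b' = (1 ⊗ₜ[R] B.m (r + 1) μ) * β) ∧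
      b' ∈ ((C (r + 1)).strictUpper μ).baseChange S
  /-- (Q3) -/
  dimension : ∀ r,
    Module.finrank (AlgebraicClosure K) (AlgebraicClosure K ⊗[K] Q r) =
      ∑ᶠ ν : perm r, Nat.card {t : StdPath ι C r ν.1 // t.IsPermissible perm} ^ 2

end Quotient

end Tower

/-! ### Congruences modulo an ideal -/

theorem Module.Basis.mem_ideal_smul_top {ι R M : Type*} [CommRing R] [AddCommMonoid M] [Module R M]
    (b : Module.Basis ι R M) (p : Ideal R) {x : M} :
    x ∈ p • (⊤ : Submodule R M) ↔ ∀ i, b.repr x i ∈ p := by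
  constructor
  · intro hx i
    induction hx using Submodule.smul_induction_on' with
    | smul c hc y _ => simpa using p.mul_mem_right _ hc
    | add y _ z _ hy hz => simpa using p.add_mem hy hz
  · intro h
    rw [← b.linearCombination_repr x, Finsupp.linearCombination_apply]
    exact Submodule.sum_mem _ fun i _ => Submodule.smul_mem_smul (h i) trivial

theorem LinearMap.map_mem_ideal_smul_top {R M N : Type*} [CommRing R] [AddCommMonoid M] [Module R M]
    [AddCommMonoid N] [Module R N] (f : M →ₗ[R] N) {p : Ideal R} {x : M}
    (hx : x ∈ p • (⊤ : Submodule R M)) : f x ∈ p • (⊤ : Submodule R N) := by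
  have : f x ∈ (p • (⊤ : Submodule R M)).map f := ⟨x, hx, rfl⟩
  rw [Submodule.map_smul''] at this
  exact Submodule.smul_mono le_rfl le_top this

theorem Module.Basis.mem_of_smul_mem_ideal_smul_top {ι R M : Type*} [CommRing R] [AddCommMonoid M]
    [Module R M] (b : Module.Basis ι R M) {p : Ideal R} [p.IsPrime] {s : R} (hs : s ∉ p) {x : M}
    (hx : s • x ∈ p • (⊤ : Submodule R M)) : x ∈ p • (⊤ : Submodule R M) := by
  rw [b.mem_ideal_smul_top] at hx ⊢
  intro i
  have := hx i
  rw [map_smul, Finsupp.smul_apply, smul_eq_mul] at this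
  exact (Ideal.IsPrime.mem_or_mem ‹_› this).resolve_left hs

theorem exists_quotient_equiv {R M N : Type*} [CommRing R] [AddCommGroup M] [Module R M]
    [AddCommGroup N] [Module R N] {U V : Submodule R M} (τ : M →ₗ[R] N)
    (hU : ∀ x ∈ V, τ x = 0 ↔ x ∈ U) (hV : ∀ w, ∃ x ∈ V, τ x = w) :
    ∃ α : (V ⧸ U.submoduleOf V) ≃ₗ[R] N, ∀ x : V, α (Submodule.Quotient.mk x) = τ x := by
  have hker : U.submoduleOf V = LinearMap.ker (τ.domRestrict V) := by
    ext x
    exact (hU x.1 x.2).symm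
  have hsurj : Function.Surjective (τ.domRestrict V) := fun w =>
    let ⟨x, hx, h⟩ := hV w
    ⟨⟨x, hx⟩, h⟩
  exact ⟨(Submodule.quotEquivOfEq _ _ hker).trans
    ((τ.domRestrict V).quotKerEquivOfSurjective hsurj), fun _ => rfl⟩

/-! ### Cellular algebras -/

section CellSpan

variable {R A Λ : Type*} [CommRing R] [Ring A] [Algebra R A] {Std : Λ → Type*}
  (b : Module.Basis (Σ l : Λ, Std l × Std l) R A)

theorem mem_cellSpan {Γ : Set Λ} {x : A} :
    x ∈ cellSpan b Γ ↔ ∀ i : (Σ l : Λ, Std l × Std l), i.1 ∉ Γ → b.repr x i = 0 := by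
  rw [cellSpan, b.mem_span_image]
  constructor
  · intro h i hi
    by_contra hne
    exact hi (h (Finsupp.mem_support_iff.2 hne))
  · intro h i hi
    by_contra hne
    exact Finsupp.mem_support_iff.1 hi (h i hne)

theorem basis_mem_cellSpan {Γ : Set Λ} {l : Λ} (hl : l ∈ Γ) (s t : Std l) :
    b ⟨l, s, t⟩ ∈ cellSpan b Γ :=
  Submodule.subset_span ⟨⟨l, s, t⟩, hl, rfl⟩

theorem cellSpan_mono {Γ Γ' : Set Λ} (h : Γ ⊆ Γ') : cellSpan b Γ ≤ cellSpan b Γ' :=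
  Submodule.span_mono (Set.image_mono fun _ hi => h hi)

theorem cellSpan_univ : cellSpan b Set.univ = ⊤ := by
  simp [cellSpan, b.span_eq]

open Classical in
/-- The projection onto `cellSpan b Γ` that kills the other basis elements. -/
noncomputable def cellProj (Γ : Set Λ) : A →ₗ[R] A :=
  b.constr R fun i => if i.1 ∈ Γ then b i else 0

open Classical in
theorem repr_cellProj (Γ : Set Λ) (x : A) (i : Σ l : Λ, Std l × Std l) :
    b.repr (cellProj b Γ x) i = if i.1 ∈ Γ then b.repr x i else 0 := by
  have : (Finsupp.lapply i) ∘ₗ b.repr.toLinearMap ∘ₗ cellProj b Γ =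
      (if i.1 ∈ Γ then (1 : R) else 0) • ((Finsupp.lapply i) ∘ₗ b.repr.toLinearMap) := by
    refine b.ext fun k => ?_
    simp only [cellProj, LinearMap.comp_apply, b.constr_basis, LinearMap.smul_apply,
      LinearEquiv.coe_coe, Finsupp.lapply_apply, b.repr_self]
    by_cases hki : k = i
    · subst hki
      split_ifs <;> simp
    · split_ifs <;> simp [Finsupp.single_eq_of_ne (Ne.symm hki)]
  have := LinearMap.congr_fun this x
  split_ifs with h <;> simpa [h] using this

theorem cellProj_mem (Γ : Set Λ) (x : A) : cellProj b Γ x ∈ cellSpan b Γ := by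
  classical
  rw [mem_cellSpan]
  intro i hi
  rw [repr_cellProj, if_neg hi]

theorem cellProj_eq {Γ : Set Λ} {x : A} (hx : x ∈ cellSpan b Γ) : cellProj b Γ x = x := by
  classical
  refine b.repr.injective (Finsupp.ext fun i => ?_)
  rw [repr_cellProj]
  split_ifs with h
  · rfl
  · exact ((mem_cellSpan b).1 hx i h).symm

/-- If `s x` lies in the span of a part of the basis modulo a prime `p` and `s ∉ p`, then so does
`x`. -/
theorem sub_cellProj_mem {p : Ideal R} [p.IsPrime] {s : R} (hs : s ∉ p) {Γ : Set Λ} {x y : A}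
    (hy : y ∈ cellSpan b Γ) (h : s • x - y ∈ p • (⊤ : Submodule R A)) :
    x - cellProj b Γ x ∈ p • (⊤ : Submodule R A) := by
  classical
  rw [b.mem_ideal_smul_top] at h ⊢
  intro i
  rw [map_sub, Finsupp.sub_apply, repr_cellProj]
  split_ifs with hi
  · simp
  · have := h i
    rw [map_sub, Finsupp.sub_apply, map_smul, Finsupp.smul_apply, (mem_cellSpan b).1 hy i hi,
      sub_zero, smul_eq_mul] at this
    rw [sub_zero]
    exact (Ideal.IsPrime.mem_or_mem ‹_› this).resolve_left hs

end CellSpan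

namespace CellDatum

variable {R A Λ : Type*} [CommRing R] [Ring A] [Algebra R A] [PartialOrder Λ] {Std : Λ → Type*}
  (C : CellDatum R A Λ Std)

theorem strictUpper_le_upper (l : Λ) : C.strictUpper l ≤ C.upper l :=
  cellSpan_mono _ fun _ h => Set.mem_Ici.2 (Set.mem_Ioi.1 h).le

theorem basis_mem_upper (l : Λ) (s t : Std l) : C.basis ⟨l, s, t⟩ ∈ C.upper l :=
  basis_mem_cellSpan _ (Set.mem_Ici.2 le_rfl) s t

theorem upper_le_cellSpan {Γ : Set Λ} (hΓ : IsUpperSet Γ) {l : Λ} (hl : l ∈ Γ) :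
    C.upper l ≤ cellSpan C.basis Γ :=
  cellSpan_mono _ fun _ h => hΓ (Set.mem_Ici.1 h) hl

theorem strictUpper_le_cellSpan {Γ : Set Λ} (hΓ : IsUpperSet Γ) {l : Λ} (hl : l ∈ Γ) :
    C.strictUpper l ≤ cellSpan C.basis Γ :=
  (C.strictUpper_le_upper l).trans (C.upper_le_cellSpan hΓ hl)

theorem coeff_spec (l : Λ) (s t : Std l) (a : A) :
    C.basis ⟨l, s, t⟩ * a - (C.coeff l t a).sum (fun v x => x • C.basis ⟨l, s, v⟩) ∈
      C.strictUpper l :=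
  (C.mul_mod l t a).choose_spec s

theorem act_single (l : Λ) (t : Std l) (a : A) (x : R) :
    C.act l a (Finsupp.single t x) = x • C.coeff l t a := by
  simp [act]

/-- The map from the cell module to the algebra that sends `c_t` to `c_{st}`. -/
noncomputable def row (l : Λ) (s : Std l) : (Std l →₀ R) →ₗ[R] A :=
  Finsupp.linearCombination R fun t => C.basis ⟨l, s, t⟩

theorem row_single (l : Λ) (s t : Std l) (x : R) :
    C.row l s (Finsupp.single t x) = x • C.basis ⟨l, s, t⟩ := by
  simp [row]

theorem row_mem_upper (l : Λ) (s : Std l) (x : Std l →₀ R) : C.row l s x ∈ C.upper l := by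
  rw [row, Finsupp.linearCombination_apply]
  exact Submodule.sum_mem _ fun t _ => Submodule.smul_mem _ _ (C.basis_mem_upper l s t)

theorem row_mul (l : Λ) (s : Std l) (x : Std l →₀ R) (a : A) :
    C.row l s x * a - C.row l s (C.act l a x) ∈ C.strictUpper l := by
  induction x using Finsupp.induction_linear with
  | zero => simp
  | add x y hx hy =>
    have := Submodule.add_mem _ hx hy
    simp only [map_add, add_mul]
    convert this using 1
    abel
  | single t r =>
    have := Submodule.smul_mem _ r (C.coeff_spec l s t a)
    rw [row_single, act_single, map_smul, smul_mul_assoc, ← smul_sub]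
    exact this

theorem cellSpan_mul {Γ : Set Λ} (hΓ : IsUpperSet Γ) {x : A} (hx : x ∈ cellSpan C.basis Γ) (a : A) :
    x * a ∈ cellSpan C.basis Γ := by
  induction hx using Submodule.span_induction with
  | mem x hx =>
    obtain ⟨⟨l, s, t⟩, hl, rfl⟩ := hx
    have h := C.row_mul l s (Finsupp.single t 1) a
    rw [row_single, one_smul] at h
    rw [← sub_add_cancel (C.basis ⟨l, s, t⟩ * a) (C.row l s (C.act l a (Finsupp.single t 1)))]
    exact add_mem (C.strictUpper_le_cellSpan hΓ hl h)
      (C.upper_le_cellSpan hΓ hl (C.row_mem_upper _ _ _))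
  | zero => simp
  | add x y _ _ hx hy => rw [add_mul]; exact add_mem hx hy
  | smul r x _ hx => rw [smul_mul_assoc]; exact Submodule.smul_mem _ _ hx

theorem invol_mem_cellSpan {Γ : Set Λ} (hΓ : IsUpperSet Γ) {x : A} (hx : x ∈ cellSpan C.basis Γ) :
    C.invol x ∈ cellSpan C.basis Γ := by
  suffices h : cellSpan C.basis Γ ≤ (cellSpan C.basis Γ).comap C.invol from h hx
  refine Submodule.span_le.2 ?_
  rintro _ ⟨⟨l, s, t⟩, hl, rfl⟩
  have h := add_mem (C.strictUpper_le_cellSpan hΓ hl (C.invol_mod l s t))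
    (basis_mem_cellSpan C.basis (Γ := Γ) hl t s)
  rw [sub_add_cancel] at h
  exact h

theorem mul_cellSpan {Γ : Set Λ} (hΓ : IsUpperSet Γ) {x : A} (hx : x ∈ cellSpan C.basis Γ) (a : A) :
    a * x ∈ cellSpan C.basis Γ := by
  rw [← C.invol_invol (a * x), C.invol_mul]
  exact C.invol_mem_cellSpan hΓ (C.cellSpan_mul hΓ (C.invol_mem_cellSpan hΓ hx) _)

theorem upper_mul {l : Λ} {x : A} (hx : x ∈ C.upper l) (a : A) : x * a ∈ C.upper l :=
  C.cellSpan_mul (isUpperSet_Ici l) hx a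

theorem mul_upper {l : Λ} {x : A} (hx : x ∈ C.upper l) (a : A) : a * x ∈ C.upper l :=
  C.mul_cellSpan (isUpperSet_Ici l) hx a

theorem strictUpper_mul {l : Λ} {x : A} (hx : x ∈ C.strictUpper l) (a : A) :
    x * a ∈ C.strictUpper l :=
  C.cellSpan_mul (isUpperSet_Ioi l) hx a

theorem mul_strictUpper {l : Λ} {x : A} (hx : x ∈ C.strictUpper l) (a : A) :
    a * x ∈ C.strictUpper l :=
  C.mul_cellSpan (isUpperSet_Ioi l) hx a

theorem invol_mem_strictUpper {l : Λ} {x : A} (hx : x ∈ C.strictUpper l) :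
    C.invol x ∈ C.strictUpper l :=
  C.invol_mem_cellSpan (isUpperSet_Ioi l) hx

theorem invol_mem_upper {l : Λ} {x : A} (hx : x ∈ C.upper l) : C.invol x ∈ C.upper l :=
  C.invol_mem_cellSpan (isUpperSet_Ici l) hx

theorem invol_one : C.invol 1 = 1 := by
  have h := C.invol_mul (C.invol 1) 1
  rw [mul_one, C.invol_invol, mul_one] at h
  exact h.symm

/-! ### The layer of a cell -/

/-- The coefficients of the basis elements `c^l_{st}`, as an element of `Δ(l) ⊗ Δ(l)`. -/
noncomputable def layer (l : Λ) : A →ₗ[R] (Std l →₀ R) ⊗[R] (Std l →₀ R) :=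
  (finsuppTensorFinsupp' R (Std l) (Std l)).symm.toLinearMap ∘ₗ
    Finsupp.lcomapDomain (fun st : Std l × Std l => (⟨l, st⟩ : Σ l, Std l × Std l))
      (sigma_mk_injective (β := fun l : Λ => Std l × Std l)) ∘ₗ C.basis.repr.toLinearMap

theorem layer_eq_zero_iff {l : Λ} {x : A} :
    C.layer l x = 0 ↔ ∀ s t, C.basis.repr x ⟨l, s, t⟩ = 0 := by
  rw [layer, LinearMap.comp_apply, LinearEquiv.coe_coe, LinearEquiv.map_eq_zero_iff]
  constructor
  · intro h s t
    simpa using DFunLike.congr_fun h (s, t)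
  · intro h
    ext ⟨s, t⟩
    simpa using h s t

theorem layer_basis (l : Λ) (s t : Std l) :
    C.layer l (C.basis ⟨l, s, t⟩) = Finsupp.single s 1 ⊗ₜ Finsupp.single t 1 := by
  classical
  rw [layer, LinearMap.comp_apply, LinearEquiv.coe_coe, LinearEquiv.symm_apply_eq]
  ext ⟨u, v⟩
  simp only [LinearMap.comp_apply, LinearEquiv.coe_coe, Module.Basis.repr_self,
    Finsupp.lcomapDomain_apply, Finsupp.comapDomain_apply, finsuppTensorFinsupp'_single_tmul_single]
  by_cases h : (s, t) = (u, v)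
  · cases h
    simp
  · rw [Finsupp.single_eq_of_ne, Finsupp.single_eq_of_ne]
    · exact Ne.symm h
    · exact fun h' => h (sigma_mk_injective (β := fun l : Λ => Std l × Std l) h').symm

theorem layer_row (l : Λ) (s : Std l) (x : Std l →₀ R) :
    C.layer l (C.row l s x) = Finsupp.single s 1 ⊗ₜ x := by
  induction x using Finsupp.induction_linear with
  | zero => simp
  | add x y hx hy => simp [hx, hy, TensorProduct.tmul_add]
  | single t r =>
    rw [row_single, map_smul, layer_basis, ← TensorProduct.tmul_smul, Finsupp.smul_single,
      smul_eq_mul, mul_one]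

theorem layer_strictUpper {l : Λ} {x : A} (hx : x ∈ C.strictUpper l) : C.layer l x = 0 :=
  C.layer_eq_zero_iff.2 fun s t => (mem_cellSpan _).1 hx ⟨l, s, t⟩ (lt_irrefl l)

theorem layer_eq_zero_iff_mem {l : Λ} {x : A} (hx : x ∈ C.upper l) :
    C.layer l x = 0 ↔ x ∈ C.strictUpper l := by
  refine ⟨fun h => (mem_cellSpan _).2 ?_, C.layer_strictUpper⟩
  rintro ⟨k, s, t⟩ hk
  by_cases hlk : l ≤ k
  · obtain rfl : l = k := hlk.eq_of_not_lt hk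
    exact C.layer_eq_zero_iff.1 h s t
  · exact (mem_cellSpan _).1 hx _ hlk

theorem exists_layer_eq (l : Λ) (w : (Std l →₀ R) ⊗[R] (Std l →₀ R)) :
    ∃ x ∈ C.upper l, C.layer l x = w := by
  induction w using TensorProduct.induction_on with
  | zero => exact ⟨0, zero_mem _, map_zero _⟩
  | add v w hv hw =>
    obtain ⟨x, hx, rfl⟩ := hv
    obtain ⟨y, hy, rfl⟩ := hw
    exact ⟨x + y, add_mem hx hy, map_add _ _ _⟩
  | tmul v w =>
    induction v using Finsupp.induction_linear with
    | zero => exact ⟨0, zero_mem _, by simp⟩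
    | add v v' hv hv' =>
      obtain ⟨x, hx, hxv⟩ := hv
      obtain ⟨y, hy, hyv⟩ := hv'
      exact ⟨x + y, add_mem hx hy, by rw [map_add, hxv, hyv, TensorProduct.add_tmul]⟩
    | single s r =>
      refine ⟨r • C.row l s w, Submodule.smul_mem _ _ (C.row_mem_upper l s w), ?_⟩
      rw [map_smul, layer_row, TensorProduct.smul_tmul', Finsupp.smul_single, smul_eq_mul, mul_one]

theorem layer_mul {l : Λ} {x : A} (hx : x ∈ C.upper l) (a : A) :
    C.layer l (x * a) = TensorProduct.map LinearMap.id (C.act l a) (C.layer l x) := by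
  induction hx using Submodule.span_induction with
  | mem x hx =>
    obtain ⟨⟨k, s, t⟩, hk, rfl⟩ := hx
    rcases (show l ≤ k from hk).eq_or_lt with rfl | hlt
    · have h := C.layer_strictUpper (C.row_mul l s (Finsupp.single t 1) a)
      rw [map_sub, sub_eq_zero, layer_row, row_single, one_smul] at h
      rw [h, layer_basis, TensorProduct.map_tmul, LinearMap.id_apply]
    · have h : C.basis ⟨k, s, t⟩ ∈ C.strictUpper l := basis_mem_cellSpan _ hlt s t
      rw [C.layer_strictUpper h, C.layer_strictUpper (C.strictUpper_mul h a), map_zero]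
  | zero => simp
  | add x y _ _ hx hy => rw [add_mul, map_add, map_add, map_add, hx, hy]
  | smul r x _ hx => rw [smul_mul_assoc, map_smul, map_smul, map_smul, hx]

theorem layer_invol {l : Λ} {x : A} (hx : x ∈ C.upper l) :
    C.layer l (C.invol x) = TensorProduct.comm R _ _ (C.layer l x) := by
  induction hx using Submodule.span_induction with
  | mem x hx =>
    obtain ⟨⟨k, s, t⟩, hk, rfl⟩ := hx
    rcases (show l ≤ k from hk).eq_or_lt with rfl | hlt
    · have h := C.layer_strictUpper (C.invol_mod l s t)
      rw [map_sub, sub_eq_zero] at h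
      rw [h, layer_basis, layer_basis, TensorProduct.comm_tmul]
    · have h : C.basis ⟨k, s, t⟩ ∈ C.strictUpper l := basis_mem_cellSpan _ hlt s t
      rw [C.layer_strictUpper h, C.layer_strictUpper (C.invol_mem_strictUpper h), map_zero]
  | zero => simp
  | add x y _ _ hx hy => rw [map_add, map_add, map_add, map_add, hx, hy]
  | smul r x _ hx => rw [map_smul, map_smul, map_smul, map_smul, hx]

theorem mul_layer {l : Λ} {x : A} (hx : x ∈ C.upper l) (a : A) :
    C.layer l (a * x) =
      TensorProduct.map (C.act l (C.invol a)) LinearMap.id (C.layer l x) := by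
  rw [← C.invol_invol (a * x), C.invol_mul,
    C.layer_invol (C.upper_mul (C.invol_mem_upper hx) _), C.layer_mul (C.invol_mem_upper hx),
    C.layer_invol hx]
  generalize C.layer l x = w
  induction w using TensorProduct.induction_on with
  | zero => simp
  | add v w hv hw => simp only [map_add, hv, hw]
  | tmul v w => simp

/-- A linear map inducing an isomorphism of bimodules `A^{⊵ l} / A^{▷ l} ≅ Δ(l)^* ⊗ Δ(l)`. -/
structure IsLayerMap (l : Λ) (τ : A →ₗ[R] (Std l →₀ R) ⊗[R] (Std l →₀ R)) : Prop where
  eq_zero_iff : ∀ x ∈ C.upper l, τ x = 0 ↔ x ∈ C.strictUpper l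
  surj : ∀ w, ∃ x ∈ C.upper l, τ x = w
  bimod : ∀ a b, ∀ x ∈ C.upper l,
    τ (a * x * b) = TensorProduct.map (C.act l (C.invol a)) (C.act l b) (τ x)

theorem isLayerMap_layer (l : Λ) : C.IsLayerMap l (C.layer l) where
  eq_zero_iff _ hx := C.layer_eq_zero_iff_mem hx
  surj := C.exists_layer_eq l
  bimod a b x hx := by
    rw [C.layer_mul (C.mul_upper hx a), C.mul_layer hx, ← LinearMap.comp_apply,
      ← TensorProduct.map_comp, LinearMap.id_comp, LinearMap.comp_id]

theorem isCellGenerator_iff {l : Λ} {δ : Std l →₀ R} {m : A} :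
    C.IsCellGenerator l δ m ↔
      m ∈ C.upper l ∧ ∃ τ, C.IsLayerMap l τ ∧ τ m = δ ⊗ₜ[R] δ := by
  constructor
  · rintro ⟨hm, α, hα, hαm⟩
    let P : A →ₗ[R] C.upper l := (cellProj C.basis (Set.Ici l)).codRestrict _ (cellProj_mem _ _)
    have hP : ∀ x (hx : x ∈ C.upper l), P x = ⟨x, hx⟩ := fun x hx =>
      Subtype.ext (cellProj_eq _ hx)
    have key : ∀ x (hx : x ∈ C.upper l),
        (α.toLinearMap ∘ₗ Submodule.mkQ _ ∘ₗ P) x = α (Submodule.Quotient.mk ⟨x, hx⟩) := by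
      intro x hx
      simp [hP x hx]
    refine ⟨hm, α.toLinearMap ∘ₗ Submodule.mkQ _ ∘ₗ P, ⟨?_, ?_, ?_⟩, ?_⟩
    · intro x hx
      rw [key x hx, LinearEquiv.map_eq_zero_iff, Submodule.Quotient.mk_eq_zero]
      exact Iff.rfl
    · intro w
      obtain ⟨⟨x, hx⟩, hxw⟩ := Submodule.Quotient.mk_surjective _ (α.symm w)
      exact ⟨x, hx, by rw [key x hx, hxw, LinearEquiv.apply_symm_apply]⟩
    · intro a b x hx
      rw [key x hx, key _ (C.upper_mul (C.mul_upper hx a) b)]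
      exact hα a b ⟨x, hx⟩ _ rfl
    · rw [key m hm, hαm]
  · rintro ⟨hm, τ, hτ, hτm⟩
    obtain ⟨α, hα⟩ := exists_quotient_equiv (N := (Std l →₀ R) ⊗[R] (Std l →₀ R)) τ
      hτ.eq_zero_iff hτ.surj
    refine ⟨hm, α, ?_, ?_⟩
    · intro a b x y hxy
      rw [hα, hα, hxy]
      exact hτ.bimod a b x.1 x.2
    · rw [hα]
      exact hτm

/-! ### Cell modules -/

theorem eq_zero_of_row_mem {l : Λ} (s : Std l) {x : Std l →₀ R}
    (h : C.row l s x ∈ C.strictUpper l) : x = 0 := by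
  have h0 := C.layer_strictUpper h
  rw [layer_row] at h0
  have h1 := congrArg (finsuppTensorFinsupp' R (Std l) (Std l)) h0
  rw [map_zero] at h1
  ext t
  simpa using DFunLike.congr_fun h1 (s, t)

theorem act_unique {l : Λ} (s : Std l) {x y : Std l →₀ R} {a : A}
    (h : C.row l s x * a - C.row l s y ∈ C.strictUpper l) : C.act l a x = y := by
  have h' := Submodule.sub_mem _ h (C.row_mul l s x a)
  rw [sub_sub_sub_cancel_left, ← map_sub] at h'
  exact sub_eq_zero.1 (C.eq_zero_of_row_mem s h')

theorem act_one_apply (l : Λ) (x : Std l →₀ R) : C.act l 1 x = x := by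
  obtain ⟨s⟩ := C.nonempty_std l
  exact C.act_unique s (by simp)

theorem act_mul (l : Λ) (a b : A) (x : Std l →₀ R) :
    C.act l (a * b) x = C.act l b (C.act l a x) := by
  obtain ⟨s⟩ := C.nonempty_std l
  refine C.act_unique s ?_
  have h1 := C.strictUpper_mul (C.row_mul l s x a) b
  have h2 := C.row_mul l s (C.act l a x) b
  convert add_mem h1 h2 using 1
  noncomm_ring

theorem act_add (l : Λ) (a b : A) (x : Std l →₀ R) :
    C.act l (a + b) x = C.act l a x + C.act l b x := by
  obtain ⟨s⟩ := C.nonempty_std l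
  refine C.act_unique s ?_
  have := add_mem (C.row_mul l s x a) (C.row_mul l s x b)
  rw [map_add, mul_add]
  convert this using 1
  abel

theorem act_smul (l : Λ) (r : R) (a : A) (x : Std l →₀ R) :
    C.act l (r • a) x = r • C.act l a x := by
  obtain ⟨s⟩ := C.nonempty_std l
  refine C.act_unique s ?_
  have := Submodule.smul_mem _ r (C.row_mul l s x a)
  rwa [smul_sub, ← map_smul, ← mul_smul_comm] at this

/-- The action on a vector of a cell module, as a linear map in the algebra element. -/
noncomputable def orbit (l : Λ) (x : Std l →₀ R) : A →ₗ[R] (Std l →₀ R) where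
  toFun a := C.act l a x
  map_add' a b := C.act_add l a b x
  map_smul' r a := C.act_smul l r a x

@[simp] theorem orbit_apply (l : Λ) (x : Std l →₀ R) (a : A) : C.orbit l x a = C.act l a x := rfl

theorem act_eq_zero_of_mem_upper {l k : Λ} (h : ¬ k ≤ l) {a : A} (ha : a ∈ C.upper k) :
    C.act l a = 0 := by
  obtain ⟨s⟩ := C.nonempty_std l
  refine LinearMap.ext fun x => C.act_unique s ?_
  rw [LinearMap.zero_apply, map_zero, sub_zero]
  refine (mem_cellSpan _).2 fun i hi => ?_
  by_cases hki : k ≤ i.1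
  · refine (mem_cellSpan _).1 (C.upper_mul (C.row_mem_upper l s x) a) i fun hli => ?_
    rcases (show l ≤ i.1 from hli).eq_or_lt with h' | h'
    · exact h (h' ▸ hki)
    · exact hi h'
  · exact (mem_cellSpan _).1 (C.mul_upper ha (C.row l s x)) i hki

end CellDatum

/-! ### Flags spanned by parts of a basis -/

section Flag

variable {R M : Type*} [CommRing R] [AddCommGroup M] [Module R M] {n : ℕ} {κ : Fin n → Type*}
  (b : Module.Basis (Σ i, κ i) R M)

/-- The span of the first `j` blocks of a basis. -/
def flag (j : Fin (n + 1)) : Submodule R M :=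
  Submodule.span R (b '' {i | i.1.castSucc < j})

theorem mem_flag {j : Fin (n + 1)} {x : M} :
    x ∈ flag b j ↔ ∀ i : (Σ i, κ i), j ≤ i.1.castSucc → b.repr x i = 0 := by
  rw [flag, b.mem_span_image]
  constructor
  · intro h i hi
    by_contra hne
    exact (not_lt.2 hi) (h (Finsupp.mem_support_iff.2 hne))
  · intro h i hi
    by_contra hne
    exact Finsupp.mem_support_iff.1 hi (h i (not_lt.1 hne))

theorem basis_mem_flag {j : Fin (n + 1)} {i : Fin n} (h : i.castSucc < j) (k : κ i) :
    b ⟨i, k⟩ ∈ flag b j :=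
  Submodule.subset_span ⟨⟨i, k⟩, h, rfl⟩

theorem flag_mono : Monotone (flag b) := fun _ _ h =>
  Submodule.span_mono (Set.image_mono fun _ hi => lt_of_lt_of_le hi h)

theorem flag_zero : flag b 0 = ⊥ := by
  rw [eq_bot_iff]
  exact Submodule.span_le.2 (by rintro _ ⟨i, hi, -⟩; exact absurd hi (Fin.not_lt_zero _))

theorem flag_last : flag b (Fin.last n) = ⊤ := by
  rw [eq_top_iff, ← b.span_eq]
  exact Submodule.span_mono (by rintro _ ⟨i, rfl⟩; exact ⟨i, Fin.castSucc_lt_last _, rfl⟩)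

/-- The coordinates in block `j`. -/
noncomputable def blockCoord (j : Fin n) : M →ₗ[R] (κ j →₀ R) :=
  Finsupp.lcomapDomain (fun k : κ j => (⟨j, k⟩ : Σ i, κ i)) (sigma_mk_injective (β := κ)) ∘ₗ
    b.repr.toLinearMap

theorem blockCoord_apply (j : Fin n) (x : M) (k : κ j) : blockCoord b j x k = b.repr x ⟨j, k⟩ := rfl

theorem blockCoord_basis (j : Fin n) (k : κ j) : blockCoord b j (b ⟨j, k⟩) = Finsupp.single k 1 := by
  classical
  ext k'
  rw [blockCoord_apply, b.repr_self, Finsupp.single_apply, Finsupp.single_apply]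
  exact if_congr (sigma_mk_injective (β := κ)).eq_iff rfl rfl

/-- The embedding of block `j`. -/
noncomputable def blockEmb (j : Fin n) : (κ j →₀ R) →ₗ[R] M :=
  Finsupp.linearCombination R fun k => b ⟨j, k⟩

theorem blockEmb_single (j : Fin n) (k : κ j) (r : R) :
    blockEmb b j (Finsupp.single k r) = r • b ⟨j, k⟩ := by
  simp [blockEmb]

theorem blockEmb_mem (j : Fin n) (x : κ j →₀ R) : blockEmb b j x ∈ flag b j.succ := by
  rw [blockEmb, Finsupp.linearCombination_apply]
  exact Submodule.sum_mem _ fun k _ =>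
    Submodule.smul_mem _ _ (basis_mem_flag b (Fin.castSucc_lt_succ) k)

theorem blockCoord_emb (j : Fin n) (x : κ j →₀ R) : blockCoord b j (blockEmb b j x) = x := by
  have : blockCoord b j ∘ₗ blockEmb b j = LinearMap.id := by
    refine Finsupp.lhom_ext fun k r => ?_
    rw [LinearMap.comp_apply, blockEmb_single, map_smul, blockCoord_basis, Finsupp.smul_single,
      smul_eq_mul, mul_one, LinearMap.id_apply]
  exact LinearMap.congr_fun this x

theorem blockCoord_eq_zero_iff {j : Fin n} {x : M} (hx : x ∈ flag b j.succ) :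
    blockCoord b j x = 0 ↔ x ∈ flag b j.castSucc := by
  rw [mem_flag]
  constructor
  · rintro h ⟨i, k⟩ hi
    rcases (Fin.castSucc_le_castSucc_iff.1 hi).eq_or_lt with rfl | hlt
    · exact DFunLike.congr_fun h k
    · exact (mem_flag b).1 hx _ (Fin.succ_le_castSucc_iff.2 hlt)
  · intro h
    ext k
    exact h ⟨j, k⟩ le_rfl

end Flag

/-! ### Cell filtrations -/

namespace CellDatum

variable {R A Λ : Type*} [CommRing R] [Ring A] [Algebra R A] [PartialOrder Λ] {Std : Λ → Type*}
  {C : CellDatum R A Λ Std} {M : Type*} [AddCommGroup M] [Module R M] {ρ : A → Module.End R M}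

namespace Filtration

set_option linter.unusedSectionVars false in
theorem exists_iso_of_basis {n : ℕ} (label : Fin n → Λ)
    (b : Module.Basis (Σ i, Std (label i)) R M) (j : Fin n) :
    ∃ α : (flag b j.succ ⧸ (flag b j.castSucc).submoduleOf (flag b j.succ)) ≃ₗ[R]
        (Std (label j) →₀ R),
      ∀ x : flag b j.succ, α (Submodule.Quotient.mk x) = blockCoord b j x :=
  exists_quotient_equiv _ (fun _ hx => blockCoord_eq_zero_iff b hx)
    fun w => ⟨_, blockEmb_mem b j w, blockCoord_emb b j w⟩

theorem action_sub_mem_flag {n : ℕ} {label : Fin n → Λ} {b : Module.Basis (Σ i, Std (label i)) R M}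
    (h : ∀ j t a, ρ a (b ⟨j, t⟩) - blockEmb b j (C.act (label j) a (Finsupp.single t 1)) ∈
      flag b j.castSucc) (j : Fin n) (a : A) (x : Std (label j) →₀ R) :
    ρ a (blockEmb b j x) - blockEmb b j (C.act (label j) a x) ∈ flag b j.castSucc := by
  induction x using Finsupp.induction_linear with
  | zero => simp
  | add x y hx hy =>
    have := add_mem hx hy
    simp only [map_add]
    convert this using 1
    abel
  | single t r =>
    have := Submodule.smul_mem _ r (h j t a)
    have hr : Finsupp.single t r = r • Finsupp.single t (1 : R) := by
      rw [Finsupp.smul_single, smul_eq_mul, mul_one]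
    rwa [hr, map_smul, map_smul, map_smul, map_smul, ← smul_sub, blockEmb_single, one_smul]

theorem action_mem_flag {n : ℕ} {label : Fin n → Λ} {b : Module.Basis (Σ i, Std (label i)) R M}
    (h : ∀ j t a, ρ a (b ⟨j, t⟩) - blockEmb b j (C.act (label j) a (Finsupp.single t 1)) ∈
      flag b j.castSucc) (j : Fin (n + 1)) (a : A) {x : M} (hx : x ∈ flag b j) :
    ρ a x ∈ flag b j := by
  suffices h' : flag b j ≤ (flag b j).comap (ρ a) from h' hx
  refine Submodule.span_le.2 ?_
  rintro _ ⟨⟨i, t⟩, hi, rfl⟩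
  have h1 := add_mem (flag_mono b (le_of_lt hi) (h i t a))
    (flag_mono b (Fin.castSucc_lt_iff_succ_le.1 hi)
      (blockEmb_mem b i (C.act (label i) a (Finsupp.single t 1))))
  rw [sub_add_cancel] at h1
  exact h1

/-- The cell filtration given by a basis such that the action of `A` on the basis is that on the
cell modules, up to elements of earlier blocks. -/
noncomputable def ofBasis {n : ℕ} (label : Fin n → Λ) (b : Module.Basis (Σ i, Std (label i)) R M)
    (h : ∀ j t a, ρ a (b ⟨j, t⟩) - blockEmb b j (C.act (label j) a (Finsupp.single t 1)) ∈
      flag b j.castSucc) : C.Filtration ρ where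
  len := n
  N := flag b
  N_zero := flag_zero b
  N_last := flag_last b
  mono := flag_mono b
  stable j a _ hx := action_mem_flag h j a hx
  label := label
  iso j := (exists_iso_of_basis label b j).choose
  iso_act j a x y hxy := by
    have hα := (exists_iso_of_basis label b j).choose_spec
    rw [hα, hα, hxy]
    have h0 : (x : M) - blockEmb b j (blockCoord b j x) ∈ flag b j.castSucc := by
      rw [← blockCoord_eq_zero_iff b (sub_mem x.2 (blockEmb_mem b j _)), map_sub, blockCoord_emb,
        sub_self]
    have h1 := action_mem_flag h _ a h0
    have h2 := add_mem h1 (action_sub_mem_flag h j a (blockCoord b j x))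
    rw [map_sub, sub_add_sub_cancel] at h2
    have h3 := (blockCoord_eq_zero_iff b (flag_mono b (Fin.castSucc_le_succ j) h2)).2 h2
    rwa [map_sub, blockCoord_emb, sub_eq_zero] at h3

theorem ofBasis_iso {n : ℕ} (label : Fin n → Λ) (b : Module.Basis (Σ i, Std (label i)) R M)
    (h : ∀ j t a, ρ a (b ⟨j, t⟩) - blockEmb b j (C.act (label j) a (Finsupp.single t 1)) ∈
      flag b j.castSucc) (j : Fin n) (x : flag b j.succ) :
    (ofBasis label b h).iso j (Submodule.Quotient.mk x) = blockCoord b j x :=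
  (exists_iso_of_basis label b j).choose_spec x

variable (f : C.Filtration ρ)

/-- The projection from a step of the filtration to its cell module. -/
noncomputable def gr (j : Fin f.len) : f.N j.succ →ₗ[R] (Std (f.label j) →₀ R) :=
  (f.iso j).toLinearMap ∘ₗ Submodule.mkQ _

theorem gr_apply (j : Fin f.len) (x : f.N j.succ) :
    f.gr j x = f.iso j (Submodule.Quotient.mk x) := rfl

theorem gr_eq_zero_iff (j : Fin f.len) (x : f.N j.succ) :
    f.gr j x = 0 ↔ (x : M) ∈ f.N j.castSucc := by
  rw [gr_apply, LinearEquiv.map_eq_zero_iff, Submodule.Quotient.mk_eq_zero]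
  exact Iff.rfl

theorem sub_mem_of_gr_eq {j : Fin f.len} {x y : M} (hx : x ∈ f.N j.succ) (hy : y ∈ f.N j.succ)
    (h : f.gr j ⟨x, hx⟩ = f.gr j ⟨y, hy⟩) : x - y ∈ f.N j.castSucc :=
  (f.gr_eq_zero_iff j (⟨x, hx⟩ - ⟨y, hy⟩)).1 (by rw [map_sub, h, sub_self])

theorem gr_surjective (j : Fin f.len) : Function.Surjective (f.gr j) :=
  (f.iso j).surjective.comp (Submodule.Quotient.mk_surjective _)

theorem gr_act (j : Fin f.len) (a : A) (x : M) (hx : x ∈ f.N j.succ) :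
    f.gr j ⟨ρ a x, f.stable _ a x hx⟩ = C.act (f.label j) a (f.gr j ⟨x, hx⟩) :=
  f.iso_act j a _ _ rfl

section Lift

variable {κ : Fin f.len → Type*} (β : ∀ j, Module.Basis (κ j) R (Std (f.label j) →₀ R))
  (x : ∀ j, κ j → M) (hx : ∀ j k, x j k ∈ f.N j.succ)
  (hβ : ∀ j k, f.gr j ⟨x j k, hx j k⟩ = β j k)

include hβ in
theorem exists_gr_linearCombination (j : Fin f.len) (c : κ j →₀ R) :
    ∃ h : Finsupp.linearCombination R (x j) c ∈ f.N j.succ,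
      f.gr j ⟨_, h⟩ = Finsupp.linearCombination R (β j) c := by
  let L : (κ j →₀ R) →ₗ[R] f.N j.succ := Finsupp.linearCombination R fun k => ⟨x j k, hx j k⟩
  have h1 : (f.N j.succ).subtype ∘ₗ L = Finsupp.linearCombination R (x j) :=
    Finsupp.lhom_ext fun k r => by simp [L]
  have h2 : f.gr j ∘ₗ L = Finsupp.linearCombination R (β j) :=
    Finsupp.lhom_ext fun k r => by
      rw [LinearMap.comp_apply, Finsupp.linearCombination_single, Finsupp.linearCombination_single,
        map_smul, hβ]
  have h3 : (L c : M) = Finsupp.linearCombination R (x j) c := LinearMap.congr_fun h1 c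
  refine ⟨h3 ▸ (L c).2, ?_⟩
  rw [← h2, LinearMap.comp_apply]
  exact congrArg _ (Subtype.ext h3.symm)

include hβ in
theorem sub_lift_mem (j : Fin f.len) {y : M} (hy : y ∈ f.N j.succ) :
    y - Finsupp.linearCombination R (x j) ((β j).repr (f.gr j ⟨y, hy⟩)) ∈ f.N j.castSucc := by
  obtain ⟨h, hh⟩ := f.exists_gr_linearCombination β x hx hβ j ((β j).repr (f.gr j ⟨y, hy⟩))
  rw [(β j).linearCombination_repr] at hh
  exact (f.gr_eq_zero_iff j (⟨y, hy⟩ - ⟨_, h⟩)).1 (by rw [map_sub, hh, sub_self])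

theorem N_le_span_of_castSucc (j : Fin f.len) (Y : Submodule R M)
    (h : f.N j.castSucc ≤ Y) (hY : ∀ k, x j k ∈ Y) (hx : ∀ j k, x j k ∈ f.N j.succ)
    (hβ : ∀ j k, f.gr j ⟨x j k, hx j k⟩ = β j k) : f.N j.succ ≤ Y := by
  intro y hy
  rw [← sub_add_cancel y (Finsupp.linearCombination R (x j) ((β j).repr (f.gr j ⟨y, hy⟩)))]
  refine add_mem (h (f.sub_lift_mem β x hx hβ j hy)) ?_
  rw [Finsupp.linearCombination_apply]
  exact Submodule.sum_mem _ fun k _ => Submodule.smul_mem _ _ (hY k)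

include hβ in
theorem N_le_span (i : Fin (f.len + 1)) :
    f.N i ≤ Submodule.span R ((fun k : Σ j, κ j => x k.1 k.2) '' {k | k.1.castSucc < i}) := by
  induction i using Fin.induction with
  | zero => rw [f.N_zero]; exact bot_le
  | succ j ih =>
    refine f.N_le_span_of_castSucc β x j _ (ih.trans (Submodule.span_mono ?_)) (fun k => ?_) hx hβ
    · exact Set.image_mono fun k hk => lt_trans hk Fin.castSucc_lt_succ
    · exact Submodule.subset_span ⟨⟨j, k⟩, Fin.castSucc_lt_succ, rfl⟩

include hβ in
theorem linearIndependent_lift : LinearIndependent R fun k : Σ j, κ j => x k.1 k.2 := by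
  classical
  rw [linearIndependent_iff]
  intro c hc
  by_contra hne
  obtain ⟨k₀, hk₀⟩ := Finsupp.support_nonempty_iff.2 hne
  obtain ⟨⟨j, k⟩, hk, hmax⟩ := c.support.exists_max_image (fun k => k.1) ⟨k₀, hk₀⟩
  rw [Finsupp.mem_support_iff] at hk
  let e : κ j → Σ i, κ i := fun k => ⟨j, k⟩
  have he : Function.Injective e := sigma_mk_injective (β := κ)
  let d : κ j →₀ R := c.comapDomain e he.injOn
  have hcd : ∀ i ∈ (c - d.mapDomain e).support, i.1 < j := by
    rintro ⟨i, k'⟩ hi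
    rw [Finsupp.mem_support_iff, Finsupp.sub_apply] at hi
    rcases eq_or_ne i j with rfl | hij
    · refine absurd ?_ hi
      rw [show (⟨i, k'⟩ : Σ i, κ i) = e k' from rfl, Finsupp.mapDomain_apply he,
        Finsupp.comapDomain_apply, sub_self]
    · rw [Finsupp.mapDomain_of_notMem_range, sub_zero] at hi
      · exact lt_of_le_of_ne (hmax _ (Finsupp.mem_support_iff.2 hi)) hij
      · rintro ⟨k'', h⟩
        exact hij (congrArg Sigma.fst h).symm
  obtain ⟨h, hh⟩ := f.exists_gr_linearCombination β x hx hβ j d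
  have h0 : Finsupp.linearCombination R (fun k : Σ j, κ j => x k.1 k.2) (c - d.mapDomain e) ∈
      f.N j.castSucc := by
    rw [Finsupp.linearCombination_apply]
    exact Submodule.sum_mem _ fun i hi => Submodule.smul_mem _ _
      (f.mono (Fin.succ_le_castSucc_iff.2 (hcd i hi)) (hx i.1 i.2))
  rw [map_sub, hc, zero_sub, neg_mem_iff, Finsupp.linearCombination_mapDomain] at h0
  rw [(f.gr_eq_zero_iff j ⟨_, h⟩).2 h0] at hh
  have hd : d = 0 := by
    have := congrArg (β j).repr hh
    rwa [map_zero, (β j).repr_linearCombination, eq_comm] at this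
  exact hk (by simpa [d, e] using DFunLike.congr_fun hd k)

/-- Bases of the subquotients of a cell filtration lift to a basis. -/
noncomputable def liftBasis : Module.Basis (Σ j, κ j) R M :=
  Module.Basis.mk (f.linearIndependent_lift β x hx hβ) (by
    rw [← f.N_last]
    exact (f.N_le_span β x hx hβ _).trans (Submodule.span_mono (Set.image_subset_range _ _)))

theorem liftBasis_apply (j : Fin f.len) (k : κ j) : f.liftBasis β x hx hβ ⟨j, k⟩ = x j k := by
  simp [liftBasis]

theorem flag_liftBasis (i : Fin (f.len + 1)) : flag (f.liftBasis β x hx hβ) i = f.N i := by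
  have h : ⇑(f.liftBasis β x hx hβ) = fun k : Σ j, κ j => x k.1 k.2 := by
    ext ⟨j, k⟩
    exact f.liftBasis_apply β x hx hβ j k
  refine le_antisymm (Submodule.span_le.2 ?_) ?_
  · rintro _ ⟨k, hk, rfl⟩
    rw [h]
    exact f.mono (Fin.castSucc_lt_iff_succ_le.1 hk) (hx _ _)
  · rw [flag, h]
    exact f.N_le_span β x hx hβ i

theorem liftBasis_repr (j : Fin f.len) {y : M} (hy : y ∈ f.N j.succ) (k : κ j) :
    (f.liftBasis β x hx hβ).repr y ⟨j, k⟩ = (β j).repr (f.gr j ⟨y, hy⟩) k := by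
  have h := f.sub_lift_mem β x hx hβ j hy
  rw [← f.flag_liftBasis β x hx hβ] at h
  have h1 := (mem_flag _).1 h ⟨j, k⟩ le_rfl
  rw [map_sub, Finsupp.sub_apply, sub_eq_zero] at h1
  rw [h1]
  have h2 : Finsupp.linearCombination R (x j) ((β j).repr (f.gr j ⟨y, hy⟩)) =
      blockEmb (f.liftBasis β x hx hβ) j ((β j).repr (f.gr j ⟨y, hy⟩)) := by
    simp only [blockEmb, f.liftBasis_apply]
  rw [h2, ← blockCoord_apply, blockCoord_emb]

end Lift

/-! ### Characters of cell modules -/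

theorem trace_eq_sum (f : C.Filtration ρ) (a : A) :
    LinearMap.trace R M (ρ a) = ∑ j, LinearMap.trace R _ (C.act (f.label j) a) := by
  classical
  have := C.finite_std
  have := fun l => Fintype.ofFinite (Std l)
  let β := fun j => (Finsupp.basisSingleOne : Module.Basis (Std (f.label j)) R _)
  choose x hx using fun j (k : Std (f.label j)) => f.gr_surjective j (β j k)
  let b := f.liftBasis β (fun j k => (x j k : M)) (fun j k => (x j k).2) hx
  rw [LinearMap.trace_eq_matrix_trace R b, Matrix.trace, Fintype.sum_sigma]
  refine Finset.sum_congr rfl fun j _ => ?_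
  rw [LinearMap.trace_eq_matrix_trace R (β j), Matrix.trace]
  refine Finset.sum_congr rfl fun k _ => ?_
  rw [Matrix.diag_apply, Matrix.diag_apply, LinearMap.toMatrix_apply, LinearMap.toMatrix_apply,
    f.liftBasis_apply, f.liftBasis_repr β _ (fun j k => (x j k).2) hx j
      (f.stable _ a _ (x j k).2), f.gr_act j a _ (x j k).2, hx]

/-- If no character of a cell module vanishes on its own cell ideal, then the subquotients of order
preserving cell filtrations are determined by the module. -/
theorem exists_label_eq (hC : ∀ l, ∃ a ∈ C.upper l, LinearMap.trace R _ (C.act l a) ≠ 0)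
    {f g : C.Filtration ρ} (hf : f.OrderPreserving) (hg : g.OrderPreserving) (i : Fin f.len) :
    ∃ j, g.label j = f.label i := by
  classical
  have hsum : ∀ f : C.Filtration ρ, f.OrderPreserving → ∀ a, LinearMap.trace R M (ρ a) =
      ∑ l ∈ Finset.univ.image f.label, LinearMap.trace R _ (C.act l a) := fun f hf a => by
    rw [f.trace_eq_sum, Finset.sum_image fun _ _ _ _ h => StrictAnti.injective hf h]
  suffices h : ∀ L L' : Finset Λ, (∀ a, ∑ l ∈ L, LinearMap.trace R _ (C.act l a) =
      ∑ l ∈ L', LinearMap.trace R _ (C.act l a)) → L ⊆ L' by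
    have := h _ _ (fun a => (hsum f hf a).symm.trans (hsum g hg a))
      (Finset.mem_image_of_mem f.label (Finset.mem_univ i))
    simpa using this
  intro L L' h
  have key : ∀ L L' : Finset Λ, (∀ a, ∑ l ∈ L, LinearMap.trace R _ (C.act l a) =
      ∑ l ∈ L', LinearMap.trace R _ (C.act l a)) → ∀ k ∈ L \ L',
        ¬ Maximal (· ∈ L \ L' ∪ L' \ L) k := by
    intro L L' h k hk hmax
    obtain ⟨a, ha, hne⟩ := hC k
    have hz : ∀ l ∈ L \ L' ∪ L' \ L, l ≠ k → LinearMap.trace R _ (C.act l a) = 0 :=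
      fun l hl hlk => by
        rw [C.act_eq_zero_of_mem_upper (fun hkl => hlk (hmax.eq_of_le hl hkl).symm) ha, map_zero]
    have h1 := h a
    rw [← Finset.sum_inter_add_sum_sdiff L L', ← Finset.sum_inter_add_sum_sdiff L' L,
      Finset.inter_comm L' L, add_right_inj,
      Finset.sum_eq_single_of_mem k hk fun l hl => hz l (Finset.mem_union_left _ hl),
      Finset.sum_eq_zero fun l hl => hz l (Finset.mem_union_right _ hl) ?_] at h1
    · exact hne h1
    · rintro rfl
      exact (Finset.mem_sdiff.1 hl).2 (Finset.mem_sdiff.1 hk).1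
  have hempty : L \ L' ∪ L' \ L = ∅ := by
    by_contra hne
    obtain ⟨k, hk⟩ := Finset.exists_maximal (Finset.nonempty_iff_ne_empty.2 hne)
    rcases Finset.mem_union.1 hk.1 with h' | h'
    · exact key L L' h k h' hk
    · exact key L' L (fun a => (h a).symm) k h' (by rwa [Finset.union_comm])
  exact Finset.sdiff_eq_empty_iff_subset.1 (Finset.union_eq_empty.1 hempty).1

end Filtration

end CellDatum

/-! ### Denominators -/

theorem IsFractionRing.exists_mul_eq {S K : Type*} [CommRing S] [IsDomain S] [Field K] [Algebra S K]
    [IsFractionRing S K] (k : K) :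
    ∃ x s : S, algebraMap S K s ≠ 0 ∧ algebraMap S K s * k = algebraMap S K x := by
  obtain ⟨x, s, hs, rfl⟩ := IsFractionRing.div_surjective (A := S) k
  have : algebraMap S K s ≠ 0 := by
    simpa using nonZeroDivisors.ne_zero hs
  exact ⟨x, s, this, mul_div_cancel₀ _ this⟩

section Denominators

variable {R K A : Type*} [CommRing R] [Field K] [Algebra R K] [Ring A] [Algebra R A]

theorem exists_smul_eq_one_tmul
    (hK : ∀ k : K, ∃ r s : R, algebraMap R K s ≠ 0 ∧ algebraMap R K s * k = algebraMap R K r)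
    (X : K ⊗[R] A) : ∃ s : R, algebraMap R K s ≠ 0 ∧ ∃ a : A, s • X = 1 ⊗ₜ[R] a := by
  induction X using TensorProduct.induction_on with
  | zero => exact ⟨1, by simp, 0, by simp⟩
  | add X Y hX hY =>
    obtain ⟨s, hs, a, ha⟩ := hX
    obtain ⟨t, ht, b, hb⟩ := hY
    refine ⟨s * t, by rw [map_mul]; exact mul_ne_zero hs ht, t • a + s • b, ?_⟩
    rw [smul_add, mul_comm, mul_smul, ha, mul_comm, mul_smul, hb, TensorProduct.tmul_add,
      TensorProduct.tmul_smul, TensorProduct.tmul_smul]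
  | tmul k a =>
    obtain ⟨r, s, hs, h⟩ := hK k
    refine ⟨s, hs, r • a, ?_⟩
    rw [TensorProduct.smul_tmul', Algebra.smul_def, h, TensorProduct.tmul_smul,
      TensorProduct.smul_tmul', Algebra.smul_def, mul_one]

theorem mem_smul_top_of_one_tmul_eq_zero {ι : Type*} (b : Module.Basis ι R A) {a : A}
    (h : (1 : K) ⊗ₜ[R] a = 0) : a ∈ RingHom.ker (algebraMap R K) • (⊤ : Submodule R A) := by
  rw [b.mem_ideal_smul_top]
  intro i
  have := DFunLike.congr_fun (congrArg (b.baseChange K).repr h) i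
  rw [Module.Basis.baseChange_repr_tmul, map_zero, Finsupp.zero_apply, Algebra.smul_def,
    mul_one] at this
  exact this

end Denominators

/-! ### Matrix algebras -/

theorem Matrix.exists_mul_mul_eq_self {K : Type*} [Field K] {k : ℕ} (X : Matrix (Fin k) (Fin k) K) :
    ∃ Y, X * Y * X = X := by
  let f := Matrix.toLin' X
  obtain ⟨g, hg⟩ := f.rangeRestrict.exists_rightInverse_of_surjective f.range_rangeRestrict
  obtain ⟨h, hh⟩ := LinearMap.exists_extend g
  refine ⟨LinearMap.toMatrix' h, Matrix.toLin'.injective ?_⟩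
  rw [Matrix.toLin'_mul, Matrix.toLin'_mul, Matrix.toLin'_toMatrix']
  ext1 v
  refine LinearMap.ext fun w => ?_
  have h1 : h (f (Pi.single v w)) = g (f.rangeRestrict (Pi.single v w)) :=
    LinearMap.congr_fun hh (f.rangeRestrict (Pi.single v w))
  have h2 : f (g (f.rangeRestrict (Pi.single v w))) = f (Pi.single v w) :=
    congrArg Subtype.val (LinearMap.congr_fun hg (f.rangeRestrict (Pi.single v w)))
  change f (h (f (Pi.single v w))) = f (Pi.single v w)
  rw [h1, h2]

theorem Matrix.exists_mul_mul_ne_zero {K : Type*} [Field K] {k : ℕ}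
    {X Y : Matrix (Fin k) (Fin k) K} (hX : X ≠ 0) (hY : Y ≠ 0) : ∃ Z, X * Z * Y ≠ 0 := by
  obtain ⟨i, j, hij⟩ : ∃ i j, X i j ≠ 0 := by
    by_contra! h
    exact hX (Matrix.ext h)
  obtain ⟨i', j', hij'⟩ : ∃ i j, Y i j ≠ 0 := by
    by_contra! h
    exact hY (Matrix.ext h)
  refine ⟨Matrix.single j i' 1, fun h => ?_⟩
  have := congrFun (congrFun h i) j'
  rw [Matrix.mul_assoc, Matrix.mul_apply, Finset.sum_eq_single j] at this
  · simp [hij, hij'] at this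
  · intro l _ hl
    rw [Matrix.single_mul_apply_of_ne _ _ _ _ _ hl, mul_zero]
  · simp

theorem IsSplitSemisimple.exists_mul_mul_eq_self {K B : Type*} [Field K] [Ring B] [Algebra K B]
    (h : IsSplitSemisimple K B) (x : B) : ∃ y, x * y * x = x := by
  obtain ⟨n, k, -, ⟨e⟩⟩ := h
  choose y hy using fun i => (e x i).exists_mul_mul_eq_self
  refine ⟨e.symm y, e.injective ?_⟩
  rw [map_mul, map_mul, e.apply_symm_apply]
  exact funext hy

/-! ### Cell modules and semisimplicity -/

namespace CellDatum

variable {R A Λ : Type*} [CommRing R] [Ring A] [Algebra R A] [PartialOrder Λ] {Std : Λ → Type*}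
  (C : CellDatum R A Λ Std)

/-- The functional `x ↦ ⟨x, c_u⟩` given by the bilinear form on the cell module. -/
noncomputable def pair (l : Λ) (u : Std l) : (Std l →₀ R) →ₗ[R] R :=
  Finsupp.linearCombination R fun w =>
    C.act l (C.invol (C.basis ⟨l, u, w⟩)) (Finsupp.single u 1) u

theorem act_basis (l : Λ) (u v : Std l) (x : Std l →₀ R) :
    C.act l (C.basis ⟨l, u, v⟩) x = C.pair l u x • Finsupp.single v 1 := by
  induction x using Finsupp.induction_linear with
  | zero => simp
  | add x y hx hy => rw [map_add, hx, hy, map_add, add_smul]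
  | single w r =>
    have h1 := C.layer_mul (C.basis_mem_upper l u w) (C.basis ⟨l, u, v⟩)
    rw [C.mul_layer (C.basis_mem_upper l u v), layer_basis, layer_basis, TensorProduct.map_tmul,
      TensorProduct.map_tmul, LinearMap.id_apply, LinearMap.id_apply] at h1
    have h2 := congrArg (TensorProduct.lid R (Std l →₀ R))
      (congrArg (TensorProduct.map (Finsupp.lapply u) LinearMap.id) h1)
    simp only [TensorProduct.map_tmul, TensorProduct.lid_tmul, LinearMap.id_apply,
      Finsupp.lapply_apply, Finsupp.single_eq_same, one_smul] at h2
    have hr : Finsupp.single w r = r • Finsupp.single w (1 : R) := by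
      rw [Finsupp.smul_single, smul_eq_mul, mul_one]
    rw [hr, map_smul, ← h2, map_smul, pair, Finsupp.linearCombination_single, one_smul, smul_assoc]

theorem basis_mul_mul (l : Λ) (s t u v : Std l) (x : A) :
    C.basis ⟨l, s, t⟩ * x * C.basis ⟨l, u, v⟩ -
      C.pair l u (C.act l x (Finsupp.single t 1)) • C.basis ⟨l, s, v⟩ ∈ C.strictUpper l := by
  have h := C.row_mul l s (Finsupp.single t 1) (x * C.basis ⟨l, u, v⟩)
  rwa [act_mul, act_basis, map_smul, row_single, row_single, one_smul, one_smul,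
    ← mul_assoc] at h

theorem trace_act_basis (l : Λ) (u v : Std l) :
    LinearMap.trace R _ (C.act l (C.basis ⟨l, u, v⟩)) = C.pair l u (Finsupp.single v 1) := by
  classical
  have := C.finite_std l
  have := Fintype.ofFinite (Std l)
  rw [LinearMap.trace_eq_matrix_trace R Finsupp.basisSingleOne, Matrix.trace,
    Finset.sum_eq_single v]
  · rw [Matrix.diag_apply, LinearMap.toMatrix_apply, Finsupp.coe_basisSingleOne, act_basis]
    simp
  · intro w _ hw
    rw [Matrix.diag_apply, LinearMap.toMatrix_apply, Finsupp.coe_basisSingleOne, act_basis]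
    simp [Finsupp.single_eq_of_ne hw]
  · simp

theorem exists_trace_ne_zero {F : Type*} [Field F] [Algebra R F]
    (hinj : Function.Injective (algebraMap R F))
    (hF : ∀ k : F, ∃ r s : R, algebraMap R F s ≠ 0 ∧ algebraMap R F s * k = algebraMap R F r)
    (hss : IsSplitSemisimple F (F ⊗[R] A)) (l : Λ) :
    ∃ a ∈ C.upper l, LinearMap.trace R _ (C.act l a) ≠ 0 := by
  obtain ⟨s⟩ := C.nonempty_std l
  set c := C.basis ⟨l, s, s⟩ with hc
  obtain ⟨X, hX⟩ := hss.exists_mul_mul_eq_self (1 ⊗ₜ[R] c)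
  obtain ⟨r, hr, a, ha⟩ := exists_smul_eq_one_tmul hF X
  have h1 : (1 : F) ⊗ₜ[R] (r • c - c * a * c) = 0 := by
    rw [TensorProduct.tmul_sub, TensorProduct.tmul_smul, sub_eq_zero, ← hX, ← smul_mul_assoc,
      ← mul_smul_comm, ha]
    simp
  have h2 := mem_smul_top_of_one_tmul_eq_zero C.basis h1
  rw [(RingHom.injective_iff_ker_eq_bot _).1 hinj, Submodule.bot_smul, Submodule.mem_bot,
    sub_eq_zero] at h2
  have h3 := C.basis_mul_mul l s s s s a
  rw [← hc, ← h2, ← sub_smul] at h3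
  have h4 := (mem_cellSpan _).1 h3 ⟨l, s, s⟩ (lt_irrefl l)
  rw [hc, map_smul, Module.Basis.repr_self, Finsupp.smul_apply, Finsupp.single_eq_same,
    smul_eq_mul, mul_one, sub_eq_zero] at h4
  have h5 : C.pair l s ≠ 0 := by
    intro h
    rw [h, LinearMap.zero_apply] at h4
    rw [h4, map_zero] at hr
    exact hr rfl
  obtain ⟨v, hv⟩ : ∃ v, C.pair l s (Finsupp.single v 1) ≠ 0 := by
    by_contra! h
    refine h5 (Finsupp.lhom_ext fun v r => ?_)
    have hr : Finsupp.single v r = r • Finsupp.single v (1 : R) := by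
      rw [Finsupp.smul_single, smul_eq_mul, mul_one]
    rw [hr, map_smul, h v, smul_zero, LinearMap.zero_apply]
  exact ⟨_, C.basis_mem_upper l s v, by rwa [trace_act_basis]⟩

/-! ### The involution on semisimple quotients -/

section Involution

variable {K : Type*} [Field K] [Algebra R K]

theorem invol_mem_ideal_smul_top {p : Ideal R} {x : A} (hx : x ∈ p • (⊤ : Submodule R A)) :
    C.invol x ∈ p • (⊤ : Submodule R A) :=
  C.invol.map_mem_ideal_smul_top hx

theorem eq_zero_of_mem_ideal_smul_top {B : Type*} [Ring B] [Algebra K B] {ψ : A →+* B}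
    (hψ : ∀ (r : R) a, ψ (r • a) = algebraMap R K r • ψ a) {x : A}
    (hx : x ∈ RingHom.ker (algebraMap R K) • (⊤ : Submodule R A)) : ψ x = 0 := by
  induction hx using Submodule.smul_induction_on' with
  | smul r hr a _ => rw [hψ, (RingHom.mem_ker).1 hr, zero_smul]
  | add x _ y _ hx hy => rw [map_add, hx, hy, add_zero]

variable {k : ℕ} {ψ : A →+* Matrix (Fin k) (Fin k) K}
  (hψ : ∀ (r : R) a, ψ (r • a) = algebraMap R K r • ψ a)
  (hspan : Submodule.span K (Set.range ψ) = ⊤)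

include hψ in
theorem exists_upper_not_le_ker (hk : 0 < k) :
    ∃ l, (∃ c ∈ C.upper l, ψ c ≠ 0) ∧ ∀ c ∈ C.strictUpper l, ψ c = 0 := by
  have hker : ∀ Γ : Set Λ, (∀ l ∈ Γ, ∀ c ∈ C.upper l, ψ c = 0) →
      ∀ c ∈ cellSpan C.basis Γ, ψ c = 0 := by
    intro Γ h c hc
    induction hc using Submodule.span_induction with
    | mem x hx =>
      obtain ⟨⟨l, s, t⟩, hl, rfl⟩ := hx
      exact h l hl _ (C.basis_mem_upper l s t)
    | zero => exact map_zero _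
    | add x y _ _ hx hy => rw [map_add, hx, hy, add_zero]
    | smul r x _ hx => rw [hψ, hx, smul_zero]
  have := C.finite_shapes
  have hne : {l | ∃ c ∈ C.upper l, ψ c ≠ 0}.Nonempty := by
    by_contra hempty
    have h1 := hker Set.univ (fun l _ c hc => by
      by_contra h
      exact hempty ⟨l, c, hc, h⟩) 1 (by rw [cellSpan_univ]; trivial)
    rw [map_one] at h1
    have := congrFun (congrFun h1 ⟨0, hk⟩) ⟨0, hk⟩
    simp at this
  obtain ⟨l, hl⟩ := (Set.toFinite _).exists_maximal hne
  refine ⟨l, hl.1, hker _ fun l' hl' c hc => ?_⟩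
  by_contra h
  exact (not_le_of_gt (Set.mem_Ioi.1 hl')) (hl.2 ⟨c, hc, h⟩ (le_of_lt (Set.mem_Ioi.1 hl')))

include hspan in
theorem exists_mul_mul_ne_zero {x y : A} (hx : ψ x ≠ 0) (hy : ψ y ≠ 0) :
    ∃ a, ψ (x * a * y) ≠ 0 := by
  obtain ⟨Z, hZ⟩ := Matrix.exists_mul_mul_ne_zero hx hy
  by_contra! h
  refine hZ ?_
  have hmem : Z ∈ Submodule.span K (Set.range ψ) := hspan ▸ Submodule.mem_top
  clear hZ
  induction hmem using Submodule.span_induction with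
  | mem z hz =>
    obtain ⟨a, rfl⟩ := hz
    rw [← map_mul, ← map_mul, h]
  | zero => simp
  | add z w _ _ hz hw => rw [mul_add, add_mul, hz, hw, add_zero]
  | smul c z _ hz => rw [mul_smul_comm, smul_mul_assoc, hz, smul_zero]

include hψ hspan in
theorem exists_mem_ker_iff (hk : 0 < k) : ∃ l, ∀ x, ψ x = 0 ↔
    ∀ c ∈ C.upper l, ∀ d ∈ C.upper l, c * x * d ∈
      C.strictUpper l ⊔ RingHom.ker (algebraMap R K) • (⊤ : Submodule R A) := by
  obtain ⟨l, ⟨c₀, hc₀, hne⟩, hstrict⟩ := C.exists_upper_not_le_ker hψ hk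
  refine ⟨l, fun x => ⟨fun hx => ?_, fun h => ?_⟩⟩
  · have hf : ∀ t u, C.pair l u (C.act l x (Finsupp.single t 1)) ∈
        RingHom.ker (algebraMap R K) := by
      intro t u
      rw [RingHom.mem_ker]
      by_contra hf
      have h1 : ∀ s v, ψ (C.basis ⟨l, s, v⟩) = 0 := by
        intro s v
        have h2 := hstrict _ (C.basis_mul_mul l s t u v x)
        rw [map_sub, map_mul, map_mul, hx, mul_zero, zero_mul, zero_sub, neg_eq_zero, hψ] at h2
        exact (smul_eq_zero.1 h2).resolve_left hf
      refine hne ?_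
      induction hc₀ using Submodule.span_induction with
      | mem y hy =>
        obtain ⟨⟨i, s, t⟩, hi, rfl⟩ := hy
        rcases (show l ≤ i from hi).eq_or_lt with rfl | hlt
        · exact h1 s t
        · exact hstrict _ (basis_mem_cellSpan _ hlt s t)
      | zero => exact map_zero _
      | add y z _ _ hy hz =>
        by_cases hy0 : ψ y = 0
        · by_cases hz0 : ψ z = 0
          · rw [map_add, hy0, hz0, add_zero]
          · exact absurd (hz hz0) hz0
        · exact absurd (hy hy0) hy0
      | smul r y _ hy =>
        by_cases hy0 : ψ y = 0
        · rw [hψ, hy0, smul_zero]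
        · exact absurd (hy hy0) hy0
    intro c hc d hd
    have hleft : ∀ s t, C.upper l ≤ (C.strictUpper l ⊔
        RingHom.ker (algebraMap R K) • (⊤ : Submodule R A)).comap
          (LinearMap.mulLeft R (C.basis ⟨l, s, t⟩ * x)) := by
      intro s t
      refine Submodule.span_le.2 ?_
      rintro _ ⟨⟨i, u, v⟩, hi, rfl⟩
      rcases (show l ≤ i from hi).eq_or_lt with rfl | hlt
      · have h1 := C.basis_mul_mul l s t u v x
        have h2 := Submodule.smul_mem_smul (hf t u)
          (Submodule.mem_top : C.basis ⟨l, s, v⟩ ∈ (⊤ : Submodule R A))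
        have h3 := Submodule.add_mem_sup h1 h2
        rw [sub_add_cancel] at h3
        exact h3
      · exact Submodule.mem_sup_left (C.mul_strictUpper (basis_mem_cellSpan _ hlt u v) _)
    have hright : C.upper l ≤ (C.strictUpper l ⊔
        RingHom.ker (algebraMap R K) • (⊤ : Submodule R A)).comap
          (LinearMap.mulRight R (x * d)) := by
      refine Submodule.span_le.2 ?_
      rintro _ ⟨⟨i, s, t⟩, hi, rfl⟩
      rcases (show l ≤ i from hi).eq_or_lt with rfl | hlt
      · have h1 := hleft s t hd
        rw [Submodule.mem_comap, LinearMap.mulLeft_apply, mul_assoc] at h1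
        exact h1
      · exact Submodule.mem_sup_left (C.strictUpper_mul (basis_mem_cellSpan _ hlt s t) _)
    have h1 := hright hc
    rwa [Submodule.mem_comap, LinearMap.mulRight_apply, ← mul_assoc] at h1
  · by_contra hx
    obtain ⟨a, ha⟩ := exists_mul_mul_ne_zero hspan hne hx
    obtain ⟨b, hb⟩ := exists_mul_mul_ne_zero hspan ha hne
    refine hb ?_
    obtain ⟨y, hy, z, hz, hyz⟩ := Submodule.mem_sup.1
      (h _ (C.upper_mul hc₀ a) _ (C.mul_upper hc₀ b))
    rw [mul_assoc _ b, ← hyz, map_add, hstrict y hy, eq_zero_of_mem_ideal_smul_top hψ hz, add_zero]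

include hψ hspan in
theorem matrix_invol_eq_zero (hk : 0 < k) {x : A} (hx : ψ x = 0) : ψ (C.invol x) = 0 := by
  obtain ⟨l, hl⟩ := C.exists_mem_ker_iff hψ hspan hk
  rw [hl] at hx ⊢
  intro c hc d hd
  obtain ⟨y, hy, z, hz, hyz⟩ := Submodule.mem_sup.1
    (hx _ (C.invol_mem_upper hd) _ (C.invol_mem_upper hc))
  have : c * C.invol x * d = C.invol (C.invol d * x * C.invol c) := by
    rw [C.invol_mul, C.invol_mul, C.invol_invol, C.invol_invol, mul_assoc]
  rw [this, ← hyz, map_add]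
  exact Submodule.add_mem_sup (C.invol_mem_strictUpper hy) (C.invol_mem_ideal_smul_top hz)

/-- The kernel of a homomorphism from a cellular algebra onto a split semisimple algebra is stable
under the involution. -/
theorem map_invol_eq_zero {B : Type*} [Ring B] [Algebra K B] (hB : IsSplitSemisimple K B)
    {ψ : A →+* B} (hψ : ∀ (r : R) a, ψ (r • a) = algebraMap R K r • ψ a)
    (hspan : Submodule.span K (Set.range ψ) = ⊤) {x : A} (hx : ψ x = 0) :
    ψ (C.invol x) = 0 := by
  obtain ⟨n, k, hk, ⟨e⟩⟩ := hB
  refine e.injective ?_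
  rw [map_zero]
  funext i
  let θ : B →ₐ[K] Matrix (Fin (k i)) (Fin (k i)) K := (Pi.evalAlgHom K _ i).comp e.toAlgHom
  have hθ : Function.Surjective θ := (Function.surjective_eval i).comp e.surjective
  have h := C.matrix_invol_eq_zero (ψ := θ.toRingHom.comp ψ) (K := K)
    (fun r a => by
      change θ (ψ (r • a)) = _ • θ (ψ a)
      rw [hψ, map_smul])
    (by
      have h1 : Set.range (θ.toRingHom.comp ψ) = θ.toLinearMap '' Set.range ψ := by
        rw [← Set.range_comp]; rfl
      rw [h1, Submodule.span_image, hspan, Submodule.map_top, LinearMap.range_eq_top]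
      exact hθ)
    (hk i) (x := x) (by
      change θ (ψ x) = 0
      rw [hx, map_zero])
  exact h

end Involution

end CellDatum

namespace CellDatum

section Generator

variable {R A Λ : Type*} [CommRing R] [Ring A] [Algebra R A] [PartialOrder Λ] {Std : Λ → Type*}
  {C : CellDatum R A Λ Std} {l : Λ} {δ : Std l →₀ R} {m : A}

theorem IsCyclicGenerator.exists_functional (hδ : C.IsCyclicGenerator l δ) :
    ∃ e : (Std l →₀ R) →ₗ[R] R, e δ = 1 := by
  obtain ⟨s⟩ := C.nonempty_std l
  obtain ⟨a, ha⟩ := hδ (Finsupp.single s 1)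
  exact ⟨Finsupp.lapply s ∘ₗ C.act l a, by simp [ha]⟩

theorem IsCellGenerator.mem_upper (hm : C.IsCellGenerator l δ m) : m ∈ C.upper l :=
  (C.isCellGenerator_iff.1 hm).1

/-- The tensor product of two vectors, as a matrix. -/
noncomputable def outer (l : Λ) :
    (Std l →₀ R) →ₗ[R] (Std l →₀ R) →ₗ[R] (Std l × Std l →₀ R) :=
  (TensorProduct.mk R (Std l →₀ R) (Std l →₀ R)).compr₂
    (finsuppTensorFinsupp' R (Std l) (Std l)).toLinearMap

/-- A linear map inducing an isomorphism from `A^{⊵ l} / A^{▷ l}` to matrices. -/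
structure IsGeneratorMap (C : CellDatum R A Λ Std) (l : Λ) (δ : Std l →₀ R) (m : A)
    (τ : A →ₗ[R] (Std l × Std l →₀ R)) : Prop where
  eq_zero_iff : ∀ x ∈ C.upper l, τ x = 0 ↔ x ∈ C.strictUpper l
  surj : ∀ w, ∃ x ∈ C.upper l, τ x = w
  map_mul_mul : ∀ a b, τ (a * m * b) = outer l (C.act l (C.invol a) δ) (C.act l b δ)

theorem IsGeneratorMap.map_mul {τ : A →ₗ[R] (Std l × Std l →₀ R)}
    (hτ : C.IsGeneratorMap l δ m τ) (a : A) : τ (m * a) = outer l δ (C.act l a δ) := by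
  have := hτ.map_mul_mul 1 a
  rwa [one_mul, C.invol_one, C.act_one_apply] at this

theorem IsGeneratorMap.map_strictUpper {τ : A →ₗ[R] (Std l × Std l →₀ R)}
    (hτ : C.IsGeneratorMap l δ m τ) {x : A} (hx : x ∈ C.strictUpper l) : τ x = 0 :=
  (hτ.eq_zero_iff x (C.strictUpper_le_upper l hx)).2 hx

theorem IsCellGenerator.exists_generatorMap (hm : C.IsCellGenerator l δ m) :
    ∃ τ, C.IsGeneratorMap l δ m τ := by
  obtain ⟨hm, τ, hτ, hτm⟩ := C.isCellGenerator_iff.1 hm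
  refine ⟨(finsuppTensorFinsupp' R (Std l) (Std l)).toLinearMap ∘ₗ τ, ?_, ?_, ?_⟩
  · intro x hx
    rw [LinearMap.comp_apply, LinearEquiv.coe_coe, LinearEquiv.map_eq_zero_iff,
      hτ.eq_zero_iff x hx]
  · intro w
    obtain ⟨x, hx, h⟩ := hτ.surj ((finsuppTensorFinsupp' R (Std l) (Std l)).symm w)
    exact ⟨x, hx, by rw [LinearMap.comp_apply, h, LinearEquiv.coe_coe,
      LinearEquiv.apply_symm_apply]⟩
  · intro a b
    rw [LinearMap.comp_apply, hτ.bimod a b m hm, hτm, TensorProduct.map_tmul]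
    rfl

theorem IsCellGenerator.mul_mem_strictUpper (hm : C.IsCellGenerator l δ m) {a : A}
    (ha : C.act l a δ = 0) : m * a ∈ C.strictUpper l := by
  obtain ⟨τ, hτ⟩ := hm.exists_generatorMap
  rw [← hτ.eq_zero_iff _ (C.upper_mul hm.mem_upper a), hτ.map_mul, ha, map_zero]

theorem IsCellGenerator.mul_sub_mul_mem (hm : C.IsCellGenerator l δ m) {a b : A}
    (hab : C.act l a δ = C.act l b δ) : m * a - m * b ∈ C.strictUpper l := by
  rw [← mul_sub]
  refine hm.mul_mem_strictUpper ?_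
  rw [← orbit_apply, map_sub, orbit_apply, orbit_apply, hab, sub_self]

/-- Contraction of the first tensor factor with a functional. -/
noncomputable def contract (e : (Std l →₀ R) →ₗ[R] R) :
    (Std l × Std l →₀ R) →ₗ[R] (Std l →₀ R) :=
  (TensorProduct.lid R _).toLinearMap ∘ₗ TensorProduct.map e LinearMap.id ∘ₗ
    (finsuppTensorFinsupp' R (Std l) (Std l)).symm.toLinearMap

set_option linter.unusedSectionVars false in
theorem contract_outer (e : (Std l →₀ R) →ₗ[R] R) (x y : Std l →₀ R) :
    contract e (outer l x y) = e x • y := by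
  simp [contract, outer]

theorem IsCellGenerator.act_mem_ideal_smul_top (hδ : C.IsCyclicGenerator l δ)
    (hm : C.IsCellGenerator l δ m) {p : Ideal R} {s : R} {y a : A} (hy : y ∈ C.strictUpper l)
    (h : s • y - m * a ∈ p • (⊤ : Submodule R A)) :
    C.act l a δ ∈ p • (⊤ : Submodule R (Std l →₀ R)) := by
  obtain ⟨τ, hτ⟩ := hm.exists_generatorMap
  obtain ⟨e, he⟩ := hδ.exists_functional
  have := (contract e).map_mem_ideal_smul_top (τ.map_mem_ideal_smul_top h)
  rwa [map_sub, map_smul, hτ.map_strictUpper hy, smul_zero, zero_sub, hτ.map_mul, map_neg,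
    contract_outer, he, one_smul, neg_mem_iff] at this

/-- Division modulo a prime: if `m a` is divisible by `s` modulo `p`, then up to higher terms the
quotient has the form `m c`. -/
theorem IsCellGenerator.exists_div (hδ : C.IsCyclicGenerator l δ)
    (hm : C.IsCellGenerator l δ m) {p : Ideal R} [p.IsPrime] {s : R} (hs : s ∉ p) {y a : A}
    (h : s • y - m * a ∈ p • (⊤ : Submodule R A)) :
    ∃ c, s • C.act l c δ - C.act l a δ ∈ p • (⊤ : Submodule R (Std l →₀ R)) ∧
      ∃ n ∈ C.strictUpper l, y - m * c - n ∈ p • (⊤ : Submodule R A) := by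
  obtain ⟨τ, hτ⟩ := hm.exists_generatorMap
  obtain ⟨e, he⟩ := hδ.exists_functional
  set y' := cellProj C.basis (Set.Ici l) y
  have hy' : y' ∈ C.upper l := cellProj_mem _ _ _
  have hyy' : y - y' ∈ p • (⊤ : Submodule R A) :=
    sub_cellProj_mem C.basis hs (C.upper_mul hm.mem_upper a) h
  have h1 : s • τ y' - outer l δ (C.act l a δ) ∈
      p • (⊤ : Submodule R (Std l × Std l →₀ R)) := by
    rw [← hτ.map_mul, ← map_smul τ, ← map_sub τ]
    refine τ.map_mem_ideal_smul_top ?_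
    have := sub_mem h (Submodule.smul_mem _ s hyy')
    rw [smul_sub] at this
    convert this using 1
    abel
  obtain ⟨c, hc⟩ := hδ (contract e (τ y'))
  have h2 : s • C.act l c δ - C.act l a δ ∈ p • (⊤ : Submodule R (Std l →₀ R)) := by
    have := (contract e).map_mem_ideal_smul_top h1
    rwa [map_sub, map_smul, ← hc, contract_outer, he, one_smul] at this
  have h3 : τ (y' - m * c) ∈ p • (⊤ : Submodule R (Std l × Std l →₀ R)) := by
    refine Finsupp.basisSingleOne.mem_of_smul_mem_ideal_smul_top hs ?_
    have := (outer l δ).map_mem_ideal_smul_top h2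
    rw [map_sub, map_smul] at this
    have := sub_mem h1 this
    rw [map_sub, hτ.map_mul, smul_sub]
    convert this using 1
    abel
  obtain ⟨w, hwp, hwu, hw⟩ : ∃ w ∈ p • (⊤ : Submodule R A), w ∈ C.upper l ∧
      τ w = τ (y' - m * c) := by
    generalize τ (y' - m * c) = z at h3
    induction h3 using Submodule.smul_induction_on' with
    | smul r hr z _ =>
      obtain ⟨x, hx, rfl⟩ := hτ.surj z
      exact ⟨r • x, Submodule.smul_mem_smul hr trivial, Submodule.smul_mem _ _ hx, map_smul _ _ _⟩
    | add z _ z' _ hz hz' =>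
      obtain ⟨w, h1, h2, rfl⟩ := hz
      obtain ⟨w', h1', h2', rfl⟩ := hz'
      exact ⟨w + w', add_mem h1 h1', add_mem h2 h2', map_add _ _ _⟩
  refine ⟨c, h2, y' - m * c - w, ?_, ?_⟩
  · rw [← hτ.eq_zero_iff _ (sub_mem (sub_mem hy' (C.upper_mul hm.mem_upper c)) hwu), map_sub, hw, sub_self]
  · have := add_mem hyy' hwp
    convert this using 1
    abel

/-- A basis of the cell module consisting of the elements `δ d_t` gives generators
`d_s^* m d_t` of `A^{⊵ l}` modulo `A^{▷ l}`. -/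
theorem IsCellGenerator.upper_le (hm : C.IsCellGenerator l δ m) {κ : Type*} {d : κ → A}
    (b : Module.Basis κ R (Std l →₀ R)) (hb : ∀ t, b t = C.act l (d t) δ) :
    C.upper l ≤ Submodule.span R (Set.range fun st : κ × κ => C.invol (d st.1) * m * d st.2) ⊔
      C.strictUpper l := by
  obtain ⟨τ, hτ⟩ := hm.exists_generatorMap
  have hmem : ∀ st : κ × κ, C.invol (d st.1) * m * d st.2 ∈ C.upper l := fun st =>
    C.upper_mul (C.mul_upper hm.mem_upper _) _
  have hmap : (Submodule.span R (Set.range fun st : κ × κ => C.invol (d st.1) * m * d st.2)).map τ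
      = ⊤ := by
    rw [Submodule.map_span, ← Set.range_comp,
      ← ((b.tensorProduct b).map (finsuppTensorFinsupp' R (Std l) (Std l))).span_eq]
    congr 2
    ext1 ⟨s, t⟩
    rw [Function.comp_apply, hτ.map_mul_mul, C.invol_invol, Module.Basis.map_apply,
      Module.Basis.tensorProduct_apply, hb, hb]
    rfl
  intro x hx
  obtain ⟨w, hw, hwx⟩ : τ x ∈ (Submodule.span R _).map τ := hmap ▸ Submodule.mem_top
  rw [← add_sub_cancel w x]
  refine Submodule.add_mem_sup hw ?_
  have hwu : w ∈ C.upper l := Submodule.span_le.2 (by rintro _ ⟨st, rfl⟩; exact hmem st) hw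
  rw [← hτ.eq_zero_iff _ (sub_mem hx hwu), map_sub, hwx, sub_self]

end Generator

end CellDatum

/-! ### Paths -/

section Tower

variable {R : Type*} [CommRing R] {A : ℕ → Type*} [∀ r, Ring (A r)] [∀ r, Algebra R (A r)]
  {Λ : ℕ → Type*} [∀ r, PartialOrder (Λ r)] {Std : ∀ r, Λ r → Type*}
  {ι : ∀ r, A r →ₐ[R] A (r + 1)} {C : ∀ r, CellDatum R (A r) (Λ r) (Std r)}

namespace StdPath

/-- The last step of a path. -/
def toPSigma {r : ℕ} {μ : Λ (r + 1)} : StdPath ι C (r + 1) μ → Σ' l : Λ r, StdPath ι C r l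
  | .snoc (l := l) t _ => ⟨l, t⟩

/-- The last vertex but one of a path. -/
def pred {r : ℕ} {μ : Λ (r + 1)} : StdPath ι C (r + 1) μ → Λ r
  | .snoc (l := l) _ _ => l

theorem toPSigma_injective {r : ℕ} {μ : Λ (r + 1)} :
    Function.Injective (toPSigma : StdPath ι C (r + 1) μ → _) := by
  rintro ⟨t, e⟩ ⟨t', e'⟩ h
  rw [toPSigma, toPSigma] at h
  cases h
  rfl

theorem snoc_injective {r : ℕ} {l : Λ r} {μ : Λ (r + 1)} (e : Edge ι C r l μ) :
    Function.Injective fun t : StdPath ι C r l => t.snoc e := by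
  intro t t' h
  cases h
  rfl

instance (l : Λ 0) : Unique (StdPath ι C 0 l) where
  default := .nil l
  uniq t := by cases t; rfl

protected theorem finite : ∀ {r : ℕ} (ν : Λ r), Finite (StdPath ι C r ν)
  | 0, _ => inferInstance
  | r + 1, _ => by
    have := (C r).finite_shapes
    have := fun l : Λ r => StdPath.finite l
    exact Finite.of_injective _ toPSigma_injective

/-- The reverse lexicographic order on paths. -/
inductive Lt : ∀ {r : ℕ} {ν : Λ r}, StdPath ι C r ν → StdPath ι C r ν → Prop
  | shape {r : ℕ} {l l' : Λ r} {μ : Λ (r + 1)} (t : StdPath ι C r l) (e : Edge ι C r l μ)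
      (t' : StdPath ι C r l') (e' : Edge ι C r l' μ) (h : l < l') : Lt (t.snoc e) (t'.snoc e')
  | path {r : ℕ} {l : Λ r} {μ : Λ (r + 1)} {t t' : StdPath ι C r l} (e : Edge ι C r l μ)
      (h : Lt t t') : Lt (t.snoc e) (t'.snoc e)

theorem wellFounded_lt : ∀ {r : ℕ} (ν : Λ r),
    WellFounded fun t t' : StdPath ι C r ν => Lt t' t
  | 0, _ => ⟨fun t => ⟨_, fun t' h => by cases h⟩⟩
  | r + 1, ν => by
    have := (C r).finite_shapes
    have hwf := WellFounded.intro fun a : (Σ' l : Λ r, StdPath ι C r l) =>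
      PSigma.lexAccessible ((wellFounded_gt (α := Λ r)).apply a.1) wellFounded_lt a.2
    refine Subrelation.wf ?_ (InvImage.wf (toPSigma (ι := ι) (C := C) (μ := ν)) hwf)
    rintro _ _ (⟨t, e, t', e', h⟩ | ⟨e, h⟩)
    · exact PSigma.Lex.left _ _ h
    · exact PSigma.Lex.right _ h

theorem Lt.pred_le {r : ℕ} {μ : Λ (r + 1)} {t t' : StdPath ι C (r + 1) μ} (h : Lt t t') :
    t.pred ≤ t'.pred := by
  rcases h with ⟨_, _, _, _, h⟩ | _
  · exact h.le
  · exact le_rfl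

end StdPath

/-! ### Restriction of cell modules -/

theorem edge_iff_label (hC : ∀ r l, ∃ a ∈ (C r).upper l, LinearMap.trace R _ ((C r).act l a) ≠ 0)
    {r : ℕ} {μ : Λ (r + 1)} {f : ResFiltration ι C r μ} (hf : f.OrderPreserving) {l : Λ r} :
    Edge ι C r l μ ↔ ∃ j, f.label j = l := by
  constructor
  · rintro ⟨g, hg, j, rfl⟩
    exact CellDatum.Filtration.exists_label_eq (hC r) hg hf j
  · rintro ⟨j, h⟩
    exact ⟨f, hf, j, h⟩

/-- Paths to `μ` correspond to paths to the subquotients of the restriction. -/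
noncomputable def pathEquiv
    (hC : ∀ r l, ∃ a ∈ (C r).upper l, LinearMap.trace R _ ((C r).act l a) ≠ 0)
    {r : ℕ} {μ : Λ (r + 1)} {f : ResFiltration ι C r μ} (hf : f.OrderPreserving) :
    (Σ j, StdPath ι C r (f.label j)) ≃ StdPath ι C (r + 1) μ :=
  Equiv.ofBijective (fun t => t.2.snoc ⟨f, hf, t.1, rfl⟩) (by
    constructor
    · rintro ⟨j, t⟩ ⟨j', t'⟩ h
      have h1 := congrArg StdPath.pred h
      obtain rfl : j = j' := StrictAnti.injective hf h1
      obtain rfl : t = t' := StdPath.snoc_injective _ h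
      rfl
    · intro v
      rcases v with _ | @⟨_, l, _, t, e⟩
      obtain ⟨j, rfl⟩ := (edge_iff_label hC hf).1 e
      exact ⟨⟨j, t⟩, rfl⟩)

namespace IsDiagramTower

variable {F : Type*} [Field F] [Algebra R F] {B : BranchingData C}

theorem trace_ne_zero [IsDomain R] [IsFractionRing R F] (hA : IsDiagramTower F ι C B) (r : ℕ)
    (l : Λ r) : ∃ a ∈ (C r).upper l, LinearMap.trace R _ ((C r).act l a) ≠ 0 :=
  (C r).exists_trace_ne_zero (IsFractionRing.injective R F)
    IsFractionRing.exists_mul_eq (hA.semisimple r) l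

variable (hA : IsDiagramTower F ι C B)
include hA

theorem exists_basis_zero (l : Λ 0) :
    ∃ b : Module.Basis (StdPath ι C 0 l) R (Std 0 l →₀ R),
      ∀ t, b t = (C 0).act l (t.d B) (B.δ 0 l) := by
  have hact : ∀ x, ∃ c : R, c • B.δ 0 l = x := by
    intro x
    obtain ⟨a, rfl⟩ := hA.cyclic 0 l x
    obtain ⟨c, rfl⟩ := hA.base.2 a
    exact ⟨c, by rw [Algebra.algebraMap_eq_smul_one, CellDatum.act_smul, CellDatum.act_one_apply]⟩
  have hd : (fun t : StdPath ι C 0 l => (C 0).act l (t.d B) (B.δ 0 l)) = fun _ => B.δ 0 l := by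
    funext t
    cases t
    exact CellDatum.act_one_apply _ _ _
  have hli : LinearIndependent R fun t : StdPath ι C 0 l => (C 0).act l (t.d B) (B.δ 0 l) := by
    rw [hd, linearIndependent_iff]
    intro c hc
    obtain ⟨s⟩ := (C 0).nonempty_std l
    obtain ⟨c', hc'⟩ := hact (Finsupp.single s 1)
    rw [Finsupp.linearCombination_unique] at hc
    have h1 : c default • Finsupp.single s (1 : R) = 0 := by
      rw [← hc', smul_comm, hc, smul_zero]
    have h2 := DFunLike.congr_fun h1 s
    rw [Finsupp.smul_apply, Finsupp.single_eq_same, smul_eq_mul, mul_one] at h2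
    exact Finsupp.ext fun t => by rw [Unique.eq_default t, h2, Finsupp.zero_apply, Finsupp.zero_apply]
  refine ⟨Module.Basis.mk hli ?_, fun t => Module.Basis.mk_apply _ _ _⟩
  rintro x -
  obtain ⟨c, rfl⟩ := hact x
  exact Submodule.smul_mem _ _ (Submodule.subset_span ⟨default, congrFun hd _⟩)

variable [IsDomain R] [IsFractionRing R F]

/-- The chosen filtration of the restriction of a cell module, for which the branching factors are
down-branching factors. -/
noncomputable def resFiltration (r : ℕ) (μ : Λ (r + 1)) : ResFiltration ι C r μ :=
  (hA.down r μ).choose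

omit [IsDomain R] [IsFractionRing R F] in
theorem resFiltration_orderPreserving (r : ℕ) (μ : Λ (r + 1)) :
    (hA.resFiltration r μ).OrderPreserving :=
  (hA.down r μ).choose_spec.1

omit [IsDomain R] [IsFractionRing R F] in
theorem resFiltration_gr (r : ℕ) (μ : Λ (r + 1)) (j : Fin (hA.resFiltration r μ).len) :
    ∃ h, (hA.resFiltration r μ).gr j ⟨(C (r + 1)).act μ (B.d r ((hA.resFiltration r μ).label j) μ)
      (B.δ (r + 1) μ), h⟩ = B.δ r ((hA.resFiltration r μ).label j) :=
  (hA.down r μ).choose_spec.2 j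

omit [IsDomain R] [IsFractionRing R F] in
theorem resFiltration_gr_mul (r : ℕ) (μ : Λ (r + 1)) (j : Fin (hA.resFiltration r μ).len)
    (a : A r) : ∃ h, (hA.resFiltration r μ).gr j ⟨(C (r + 1)).act μ
      (B.d r ((hA.resFiltration r μ).label j) μ * ι r a) (B.δ (r + 1) μ), h⟩ =
      (C r).act ((hA.resFiltration r μ).label j) a (B.δ r ((hA.resFiltration r μ).label j)) := by
  obtain ⟨h, hh⟩ := hA.resFiltration_gr r μ j
  have h1 := (hA.resFiltration r μ).stable _ a _ h
  have h2 := (hA.resFiltration r μ).gr_act j a _ h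
  simp only [CellDatum.act_mul]
  exact ⟨h1, by rw [h2, hh]⟩

/-- The basis of `Δ(μ)` adapted to the filtration of its restriction. -/
theorem exists_basis_succ {r : ℕ}
    (ih : ∀ l : Λ r, ∃ b : Module.Basis (StdPath ι C r l) R (Std r l →₀ R),
      ∀ t, b t = (C r).act l (t.d B) (B.δ r l)) (μ : Λ (r + 1)) :
    ∃ b : Module.Basis (Σ j, StdPath ι C r ((hA.resFiltration r μ).label j)) R
        (Std (r + 1) μ →₀ R),
      (∀ j t, b ⟨j, t⟩ = (C (r + 1)).act μ (StdPath.d B (pathEquiv hA.trace_ne_zero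
        (hA.resFiltration_orderPreserving r μ) ⟨j, t⟩)) (B.δ (r + 1) μ)) ∧
      ∀ i, flag b i = (hA.resFiltration r μ).N i := by
  choose b hb using ih
  choose h hh using fun j (t : StdPath ι C r ((hA.resFiltration r μ).label j)) =>
    hA.resFiltration_gr_mul r μ j (t.d B)
  refine ⟨(hA.resFiltration r μ).liftBasis (fun j => b _) _ h
    (fun j t => (hh j t).trans (hb _ t).symm), fun j t => ?_,
    (hA.resFiltration r μ).flag_liftBasis _ _ _ _⟩
  rw [CellDatum.Filtration.liftBasis_apply]
  rfl

theorem exists_basis : ∀ (r : ℕ) (l : Λ r),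
    ∃ b : Module.Basis (StdPath ι C r l) R (Std r l →₀ R),
      ∀ t, b t = (C r).act l (t.d B) (B.δ r l)
  | 0, l => hA.exists_basis_zero l
  | r + 1, μ => by
    obtain ⟨b, hb, -⟩ := hA.exists_basis_succ (exists_basis r) μ
    refine ⟨b.reindex (pathEquiv hA.trace_ne_zero (hA.resFiltration_orderPreserving r μ)),
      fun t => ?_⟩
    obtain ⟨⟨j, t⟩, rfl⟩ :=
      (pathEquiv hA.trace_ne_zero (hA.resFiltration_orderPreserving r μ)).surjective t
    rw [Module.Basis.reindex_apply, Equiv.symm_apply_apply, hb]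

/-- The Murphy basis of a cell module. -/
noncomputable def murphyBasis (r : ℕ) (l : Λ r) :
    Module.Basis (StdPath ι C r l) R (Std r l →₀ R) :=
  (hA.exists_basis r l).choose

theorem murphyBasis_apply {r : ℕ} {l : Λ r} (t : StdPath ι C r l) :
    hA.murphyBasis r l t = (C r).act l (t.d B) (B.δ r l) :=
  (hA.exists_basis r l).choose_spec t

/-- The vectors `x ∈ Δ(μ)` that are combinations of Murphy basis vectors indexed by paths whose last
vertex but one is larger than `l`. -/
def IsAbove {r : ℕ} (l : Λ r) {μ : Λ (r + 1)} (x : Std (r + 1) μ →₀ R) : Prop :=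
  ∀ t, ¬ l < t.pred → (hA.murphyBasis (r + 1) μ).repr x t = 0

theorem isAbove_iff {r : ℕ} {μ : Λ (r + 1)} (j : Fin (hA.resFiltration r μ).len)
    {x : Std (r + 1) μ →₀ R} : hA.IsAbove ((hA.resFiltration r μ).label j) x ↔
      x ∈ (hA.resFiltration r μ).N j.castSucc := by
  obtain ⟨b, hb, hN⟩ := hA.exists_basis_succ (hA.exists_basis r) μ
  have hbb : b.reindex (pathEquiv hA.trace_ne_zero (hA.resFiltration_orderPreserving r μ)) =
      hA.murphyBasis (r + 1) μ := by
    refine Module.Basis.eq_of_apply_eq fun t => ?_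
    obtain ⟨⟨j, t⟩, rfl⟩ :=
      (pathEquiv hA.trace_ne_zero (hA.resFiltration_orderPreserving r μ)).surjective t
    rw [Module.Basis.reindex_apply, Equiv.symm_apply_apply, hb, hA.murphyBasis_apply]
  rw [← hN, mem_flag, IsAbove, ← hbb,
    ← (pathEquiv hA.trace_ne_zero (hA.resFiltration_orderPreserving r μ)).forall_congr_right]
  refine forall_congr' fun i => ?_
  rw [Module.Basis.repr_reindex_apply, Equiv.symm_apply_apply]
  refine imp_congr_left ?_
  have h1 : (pathEquiv hA.trace_ne_zero (hA.resFiltration_orderPreserving r μ) i).pred =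
      (hA.resFiltration r μ).label i.1 := rfl
  rw [h1, StrictAnti.lt_iff_gt (hA.resFiltration_orderPreserving r μ), not_lt,
    Fin.castSucc_le_castSucc_iff]

/-- The map of cell modules that extends paths by an edge. -/
noncomputable def lift {r : ℕ} {l : Λ r} {μ : Λ (r + 1)} (e : Edge ι C r l μ) :
    (Std r l →₀ R) →ₗ[R] (Std (r + 1) μ →₀ R) :=
  (hA.murphyBasis r l).constr R fun t => hA.murphyBasis (r + 1) μ (t.snoc e)

theorem lift_basis {r : ℕ} {l : Λ r} {μ : Λ (r + 1)} (e : Edge ι C r l μ) (t : StdPath ι C r l) :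
    hA.lift e (hA.murphyBasis r l t) = hA.murphyBasis (r + 1) μ (t.snoc e) :=
  (hA.murphyBasis r l).constr_basis R _ t

theorem isAbove_act_sub_lift {r : ℕ} {l : Λ r} {μ : Λ (r + 1)} (e : Edge ι C r l μ) (a : A r) :
    hA.IsAbove l ((C (r + 1)).act μ (B.d r l μ * ι r a) (B.δ (r + 1) μ) -
      hA.lift e ((C r).act l a (B.δ r l))) := by
  obtain ⟨j, rfl⟩ := (edge_iff_label hA.trace_ne_zero (hA.resFiltration_orderPreserving r μ)).1 e
  have h1 : ∀ x, ∃ h : hA.lift e x ∈ (hA.resFiltration r μ).N j.succ,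
      (hA.resFiltration r μ).gr j ⟨_, h⟩ = x := by
    intro x
    have hbasis : ∀ t, ∃ h : hA.murphyBasis (r + 1) μ (t.snoc e) ∈
        (hA.resFiltration r μ).N j.succ, (hA.resFiltration r μ).gr j ⟨_, h⟩ =
          hA.murphyBasis r ((hA.resFiltration r μ).label j) t := by
      intro t
      simp only [hA.murphyBasis_apply]
      exact hA.resFiltration_gr_mul r μ j (t.d B)
    choose h hh using hbasis
    let G : (Std r ((hA.resFiltration r μ).label j) →₀ R) →ₗ[R]
        (hA.resFiltration r μ).N j.succ := (hA.murphyBasis r _).constr R fun t => ⟨_, h t⟩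
    have hG : ∀ t, G (hA.murphyBasis r _ t) = ⟨_, h t⟩ := fun t =>
      (hA.murphyBasis r _).constr_basis R _ t
    have h2 : ((hA.resFiltration r μ).N j.succ).subtype ∘ₗ G = hA.lift e :=
      (hA.murphyBasis r _).ext fun t => by
        rw [hA.lift_basis, LinearMap.comp_apply, hG]
        rfl
    have h3 : (hA.resFiltration r μ).gr j ∘ₗ G = LinearMap.id :=
      (hA.murphyBasis r _).ext fun t => by
        rw [LinearMap.comp_apply, hG, hh, LinearMap.id_apply]
    have h4 : (G x : Std (r + 1) μ →₀ R) = hA.lift e x := LinearMap.congr_fun h2 x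
    exact ⟨h4 ▸ (G x).2, (congrArg _ (Subtype.ext h4.symm)).trans (LinearMap.congr_fun h3 x)⟩
  obtain ⟨h, hh⟩ := h1 ((C r).act _ a (B.δ r _))
  obtain ⟨h', hh'⟩ := hA.resFiltration_gr_mul r μ j a
  rw [isAbove_iff]
  exact (hA.resFiltration r μ).sub_mem_of_gr_eq h' h (hh'.trans hh.symm)

end IsDiagramTower

end Tower

section Tower

variable {R : Type*} [CommRing R] {A : ℕ → Type*} [∀ r, Ring (A r)] [∀ r, Algebra R (A r)]
  {Λ : ℕ → Type*} [∀ r, PartialOrder (Λ r)] {Std : ∀ r, Λ r → Type*}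
  {ι : ∀ r, A r →ₐ[R] A (r + 1)} {C : ∀ r, CellDatum R (A r) (Λ r) (Std r)}

theorem StdPath.IsPermissible.mem {perm : ∀ r, Set (Λ r)} :
    ∀ {r : ℕ} {ν : Λ r} {t : StdPath ι C r ν}, t.IsPermissible perm → ν ∈ perm r
  | _, _, .nil _, h => h
  | _, _, .snoc _ _, h => h.2

theorem StdPath.exists_eq_snoc {r : ℕ} {l : Λ r} {μ : Λ (r + 1)} (e : Edge ι C r l μ)
    {v : StdPath ι C (r + 1) μ} (hv : v.pred = l) : ∃ t : StdPath ι C r l, v = t.snoc e := by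
  rcases v with _ | ⟨t, e'⟩
  obtain rfl := hv
  exact ⟨t, rfl⟩

/-- The permissible paths to a vertex. -/
abbrev PermPath (ι : ∀ r, A r →ₐ[R] A (r + 1)) (C : ∀ r, CellDatum R (A r) (Λ r) (Std r))
    (perm : ∀ r, Set (Λ r)) (r : ℕ) (ν : Λ r) :=
  {t : StdPath ι C r ν // t.IsPermissible perm}

namespace IsDiagramTower

variable {F : Type*} [Field F] [Algebra R F] {B : BranchingData C}
  [IsDomain R] [IsFractionRing R F] (hA : IsDiagramTower F ι C B)

theorem repr_lift_snoc {r : ℕ} {l : Λ r} {μ : Λ (r + 1)} (e : Edge ι C r l μ)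
    (x : Std r l →₀ R) (t : StdPath ι C r l) :
    (hA.murphyBasis (r + 1) μ).repr (hA.lift e x) (t.snoc e) = (hA.murphyBasis r l).repr x t := by
  classical
  have : Finsupp.lapply (t.snoc e) ∘ₗ (hA.murphyBasis (r + 1) μ).repr.toLinearMap ∘ₗ hA.lift e =
      Finsupp.lapply t ∘ₗ (hA.murphyBasis r l).repr.toLinearMap := by
    refine (hA.murphyBasis r l).ext fun t' => ?_
    simp only [LinearMap.comp_apply, hA.lift_basis, LinearEquiv.coe_coe, Module.Basis.repr_self,
      Finsupp.lapply_apply, Finsupp.single_apply]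
    exact if_congr (StdPath.snoc_injective e).eq_iff rfl rfl
  exact LinearMap.congr_fun this x

theorem repr_lift_of_pred_ne {r : ℕ} {l : Λ r} {μ : Λ (r + 1)} (e : Edge ι C r l μ)
    (x : Std r l →₀ R) {v : StdPath ι C (r + 1) μ} (hv : v.pred ≠ l) :
    (hA.murphyBasis (r + 1) μ).repr (hA.lift e x) v = 0 := by
  classical
  have : Finsupp.lapply v ∘ₗ (hA.murphyBasis (r + 1) μ).repr.toLinearMap ∘ₗ hA.lift e = 0 := by
    refine (hA.murphyBasis r l).ext fun t' => ?_
    simp only [LinearMap.comp_apply, hA.lift_basis, LinearEquiv.coe_coe, Module.Basis.repr_self,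
      Finsupp.lapply_apply, LinearMap.zero_apply]
    refine Finsupp.single_eq_of_ne ?_
    rintro rfl
    exact hv rfl
  exact LinearMap.congr_fun this x

/-- The linear map that sends `δ d_t` to `m d_t`. -/
noncomputable def cellEmb (r : ℕ) (l : Λ r) : (Std r l →₀ R) →ₗ[R] A r :=
  LinearMap.mulLeft R (B.m r l) ∘ₗ (hA.murphyBasis r l).constr R fun t => t.d B

theorem cellEmb_basis {r : ℕ} {l : Λ r} (t : StdPath ι C r l) :
    hA.cellEmb r l (hA.murphyBasis r l t) = B.m r l * t.d B := by
  rw [cellEmb, LinearMap.comp_apply, Module.Basis.constr_basis, LinearMap.mulLeft_apply]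

theorem mul_sub_cellEmb_mem {r : ℕ} {l : Λ r} (a : A r) :
    B.m r l * a - hA.cellEmb r l ((C r).act l a (B.δ r l)) ∈ (C r).strictUpper l := by
  refine (hA.cellGenerator r l).mul_sub_mul_mem ?_
  have : (C r).orbit l (B.δ r l) ∘ₗ (hA.murphyBasis r l).constr R (fun t => t.d B) =
      LinearMap.id := by
    refine (hA.murphyBasis r l).ext fun t => ?_
    rw [LinearMap.comp_apply, Module.Basis.constr_basis, CellDatum.orbit_apply,
      LinearMap.id_apply, hA.murphyBasis_apply]
  exact (LinearMap.congr_fun this _).symm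

end IsDiagramTower

/-! ### Quotients of towers -/

/-- The linear map from the permissible paths to the quotient that sends `t` to the image of
`m d_t`. -/
noncomputable def rowEmb (ι : ∀ r, A r →ₐ[R] A (r + 1)) {C : ∀ r, CellDatum R (A r) (Λ r) (Std r)}
    (B : BranchingData C) (perm : ∀ r, Set (Λ r)) (S : Type*) [CommRing S]
    {Q : ℕ → Type*} [∀ r, Ring (Q r)] [∀ r, Algebra S (Q r)] (ψ : ∀ r, A r →+* Q r) (r : ℕ)
    (ν : Λ r) : (PermPath ι C perm r ν →₀ S) →ₗ[S] Q r :=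
  Finsupp.linearCombination S fun t => ψ r (B.m r ν * t.1.d B)

theorem rowEmb_single {B : BranchingData C} {perm : ∀ r, Set (Λ r)} {S : Type*} [CommRing S]
    {Q : ℕ → Type*} [∀ r, Ring (Q r)] [∀ r, Algebra S (Q r)] {ψ : ∀ r, A r →+* Q r} {r : ℕ}
    {ν : Λ r} (t : PermPath ι C perm r ν) (c : S) :
    rowEmb ι B perm S ψ r ν (Finsupp.single t c) = c • ψ r (B.m r ν * t.1.d B) := by
  simp [rowEmb]

/-- The images of the Murphy basis elements indexed by permissible paths. -/
def permMurphy (ι : ∀ r, A r →ₐ[R] A (r + 1)) {C : ∀ r, CellDatum R (A r) (Λ r) (Std r)}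
    (B : BranchingData C) (perm : ∀ r, Set (Λ r)) {Q : ℕ → Type*} [∀ r, Ring (Q r)]
    (ψ : ∀ r, A r →+* Q r) (r : ℕ)
    (i : Σ ν : perm r, PermPath ι C perm r ν.1 × PermPath ι C perm r ν.1) : Q r :=
  ψ r (murphy B i.2.1.1 i.2.2.1)

/-- Surjective ring homomorphisms `ψ r : A r → Q r` over `R → S`, compatible with the inclusions and
the involutions, such that the generators of marginal cells are equivalent modulo `ψ` to higher
terms. -/
structure IsTowerQuotient {S : Type*} [CommRing S] [Algebra R S] {Q : ℕ → Type*} [∀ r, Ring (Q r)]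
    [∀ r, Algebra S (Q r)] (ι : ∀ r, A r →ₐ[R] A (r + 1))
    (C : ∀ r, CellDatum R (A r) (Λ r) (Std r)) (B : BranchingData C) (perm : ∀ r, Set (Λ r))
    (κ : ∀ r, Q r →ₐ[S] Q (r + 1)) (ψ : ∀ r, A r →+* Q r) : Prop where
  scalar_surjective : Function.Surjective (algebraMap R S)
  surjective : ∀ r, Function.Surjective (ψ r)
  map_smul : ∀ r (c : R) a, ψ r (c • a) = algebraMap R S c • ψ r a
  map_incl : ∀ r a, ψ (r + 1) (ι r a) = κ r (ψ r a)
  map_invol : ∀ r a, ψ r a = 0 → ψ r ((C r).invol a) = 0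
  permissible : IsPermissibleSet ι C perm
  marginal : ∀ r μ, IsMarginal ι C perm r μ →
    ∃ y ∈ (C (r + 1)).strictUpper μ, ψ (r + 1) (B.m (r + 1) μ + y) = 0 ∧
      ∃ s : R, algebraMap R S s ≠ 0 ∧ ∃ a, s • y - B.m (r + 1) μ * a ∈
        RingHom.ker (algebraMap R S) • (⊤ : Submodule R (A (r + 1)))

namespace IsTowerQuotient

variable {S : Type*} [CommRing S] [Algebra R S] {Q : ℕ → Type*} [∀ r, Ring (Q r)]
  [∀ r, Algebra S (Q r)] {B : BranchingData C} {perm : ∀ r, Set (Λ r)}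
  {κ : ∀ r, Q r →ₐ[S] Q (r + 1)} {ψ : ∀ r, A r →+* Q r}
  (hQ : IsTowerQuotient ι C B perm κ ψ)
include hQ

theorem map_eq_zero {r : ℕ} {x : A r}
    (hx : x ∈ RingHom.ker (algebraMap R S) • (⊤ : Submodule R (A r))) : ψ r x = 0 := by
  induction hx using Submodule.smul_induction_on' with
  | smul c hc a _ => rw [hQ.map_smul, (RingHom.mem_ker).1 hc, zero_smul]
  | add x _ y _ hx hy => rw [map_add, hx, hy, add_zero]

/-- The image of a submodule under `ψ`. -/
def image {r : ℕ} (N : Submodule R (A r)) : Submodule S (Q r) where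
  carrier := ψ r '' N
  zero_mem' := ⟨0, N.zero_mem, map_zero _⟩
  add_mem' := by
    rintro _ _ ⟨x, hx, rfl⟩ ⟨y, hy, rfl⟩
    exact ⟨x + y, N.add_mem hx hy, map_add _ _ _⟩
  smul_mem' := by
    rintro c _ ⟨x, hx, rfl⟩
    obtain ⟨c, rfl⟩ := hQ.scalar_surjective c
    exact ⟨c • x, N.smul_mem c hx, hQ.map_smul _ _ _⟩

theorem map_mem_image {r : ℕ} {N : Submodule R (A r)} {x : A r} (hx : x ∈ N) :
    ψ r x ∈ hQ.image N := ⟨x, hx, rfl⟩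

/-- The involution induced on the quotient. -/
noncomputable def invol (r : ℕ) : Q r →ₗ[S] Q r :=
  have key : ∀ q a, ψ r a = q → ψ r ((C r).invol (hQ.surjective r q).choose) =
      ψ r ((C r).invol a) := fun q a h => by
    rw [← sub_eq_zero, ← map_sub, ← map_sub]
    exact hQ.map_invol r _ (by rw [map_sub, (hQ.surjective r q).choose_spec, h, sub_self])
  { toFun := fun q => ψ r ((C r).invol (hQ.surjective r q).choose)
    map_add' := fun q q' => by
      obtain ⟨a, rfl⟩ := hQ.surjective r q
      obtain ⟨b, rfl⟩ := hQ.surjective r q'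
      rw [key _ a rfl, key _ b rfl, key _ (a + b) (map_add _ _ _), map_add, map_add]
    map_smul' := fun c q => by
      obtain ⟨a, rfl⟩ := hQ.surjective r q
      obtain ⟨c, rfl⟩ := hQ.scalar_surjective c
      rw [key _ a rfl, key _ (c • a) (hQ.map_smul _ _ _), _root_.map_smul, hQ.map_smul,
        RingHom.id_apply] }

theorem invol_map {r : ℕ} (a : A r) : hQ.invol r (ψ r a) = ψ r ((C r).invol a) := by
  rw [← sub_eq_zero]
  change ψ r ((C r).invol (hQ.surjective r (ψ r a)).choose) - _ = 0
  rw [← map_sub, ← map_sub]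
  exact hQ.map_invol r _ (by rw [map_sub, (hQ.surjective r (ψ r a)).choose_spec, sub_self])

theorem invol_mul {r : ℕ} (q q' : Q r) :
    hQ.invol r (q * q') = hQ.invol r q' * hQ.invol r q := by
  obtain ⟨a, rfl⟩ := hQ.surjective r q
  obtain ⟨b, rfl⟩ := hQ.surjective r q'
  rw [← map_mul, hQ.invol_map, hQ.invol_map, hQ.invol_map, (C r).invol_mul, map_mul]

theorem invol_invol {r : ℕ} (q : Q r) : hQ.invol r (hQ.invol r q) = q := by
  obtain ⟨a, rfl⟩ := hQ.surjective r q
  rw [hQ.invol_map, hQ.invol_map, (C r).invol_invol]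

theorem mul_mem_image_strictUpper {r : ℕ} {l : Λ r} {x : Q r}
    (hx : x ∈ hQ.image ((C r).strictUpper l)) (q : Q r) :
    x * q ∈ hQ.image ((C r).strictUpper l) := by
  obtain ⟨x, hx, rfl⟩ := hx
  obtain ⟨a, rfl⟩ := hQ.surjective r q
  exact ⟨x * a, (C r).strictUpper_mul hx a, map_mul _ _ _⟩

theorem mul_mem_image_strictUpper' {r : ℕ} {l : Λ r} {x : Q r}
    (hx : x ∈ hQ.image ((C r).strictUpper l)) (q : Q r) :
    q * x ∈ hQ.image ((C r).strictUpper l) := by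
  obtain ⟨x, hx, rfl⟩ := hx
  obtain ⟨a, rfl⟩ := hQ.surjective r q
  exact ⟨a * x, (C r).mul_strictUpper hx a, map_mul _ _ _⟩

theorem invol_mem_image_strictUpper {r : ℕ} {l : Λ r} {x : Q r}
    (hx : x ∈ hQ.image ((C r).strictUpper l)) :
    hQ.invol r x ∈ hQ.image ((C r).strictUpper l) := by
  obtain ⟨x, hx, rfl⟩ := hx
  rw [hQ.invol_map]
  exact ⟨_, (C r).invol_mem_strictUpper hx, rfl⟩

/-! ### Reduction of paths that are not permissible -/

omit hQ in
/-- Data that express `m d_t` modulo `ψ`, up to higher cells, by larger paths. -/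
structure _root_.IsDiagramTower.IsReduction {F : Type*} [Field F] [Algebra R F] [IsDomain R]
    [IsFractionRing R F] (hA : IsDiagramTower F ι C B) (S : Type*) [CommRing S] [Algebra R S]
    {Q : ℕ → Type*} [∀ r, Ring (Q r)] (ψ : ∀ r, A r →+* Q r)
    {r : ℕ} {ν : Λ r} (t : StdPath ι C r ν) (s : R) (a y : A r) : Prop where
  scalar : algebraMap R S s ≠ 0
  map_add : ψ r (B.m r ν * t.d B + y) = 0
  divides : s • y - B.m r ν * a ∈ RingHom.ker (algebraMap R S) • (⊤ : Submodule R (A r))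
  repr_mem : ∀ v, ¬ t.Lt v → (hA.murphyBasis r ν).repr ((C r).act ν a (B.δ r ν)) v ∈
    RingHom.ker (algebraMap R S)

variable {F : Type*} [Field F] [Algebra R F] [IsDomain R] [IsFractionRing R F]
  (hA : IsDiagramTower F ι C B)

theorem isReduction_snoc {r : ℕ} {l : Λ r} {μ : Λ (r + 1)} {t : StdPath ι C r l}
    (e : Edge ι C r l μ) {s : R} {a y : A r} (h : hA.IsReduction S ψ t s a y) :
    hA.IsReduction S ψ (t.snoc e) s (B.d r l μ * ι r a)
      ((C (r + 1)).invol (B.u r l μ) * ι r y) where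
  scalar := h.scalar
  map_add := by
    have h1 : B.m (r + 1) μ * (t.snoc e).d B + (C (r + 1)).invol (B.u r l μ) * ι r y =
        (C (r + 1)).invol (B.u r l μ) * ι r (B.m r l * t.d B + y) := by
      rw [StdPath.d, ← mul_assoc, hA.compatible r l μ e, mul_assoc, ← mul_add, ← map_mul,
        ← _root_.map_add]
    rw [h1, map_mul, hQ.map_incl, h.map_add, map_zero, mul_zero]
  divides := by
    have h1 := (LinearMap.mulLeft R ((C (r + 1)).invol (B.u r l μ)) ∘ₗ
      (ι r).toLinearMap).map_mem_ideal_smul_top h.divides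
    convert h1 using 1
    rw [LinearMap.comp_apply, AlgHom.toLinearMap_apply, map_sub, map_mul, _root_.map_smul, map_sub,
      _root_.map_smul, LinearMap.mulLeft_apply, LinearMap.mulLeft_apply, ← mul_assoc, ← mul_assoc,
      hA.compatible r l μ e]
  repr_mem := by
    intro v hv
    have hv' : ¬ l < v.pred := by
      intro hlt
      rcases v with _ | ⟨t', e'⟩
      exact hv (.shape t e t' e' hlt)
    have h1 := hA.isAbove_act_sub_lift e a v hv'
    rw [map_sub, Finsupp.sub_apply, sub_eq_zero] at h1
    rw [h1]
    by_cases hl : v.pred = l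
    · obtain ⟨t', rfl⟩ := StdPath.exists_eq_snoc e hl
      rw [hA.repr_lift_snoc]
      exact h.repr_mem t' fun hlt => hv (.path _ hlt)
    · rw [hA.repr_lift_of_pred_ne e _ hl]
      exact zero_mem _

theorem exists_isReduction : ∀ {r : ℕ} {ν : Λ r} (t : StdPath ι C r ν), ¬ t.IsPermissible perm →
    ∃ s a y, hA.IsReduction S ψ t s a y
  | _, _, .nil l, h => absurd (hQ.permissible.root l) h
  | _, _, .snoc (r := r) (l := l) (μ := μ) t e, h => by
    by_cases ht : t.IsPermissible perm
    · have hμ : μ ∉ perm (r + 1) := fun hμ => h ⟨ht, hμ⟩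
      obtain ⟨y, hy, hy0, s, hs, a, ha⟩ := hQ.marginal r μ ⟨hμ, l, t, ht, e⟩
      refine ⟨s, a * (t.snoc e).d B, y * (t.snoc e).d B, hs, ?_, ?_, fun v _ => ?_⟩
      · rw [← add_mul, map_mul, hy0, zero_mul]
      · have := (LinearMap.mulRight R ((t.snoc e).d B)).map_mem_ideal_smul_top ha
        rwa [LinearMap.mulRight_apply, sub_mul, smul_mul_assoc, mul_assoc] at this
      · refine ((hA.murphyBasis (r + 1) μ).mem_ideal_smul_top _).1 ?_ v
        rw [CellDatum.act_mul]
        exact ((C (r + 1)).act μ _).map_mem_ideal_smul_top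
          ((hA.cellGenerator (r + 1) μ).act_mem_ideal_smul_top (hA.cyclic (r + 1) μ) hy ha)
    · obtain ⟨s, a, y, h⟩ := exists_isReduction t ht
      exact ⟨_, _, _, hQ.isReduction_snoc hA e h⟩

set_option linter.unusedSectionVars false
variable [IsDomain S]

theorem exists_of_isReduction {r : ℕ} {ν : Λ r} {t : StdPath ι C r ν} {s : R} {a y : A r}
    (h : hA.IsReduction S ψ t s a y) : ∃ z,
      s • z - (C r).act ν a (B.δ r ν) ∈
        RingHom.ker (algebraMap R S) • (⊤ : Submodule R (Std r ν →₀ R)) ∧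
      (∀ v, ¬ t.Lt v → (hA.murphyBasis r ν).repr z v ∈ RingHom.ker (algebraMap R S)) ∧
      ψ r (hA.cellEmb r ν (hA.murphyBasis r ν t + z)) ∈ hQ.image ((C r).strictUpper ν) := by
  have hs : s ∉ RingHom.ker (algebraMap R S) := h.scalar
  have := RingHom.ker_isPrime (algebraMap R S)
  obtain ⟨c, hc, n, hn, hcn⟩ :=
    (hA.cellGenerator r ν).exists_div (hA.cyclic r ν) hs h.divides
  refine ⟨_, hc, fun v hv => ?_, ?_⟩
  · have h1 := ((hA.murphyBasis r ν).mem_ideal_smul_top _).1 hc v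
    rw [map_sub, Finsupp.sub_apply] at h1
    have h2 := add_mem h1 (h.repr_mem v hv)
    rw [sub_add_cancel, _root_.map_smul, Finsupp.smul_apply, smul_eq_mul] at h2
    exact (Ideal.IsPrime.mem_or_mem this h2).resolve_left hs
  · have h3 := hA.mul_sub_cellEmb_mem (l := ν) c
    refine ⟨-n - (B.m r ν * c - hA.cellEmb r ν ((C r).act ν c (B.δ r ν))),
      sub_mem (neg_mem hn) h3, ?_⟩
    rw [eq_comm, ← sub_eq_zero, ← map_sub, show (0 : Q r) = 0 - 0 from (sub_zero 0).symm]
    nth_rewrite 2 [← hQ.map_eq_zero hcn]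
    rw [← h.map_add, ← map_sub, _root_.map_add, hA.cellEmb_basis]
    congr 1
    abel

theorem map_cellEmb_smul {r : ℕ} {ν : Λ r} (c : R) (x : Std r ν →₀ R) :
    ψ r (hA.cellEmb r ν (c • x)) = algebraMap R S c • ψ r (hA.cellEmb r ν x) := by
  rw [_root_.map_smul, hQ.map_smul]

/-- Modulo higher cells the image of `m A` is spanned by the permissible paths. -/
theorem exists_rowEmb {r : ℕ} {ν : Λ r} (x : Std r ν →₀ R) :
    ∃ z, ψ r (hA.cellEmb r ν x) - rowEmb ι B perm S ψ r ν z ∈ hQ.image ((C r).strictUpper ν) := by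
  let P : Submodule R (Std r ν →₀ R) :=
    { carrier := {x | ∃ z, ψ r (hA.cellEmb r ν x) - rowEmb ι B perm S ψ r ν z ∈
        hQ.image ((C r).strictUpper ν)}
      zero_mem' := ⟨0, by simp⟩
      add_mem' := by
        rintro x y ⟨z, hz⟩ ⟨w, hw⟩
        refine ⟨z + w, ?_⟩
        have := add_mem hz hw
        rw [_root_.map_add, _root_.map_add, _root_.map_add]
        convert this using 1
        abel
      smul_mem' := by
        rintro c x ⟨z, hz⟩
        refine ⟨algebraMap R S c • z, ?_⟩
        rw [hQ.map_cellEmb_smul, _root_.map_smul, ← smul_sub]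
        exact Submodule.smul_mem _ _ hz }
  have hP : ∀ t, hA.murphyBasis r ν t ∈ P := by
    intro t
    induction t using (StdPath.wellFounded_lt ν).induction with
    | _ t ih =>
      by_cases ht : t.IsPermissible perm
      · refine ⟨Finsupp.single ⟨t, ht⟩ 1, ?_⟩
        rw [rowEmb_single, one_smul, hA.cellEmb_basis, sub_self]
        exact zero_mem _
      · obtain ⟨s, a, y, h⟩ := hQ.exists_isReduction hA t ht
        obtain ⟨z, -, hz, hzt⟩ := hQ.exists_of_isReduction hA h
        have hzP : z ∈ P := by
          rw [← (hA.murphyBasis r ν).linearCombination_repr z, Finsupp.linearCombination_apply]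
          refine Submodule.sum_mem _ fun v _ => ?_
          by_cases hv : t.Lt v
          · exact P.smul_mem _ (ih v hv)
          · refine ⟨0, ?_⟩
            rw [hQ.map_cellEmb_smul, (RingHom.mem_ker).1 (hz v hv), zero_smul, map_zero, sub_zero]
            exact zero_mem _
        have h1 : hA.murphyBasis r ν t + z ∈ P := ⟨0, by rwa [map_zero, sub_zero]⟩
        exact (P.add_mem_iff_left hzP).1 h1
  have htop : P = ⊤ := by
    rw [eq_top_iff, ← (hA.murphyBasis r ν).span_eq, Submodule.span_le]
    rintro _ ⟨t, rfl⟩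
    exact hP t
  exact (htop.ge Submodule.mem_top : x ∈ P)

include hA

theorem murphy_mem_upper {r : ℕ} {ν : Λ r} (s t : StdPath ι C r ν) :
    murphy B s t ∈ (C r).upper ν :=
  (C r).upper_mul ((C r).mul_upper (hA.cellGenerator r ν).mem_upper _) _

theorem invol_map_mul {r : ℕ} {ν : Λ r} (a : A r) :
    hQ.invol r (ψ r (B.m r ν * a)) = ψ r ((C r).invol a * B.m r ν) := by
  rw [hQ.invol_map, (C r).invol_mul, hA.symmetric]

theorem map_murphy_mem {r : ℕ} {ν : Λ r} {W : Submodule S (Q r)}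
    (hW : hQ.image ((C r).strictUpper ν) ≤ W)
    (h : ∀ s t : PermPath ι C perm r ν, ψ r (murphy B s.1 t.1) ∈ W) (s t : StdPath ι C r ν) :
    ψ r (murphy B s t) ∈ W := by
  have h1 : ∀ (s : StdPath ι C r ν) (t : PermPath ι C perm r ν), ψ r (murphy B s t.1) ∈ W := by
    intro s t
    obtain ⟨z, hz⟩ := hQ.exists_rowEmb hA (hA.murphyBasis r ν s)
    have h2 := hW (hQ.mul_mem_image_strictUpper (hQ.invol_mem_image_strictUpper hz) (ψ r (t.1.d B)))
    rw [map_sub, sub_mul, hA.cellEmb_basis, hQ.invol_map_mul hA, ← map_mul] at h2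
    refine (W.sub_mem_iff_left ?_).1 h2
    clear hz h2
    induction z using Finsupp.induction_linear with
    | zero => simp
    | add z w hz hw => rw [_root_.map_add, _root_.map_add, add_mul]; exact add_mem hz hw
    | single u c =>
      rw [rowEmb_single, _root_.map_smul, hQ.invol_map_mul hA, smul_mul_assoc, ← map_mul]
      exact W.smul_mem c (h u t)
  obtain ⟨z, hz⟩ := hQ.exists_rowEmb hA (hA.murphyBasis r ν t)
  have h2 := hW (hQ.mul_mem_image_strictUpper' hz (ψ r ((C r).invol (s.d B))))
  rw [mul_sub, hA.cellEmb_basis, ← map_mul, ← mul_assoc] at h2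
  refine (W.sub_mem_iff_left ?_).1 h2
  clear hz h2
  induction z using Finsupp.induction_linear with
  | zero => simp
  | add z w hz hw => rw [_root_.map_add, mul_add]; exact add_mem hz hw
  | single u c =>
    rw [rowEmb_single, mul_smul_comm, ← map_mul, ← mul_assoc]
    exact W.smul_mem c (h1 s u)

theorem image_upper_le {r : ℕ} (l : Λ r) : hQ.image ((C r).upper l) ≤
    Submodule.span S (permMurphy ι B perm ψ r '' {i | l ≤ i.1.1}) := by
  have := (C r).finite_shapes
  induction l using (wellFounded_gt (α := Λ r)).induction with
  | _ l ih =>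
    have hstrict : hQ.image ((C r).strictUpper l) ≤
        Submodule.span S (permMurphy ι B perm ψ r '' {i | l ≤ i.1.1}) := by
      rintro _ ⟨x, hx, rfl⟩
      induction hx using Submodule.span_induction with
      | mem x hx =>
        obtain ⟨⟨k, s, t⟩, hk, rfl⟩ := hx
        exact Submodule.span_mono (Set.image_mono fun i hi => (le_of_lt hk).trans hi)
          (ih k hk (hQ.map_mem_image ((C r).basis_mem_upper k s t)))
      | zero => rw [map_zero]; exact zero_mem _
      | add x y _ _ hx hy => rw [_root_.map_add]; exact add_mem hx hy
      | smul c x _ hx => rw [hQ.map_smul]; exact Submodule.smul_mem _ _ hx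
    rintro _ ⟨x, hx, rfl⟩
    obtain ⟨y, hy, z, hz, rfl⟩ := Submodule.mem_sup.1 ((hA.cellGenerator r l).upper_le
      (hA.murphyBasis r l) (fun t => hA.murphyBasis_apply t) hx)
    rw [_root_.map_add]
    refine add_mem ?_ (hstrict (hQ.map_mem_image hz))
    clear hx
    induction hy using Submodule.span_induction with
    | mem x hx =>
      obtain ⟨⟨s, t⟩, rfl⟩ := hx
      exact hQ.map_murphy_mem hA hstrict (fun s t =>
        Submodule.subset_span ⟨⟨⟨l, s.2.mem⟩, s, t⟩, le_rfl, rfl⟩) s t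
    | zero => rw [map_zero]; exact zero_mem _
    | add x y _ _ hx hy => rw [_root_.map_add]; exact add_mem hx hy
    | smul c x _ hx => rw [hQ.map_smul]; exact Submodule.smul_mem _ _ hx

theorem image_cellSpan {r : ℕ} {Γ : Set (Λ r)} (hΓ : IsUpperSet Γ) :
    hQ.image (cellSpan (C r).basis Γ) =
      Submodule.span S (permMurphy ι B perm ψ r '' {i | i.1.1 ∈ Γ}) := by
  refine le_antisymm ?_ (Submodule.span_le.2 ?_)
  · have hk : ∀ k ∈ Γ, hQ.image ((C r).upper k) ≤
        Submodule.span S (permMurphy ι B perm ψ r '' {i | i.1.1 ∈ Γ}) := fun k hk =>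
      (hQ.image_upper_le hA k).trans (Submodule.span_mono (Set.image_mono
        fun i (hi : k ≤ i.1.1) => show i.1.1 ∈ Γ from hΓ hi hk))
    rintro _ ⟨x, hx, rfl⟩
    induction hx using Submodule.span_induction with
    | mem x hx =>
      obtain ⟨⟨k, s, t⟩, hkΓ, rfl⟩ := hx
      exact hk k hkΓ (hQ.map_mem_image ((C r).basis_mem_upper k s t))
    | zero => rw [map_zero]; exact zero_mem _
    | add x y _ _ hx hy => rw [_root_.map_add]; exact add_mem hx hy
    | smul c x _ hx => rw [hQ.map_smul]; exact Submodule.smul_mem _ _ hx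
  · rintro _ ⟨⟨ν, s, t⟩, hν, rfl⟩
    exact hQ.map_mem_image ((C r).upper_le_cellSpan hΓ hν (hQ.murphy_mem_upper hA s.1 t.1))

theorem span_permMurphy (r : ℕ) :
    Submodule.span S (Set.range (permMurphy ι B perm ψ r)) = ⊤ := by
  have h := hQ.image_cellSpan hA (r := r) (isUpperSet_univ)
  rw [cellSpan_univ] at h
  rw [eq_top_iff]
  intro q _
  obtain ⟨a, rfl⟩ := hQ.surjective r q
  refine Submodule.span_mono (Set.image_subset_range _ _) (h.le (hQ.map_mem_image ?_))
  trivial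

end IsTowerQuotient

end Tower

section Tower

variable {R : Type*} [CommRing R] {A : ℕ → Type*} [∀ r, Ring (A r)] [∀ r, Algebra R (A r)]
  {Λ : ℕ → Type*} [∀ r, PartialOrder (Λ r)] {Std : ∀ r, Λ r → Type*}
  {ι : ∀ r, A r →ₐ[R] A (r + 1)} {C : ∀ r, CellDatum R (A r) (Λ r) (Std r)}

theorem IsPermissibleSet.exists_permPath {perm : ∀ r, Set (Λ r)}
    (h : IsPermissibleSet ι C perm) : ∀ {r : ℕ} (ν : perm r), Nonempty (PermPath ι C perm r ν.1)
  | 0, ν => ⟨⟨.nil ν.1, ν.2⟩⟩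
  | r + 1, ν => by
    obtain ⟨l, hl, e⟩ := h.below r ν.1 ν.2
    obtain ⟨t⟩ := h.exists_permPath ⟨l, hl⟩
    exact ⟨⟨t.1.snoc e, t.2, ν.2⟩⟩

theorem IsDiagramTower.cellEmb_mul {F : Type*} [Field F] [Algebra R F] {B : BranchingData C}
    [IsDomain R] [IsFractionRing R F] (hA : IsDiagramTower F ι C B) {r : ℕ} {l : Λ r}
    (x : Std r l →₀ R) (a : A r) :
    hA.cellEmb r l x * a - hA.cellEmb r l ((C r).act l a x) ∈ (C r).strictUpper l := by
  obtain ⟨c, rfl⟩ := hA.cyclic r l x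
  have h1 := (C r).strictUpper_mul (hA.mul_sub_cellEmb_mem (l := l) c) a
  have h2 := hA.mul_sub_cellEmb_mem (l := l) (c * a)
  rw [CellDatum.act_mul] at h2
  have := sub_mem h2 h1
  rw [sub_mul, ← mul_assoc, sub_sub_sub_cancel_left] at this
  exact this

namespace IsTowerQuotient

variable {S : Type*} [CommRing S] [Algebra R S] {Q : ℕ → Type*} [∀ r, Ring (Q r)]
  [∀ r, Algebra S (Q r)] {B : BranchingData C} {perm : ∀ r, Set (Λ r)}
  {κ : ∀ r, Q r →ₐ[S] Q (r + 1)} {ψ : ∀ r, A r →+* Q r}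
  (hQ : IsTowerQuotient ι C B perm κ ψ)
  {F : Type*} [Field F] [Algebra R F] [IsDomain R] [IsFractionRing R F]
  (hA : IsDiagramTower F ι C B) [IsDomain S]
  (hli : ∀ r, LinearIndependent S (permMurphy ι B perm ψ r))

/-- The cellular basis of the quotient. -/
noncomputable def basis (r : ℕ) :
    Module.Basis (Σ ν : perm r, PermPath ι C perm r ν.1 × PermPath ι C perm r ν.1) S (Q r) :=
  Module.Basis.mk (hli r) (hQ.span_permMurphy hA r).ge

theorem basis_apply {r : ℕ} (ν : perm r) (s t : PermPath ι C perm r ν.1) :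
    hQ.basis hA hli r ⟨ν, s, t⟩ = ψ r (murphy B s.1 t.1) := by
  simp [basis, permMurphy]

theorem cellSpan_basis {r : ℕ} {Γ : Set (Λ r)} (hΓ : IsUpperSet Γ) :
    cellSpan (hQ.basis hA hli r) {ν | ν.1 ∈ Γ} = hQ.image (cellSpan (C r).basis Γ) := by
  rw [hQ.image_cellSpan hA hΓ, cellSpan, basis, Module.Basis.coe_mk]
  rfl

theorem strictUpper_basis {r : ℕ} (l : perm r) :
    cellSpan (hQ.basis hA hli r) (Set.Ioi l) = hQ.image ((C r).strictUpper l.1) :=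
  hQ.cellSpan_basis hA hli (isUpperSet_Ioi l.1)

theorem upper_basis {r : ℕ} (l : perm r) :
    cellSpan (hQ.basis hA hli r) (Set.Ici l) = hQ.image ((C r).upper l.1) :=
  hQ.cellSpan_basis hA hli (isUpperSet_Ici l.1)

theorem mul_rowEmb {r : ℕ} (l : perm r) (s : PermPath ι C perm r l.1)
    (z : PermPath ι C perm r l.1 →₀ S) :
    ψ r ((C r).invol (s.1.d B)) * rowEmb ι B perm S ψ r l.1 z =
      Finsupp.linearCombination S (fun t => hQ.basis hA hli r ⟨l, s, t⟩) z := by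
  induction z using Finsupp.induction_linear with
  | zero => simp
  | add z w hz hw => rw [map_add, mul_add, hz, hw, map_add]
  | single t c =>
    rw [rowEmb_single, mul_smul_comm, ← map_mul, ← mul_assoc, Finsupp.linearCombination_single,
      basis_apply]
    rfl

/-- The cell datum of the quotient. -/
noncomputable def cellDatum (r : ℕ) :
    CellDatum S (Q r) (perm r) (fun ν => PermPath ι C perm r ν.1) where
  invol := hQ.invol r
  invol_mul := hQ.invol_mul
  invol_invol := hQ.invol_invol
  finite_shapes := by
    have := (C r).finite_shapes
    infer_instance
  finite_std l := by
    have := StdPath.finite (ι := ι) (C := C) l.1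
    infer_instance
  nonempty_std l := hQ.permissible.exists_permPath l
  basis := hQ.basis hA hli r
  mul_mod l t a := by
    obtain ⟨a, rfl⟩ := hQ.surjective r a
    obtain ⟨z, hz⟩ := hQ.exists_rowEmb hA ((C r).act l.1 (t.1.d B * a) (B.δ r l.1))
    refine ⟨z, fun s => ?_⟩
    have h1 := add_mem (hQ.map_mem_image (hA.mul_sub_cellEmb_mem (l := l.1) (t.1.d B * a))) hz
    rw [map_sub, sub_add_sub_cancel] at h1
    have h2 := hQ.mul_mem_image_strictUpper' h1 (ψ r ((C r).invol (s.1.d B)))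
    rw [mul_sub, hQ.mul_rowEmb hA hli, ← map_mul, ← mul_assoc, ← mul_assoc, map_mul] at h2
    rw [hQ.strictUpper_basis, basis_apply]
    exact h2
  invol_mod l s t := by
    rw [basis_apply, basis_apply, hQ.invol_map, murphy, murphy, (C r).invol_mul, (C r).invol_mul,
      (C r).invol_invol, hA.symmetric, mul_assoc, sub_self]
    exact zero_mem _

theorem cellDatum_basis {r : ℕ} (ν : perm r) (s t : PermPath ι C perm r ν.1) :
    (hQ.cellDatum hA hli r).basis ⟨ν, s, t⟩ = ψ r (murphy B s.1 t.1) :=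
  hQ.basis_apply hA hli ν s t

theorem cellDatum_strictUpper {r : ℕ} (l : perm r) :
    (hQ.cellDatum hA hli r).strictUpper l = hQ.image ((C r).strictUpper l.1) :=
  hQ.strictUpper_basis hA hli l

theorem cellDatum_upper {r : ℕ} (l : perm r) :
    (hQ.cellDatum hA hli r).upper l = hQ.image ((C r).upper l.1) :=
  hQ.upper_basis hA hli l

theorem row_eq {r : ℕ} (l : perm r) (s : PermPath ι C perm r l.1)
    (z : PermPath ι C perm r l.1 →₀ S) : (hQ.cellDatum hA hli r).row l s z =
      ψ r ((C r).invol (s.1.d B)) * rowEmb ι B perm S ψ r l.1 z :=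
  (hQ.mul_rowEmb hA hli l s z).symm

include hA hli in
theorem eq_zero_of_rowEmb_mem {r : ℕ} (l : perm r) {z : PermPath ι C perm r l.1 →₀ S}
    (h : rowEmb ι B perm S ψ r l.1 z ∈ hQ.image ((C r).strictUpper l.1)) : z = 0 := by
  obtain ⟨s⟩ := hQ.permissible.exists_permPath l
  refine (hQ.cellDatum hA hli r).eq_zero_of_row_mem s ?_
  rw [row_eq, cellDatum_strictUpper]
  exact hQ.mul_mem_image_strictUpper' h _

include hA hli in
theorem choose_rowEmb_eq {r : ℕ} (l : perm r) {x : Std r l.1 →₀ R}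
    {z : PermPath ι C perm r l.1 →₀ S} (h : ψ r (hA.cellEmb r l.1 x) -
      rowEmb ι B perm S ψ r l.1 z ∈ hQ.image ((C r).strictUpper l.1)) :
    (hQ.exists_rowEmb hA x).choose = z := by
  have h1 := sub_mem h (hQ.exists_rowEmb hA x).choose_spec
  rw [sub_sub_sub_cancel_left, ← map_sub] at h1
  exact sub_eq_zero.1 (hQ.eq_zero_of_rowEmb_mem hA hli l h1)

/-- The projection of the cell modules of `A r` onto those of the quotient. -/
noncomputable def proj (r : ℕ) (l : perm r) :
    (Std r l.1 →₀ R) →ₛₗ[algebraMap R S] (PermPath ι C perm r l.1 →₀ S) where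
  toFun x := (hQ.exists_rowEmb hA x).choose
  map_add' x y := by
    refine hQ.choose_rowEmb_eq hA hli l ?_
    have := add_mem (hQ.exists_rowEmb hA x).choose_spec (hQ.exists_rowEmb hA y).choose_spec
    rw [_root_.map_add, _root_.map_add, _root_.map_add]
    convert this using 1
    abel
  map_smul' c x := by
    refine hQ.choose_rowEmb_eq hA hli l ?_
    have := Submodule.smul_mem _ (algebraMap R S c) (hQ.exists_rowEmb hA x).choose_spec
    rw [hQ.map_cellEmb_smul, _root_.map_smul, ← smul_sub]
    exact this

theorem proj_spec {r : ℕ} (l : perm r) (x : Std r l.1 →₀ R) :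
    ψ r (hA.cellEmb r l.1 x) - rowEmb ι B perm S ψ r l.1 (hQ.proj hA hli r l x) ∈
      hQ.image ((C r).strictUpper l.1) :=
  (hQ.exists_rowEmb hA x).choose_spec

theorem proj_eq {r : ℕ} (l : perm r) {x : Std r l.1 →₀ R}
    {z : PermPath ι C perm r l.1 →₀ S} (h : ψ r (hA.cellEmb r l.1 x) -
      rowEmb ι B perm S ψ r l.1 z ∈ hQ.image ((C r).strictUpper l.1)) :
    hQ.proj hA hli r l x = z :=
  hQ.choose_rowEmb_eq hA hli l h

theorem proj_basis {r : ℕ} (l : perm r) (t : PermPath ι C perm r l.1) :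
    hQ.proj hA hli r l (hA.murphyBasis r l.1 t.1) = Finsupp.single t 1 := by
  refine hQ.proj_eq hA hli l ?_
  rw [rowEmb_single, one_smul, hA.cellEmb_basis, sub_self]
  exact zero_mem _

theorem proj_surjective {r : ℕ} (l : perm r) : Function.Surjective (hQ.proj hA hli r l) := by
  intro z
  induction z using Finsupp.induction_linear with
  | zero => exact ⟨0, map_zero _⟩
  | add z w hz hw =>
    obtain ⟨x, rfl⟩ := hz
    obtain ⟨y, rfl⟩ := hw
    exact ⟨x + y, _root_.map_add _ _ _⟩
  | single t c =>
    obtain ⟨c, rfl⟩ := hQ.scalar_surjective c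
    refine ⟨c • hA.murphyBasis r l.1 t.1, ?_⟩
    rw [LinearMap.map_smulₛₗ, proj_basis, Finsupp.smul_single, smul_eq_mul, mul_one]

theorem act_proj {r : ℕ} (l : perm r) (a : A r) (x : Std r l.1 →₀ R) :
    (hQ.cellDatum hA hli r).act l (ψ r a) (hQ.proj hA hli r l x) =
      hQ.proj hA hli r l ((C r).act l.1 a x) := by
  obtain ⟨s⟩ := hQ.permissible.exists_permPath l
  refine (hQ.cellDatum hA hli r).act_unique s ?_
  rw [row_eq, row_eq, cellDatum_strictUpper, mul_assoc, ← mul_sub]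
  refine hQ.mul_mem_image_strictUpper' ?_ _
  have h1 := hQ.mul_mem_image_strictUpper (hQ.proj_spec hA hli l x) (ψ r a)
  have h2 := hQ.proj_spec hA hli l ((C r).act l.1 a x)
  have h3 := hQ.map_mem_image (hA.cellEmb_mul (l := l.1) x a)
  rw [sub_mul] at h1
  rw [map_sub, map_mul] at h3
  have := sub_mem (add_mem h3 h2) h1
  convert this using 1
  abel

/-- The chosen elements of the quotient tower. -/
noncomputable def branchingData : BranchingData (hQ.cellDatum hA hli) where
  δ r ν := hQ.proj hA hli r ν (B.δ r ν.1)
  m r ν := ψ r (B.m r ν.1)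
  d r μ ν := ψ (r + 1) (B.d r μ.1 ν.1)
  u r μ ν := ψ (r + 1) (B.u r μ.1 ν.1)

theorem map_m_sub_rowEmb_mem {r : ℕ} (ν : perm r) : ψ r (B.m r ν.1) -
    rowEmb ι B perm S ψ r ν.1 (hQ.proj hA hli r ν (B.δ r ν.1)) ∈
      hQ.image ((C r).strictUpper ν.1) := by
  have h1 := hQ.map_mem_image (hA.mul_sub_cellEmb_mem (l := ν.1) 1)
  have h2 := add_mem h1 (hQ.proj_spec hA hli ν ((C r).act ν.1 1 (B.δ r ν.1)))
  rwa [map_sub, sub_add_sub_cancel, mul_one, CellDatum.act_one_apply] at h2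

theorem isCyclicGenerator {r : ℕ} (ν : perm r) : (hQ.cellDatum hA hli r).IsCyclicGenerator ν
    (hQ.proj hA hli r ν (B.δ r ν.1)) := by
  intro z
  obtain ⟨x, rfl⟩ := hQ.proj_surjective hA hli ν z
  obtain ⟨a, rfl⟩ := hA.cyclic r ν.1 x
  exact ⟨ψ r a, hQ.act_proj hA hli ν a _⟩

theorem isCellGenerator {r : ℕ} (ν : perm r) : (hQ.cellDatum hA hli r).IsCellGenerator ν
    (hQ.proj hA hli r ν (B.δ r ν.1)) (ψ r (B.m r ν.1)) := by
  set D := hQ.cellDatum hA hli r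
  set δ' := hQ.proj hA hli r ν (B.δ r ν.1)
  have hmem : ∀ a ∈ (C r).upper ν.1, ψ r a ∈ D.upper ν := fun a ha => by
    rw [hQ.cellDatum_upper hA hli]
    exact hQ.map_mem_image ha
  have hm := (hA.cellGenerator r ν.1).mem_upper
  have h1 := hQ.map_m_sub_rowEmb_mem hA hli ν
  have h2 : ∀ z, D.layer ν (rowEmb ι B perm S ψ r ν.1 z) = δ' ⊗ₜ z := by
    intro z
    induction z using Finsupp.induction_linear with
    | zero => simp
    | add z w hz hw => rw [_root_.map_add, _root_.map_add, hz, hw, TensorProduct.tmul_add]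
    | single t c =>
      have h3 := hQ.mul_mem_image_strictUpper' h1 (ψ r ((C r).invol (t.1.d B)))
      rw [mul_sub, ← hQ.row_eq hA hli, ← hQ.cellDatum_strictUpper hA hli] at h3
      have h4 := D.layer_strictUpper h3
      rw [map_sub, sub_eq_zero, D.layer_row] at h4
      have h5 : D.invol (ψ r ((C r).invol (t.1.d B)) * ψ r (B.m r ν.1)) =
          ψ r (B.m r ν.1 * t.1.d B) := by
        rw [← map_mul]
        refine (hQ.invol_map _).trans ?_
        rw [(C r).invol_mul, (C r).invol_invol, hA.symmetric]
      rw [rowEmb_single, _root_.map_smul, ← h5, D.layer_invol, h4, TensorProduct.comm_tmul,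
        ← TensorProduct.tmul_smul, Finsupp.smul_single, smul_eq_mul, mul_one]
      rw [← map_mul]
      exact hmem _ ((C r).mul_upper hm _)
  refine D.isCellGenerator_iff.2 ⟨hmem _ hm, D.layer ν, D.isLayerMap_layer ν, ?_⟩
  rw [← hQ.cellDatum_strictUpper hA hli] at h1
  have h3 := D.layer_strictUpper h1
  rw [map_sub, sub_eq_zero] at h3
  rw [h3, h2]

end IsTowerQuotient

end Tower

section Tower

variable {R : Type*} [CommRing R] {A : ℕ → Type*} [∀ r, Ring (A r)] [∀ r, Algebra R (A r)]
  {Λ : ℕ → Type*} [∀ r, PartialOrder (Λ r)] {Std : ∀ r, Λ r → Type*}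
  {ι : ∀ r, A r →ₐ[R] A (r + 1)} {C : ∀ r, CellDatum R (A r) (Λ r) (Std r)}

theorem StdPath.exists_snoc {r : ℕ} {μ : Λ (r + 1)} (v : StdPath ι C (r + 1) μ) :
    ∃ (l : Λ r) (t : StdPath ι C r l) (e : Edge ι C r l μ), v = t.snoc e := by
  rcases v with _ | ⟨t, e⟩
  exact ⟨_, t, e, rfl⟩

/-- The combinations of permissible paths to `ν` whose last vertex but one is larger than `l`. -/
def permAbove (S : Type*) [CommRing S] {perm : ∀ r, Set (Λ r)} {r : ℕ} (l : Λ r) (ν : Λ (r + 1)) :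
    Submodule S (PermPath ι C perm (r + 1) ν →₀ S) :=
  Finsupp.supported S S {v | l < v.1.pred}

/-- Extension of permissible paths by an edge. -/
noncomputable def permLift (S : Type*) [CommRing S] {perm : ∀ r, Set (Λ r)} {r : ℕ} {l : Λ r}
    {ν : Λ (r + 1)} (hν : ν ∈ perm (r + 1)) (e : Edge ι C r l ν) :
    (PermPath ι C perm r l →₀ S) →ₗ[S] (PermPath ι C perm (r + 1) ν →₀ S) :=
  Finsupp.lmapDomain S S fun t => ⟨t.1.snoc e, t.2, hν⟩

theorem permLift_single {S : Type*} [CommRing S] {perm : ∀ r, Set (Λ r)} {r : ℕ} {l : Λ r}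
    {ν : Λ (r + 1)} (hν : ν ∈ perm (r + 1)) (e : Edge ι C r l ν) (t : PermPath ι C perm r l)
    (c : S) : permLift S hν e (Finsupp.single t c) =
      Finsupp.single ⟨t.1.snoc e, t.2, hν⟩ c := by
  rw [permLift, Finsupp.lmapDomain_apply, Finsupp.mapDomain_single]

theorem Module.Basis.map_mem_of_repr {R S M N ι : Type*} [CommRing R] [CommRing S]
    {σ : R →+* S} [AddCommGroup M] [Module R M] [AddCommGroup N] [Module S N]
    (b : Module.Basis ι R M) (f : M →ₛₗ[σ] N) (W : Submodule S N) {x : M}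
    (h : ∀ i, b.repr x i ∈ RingHom.ker σ ∨ f (b i) ∈ W) : f x ∈ W := by
  suffices hx : x ∈ W.comap f from hx
  rw [← b.linearCombination_repr x, Finsupp.linearCombination_apply]
  refine Submodule.sum_mem _ fun i _ => ?_
  change f (b.repr x i • b i) ∈ W
  rw [LinearMap.map_smulₛₗ]
  rcases h i with h | h
  · rw [(RingHom.mem_ker).1 h, zero_smul]
    exact zero_mem _
  · exact W.smul_mem _ h

namespace IsTowerQuotient

variable {S : Type*} [CommRing S] [Algebra R S] {Q : ℕ → Type*} [∀ r, Ring (Q r)]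
  [∀ r, Algebra S (Q r)] {B : BranchingData C} {perm : ∀ r, Set (Λ r)}
  {κ : ∀ r, Q r →ₐ[S] Q (r + 1)} {ψ : ∀ r, A r →+* Q r}
  (hQ : IsTowerQuotient ι C B perm κ ψ)
  {F : Type*} [Field F] [Algebra R F] [IsDomain R] [IsFractionRing R F]
  (hA : IsDiagramTower F ι C B) [IsDomain S]
  (hli : ∀ r, LinearIndependent S (permMurphy ι B perm ψ r))

theorem proj_eq_zero {r : ℕ} (l : perm r) {x : Std r l.1 →₀ R}
    (h : ψ r (hA.cellEmb r l.1 x) ∈ hQ.image ((C r).strictUpper l.1)) :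
    hQ.proj hA hli r l x = 0 :=
  hQ.proj_eq hA hli l (by rwa [map_zero, sub_zero])

theorem proj_basis_mem {r : ℕ} {l : Λ r} (ν : perm (r + 1)) (t : StdPath ι C (r + 1) ν.1)
    (ht : l < t.pred) : hQ.proj hA hli (r + 1) ν (hA.murphyBasis (r + 1) ν.1 t) ∈
      permAbove S l ν.1 := by
  induction t using (StdPath.wellFounded_lt ν.1).induction with
  | _ t ih =>
    by_cases htp : t.IsPermissible perm
    · rw [hQ.proj_basis hA hli ν ⟨t, htp⟩]
      exact Finsupp.single_mem_supported S 1 ht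
    · obtain ⟨s, a, y, h⟩ := hQ.exists_isReduction hA t htp
      obtain ⟨z, -, hz, hzt⟩ := hQ.exists_of_isReduction hA h
      have h1 := hQ.proj_eq_zero hA hli ν hzt
      rw [_root_.map_add, add_eq_zero_iff_eq_neg] at h1
      rw [h1]
      refine neg_mem ((hA.murphyBasis (r + 1) ν.1).map_mem_of_repr _ _ fun v => ?_)
      by_cases hv : t.Lt v
      · exact .inr (ih v hv (ht.trans_le hv.pred_le))
      · exact .inl (hz v hv)

theorem proj_mem {r : ℕ} {l : Λ r} (ν : perm (r + 1)) {x : Std (r + 1) ν.1 →₀ R}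
    (h : ∀ v, ¬ l < v.pred → (hA.murphyBasis (r + 1) ν.1).repr x v ∈
      RingHom.ker (algebraMap R S)) :
    hQ.proj hA hli (r + 1) ν x ∈ permAbove S l ν.1 := by
  refine (hA.murphyBasis (r + 1) ν.1).map_mem_of_repr _ _ fun v => ?_
  by_cases hv : l < v.pred
  · exact .inr (hQ.proj_basis_mem hA hli ν v hv)
  · exact .inl (h v hv)

theorem proj_mem_of_isAbove {r : ℕ} {l : Λ r} (ν : perm (r + 1)) {x : Std (r + 1) ν.1 →₀ R}
    (h : hA.IsAbove l x) : hQ.proj hA hli (r + 1) ν x ∈ permAbove S l ν.1 :=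
  hQ.proj_mem hA hli ν fun v hv => by rw [h v hv]; exact zero_mem _

/-- The projections of cell modules are compatible with the extension of paths. -/
theorem proj_lift_sub_mem {r : ℕ} (l : perm r) (ν : perm (r + 1)) (e : Edge ι C r l.1 ν.1)
    (x : Std r l.1 →₀ R) : hQ.proj hA hli (r + 1) ν (hA.lift e x) -
      permLift S ν.2 e (hQ.proj hA hli r l x) ∈ permAbove S l.1 ν.1 := by
  let D : (Std r l.1 →₀ R) →ₛₗ[algebraMap R S] (PermPath ι C perm (r + 1) ν.1 →₀ S) :=
    (hQ.proj hA hli (r + 1) ν).comp (hA.lift e) - (permLift S ν.2 e).comp (hQ.proj hA hli r l)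
  have hD : ∀ x, D x = hQ.proj hA hli (r + 1) ν (hA.lift e x) -
      permLift S ν.2 e (hQ.proj hA hli r l x) := fun _ => rfl
  rw [← hD]
  refine (hA.murphyBasis r l.1).map_mem_of_repr D _ fun t => .inr ?_
  induction t using (StdPath.wellFounded_lt l.1).induction with
  | _ t ih =>
    by_cases htp : t.IsPermissible perm
    · rw [hD, hA.lift_basis, hQ.proj_basis hA hli l ⟨t, htp⟩, permLift_single,
        hQ.proj_basis hA hli ν ⟨t.snoc e, htp, ν.2⟩, sub_self]
      exact zero_mem _
    · obtain ⟨s, a, y, h⟩ := hQ.exists_isReduction hA t htp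
      obtain ⟨z, hz, hzv, hzt⟩ := hQ.exists_of_isReduction hA h
      obtain ⟨w, hw, -, hwt⟩ := hQ.exists_of_isReduction hA (hQ.isReduction_snoc hA e h)
      have hDz : D z ∈ permAbove S l.1 ν.1 := by
        refine (hA.murphyBasis r l.1).map_mem_of_repr D _ fun v => ?_
        by_cases hv : t.Lt v
        · exact .inr (ih v hv)
        · exact .inl (hzv v hv)
      refine (Submodule.add_mem_iff_left _ hDz).1 ?_
      rw [← _root_.map_add, hD, hQ.proj_eq_zero hA hli l hzt, map_zero, sub_zero, _root_.map_add,
        hA.lift_basis, ← add_sub_cancel w (hA.lift e z), ← add_assoc, _root_.map_add,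
        hQ.proj_eq_zero hA hli ν hwt, zero_add]
      refine hQ.proj_mem hA hli ν fun v hv => ?_
      have h1 := (hA.lift e).map_mem_ideal_smul_top hz
      have h2 := ((hA.murphyBasis (r + 1) ν.1).mem_ideal_smul_top _).1 (sub_mem h1 hw) v
      have h3 := hA.isAbove_act_sub_lift e a v hv
      rw [map_sub, Finsupp.sub_apply, sub_eq_zero] at h3
      have := RingHom.ker_isPrime (algebraMap R S)
      refine (Ideal.IsPrime.mem_or_mem this (x := s) ?_).resolve_left h.scalar
      convert h2 using 1
      simp only [map_sub, Finsupp.sub_apply, _root_.map_smul, Finsupp.smul_apply, h3, smul_eq_mul]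
      ring

/-! ### Restriction of the cell modules of the quotient -/

section Restriction

set_option linter.unusedSectionVars false

variable (r : ℕ) (ν : perm (r + 1))

/-- The positions of the permissible subquotients. -/
abbrev PermIndex := {i : Fin (hA.resFiltration r ν.1).len //
  (hA.resFiltration r ν.1).label i ∈ perm r}

/-- Enumeration of the positions of the permissible subquotients. -/
noncomputable def permIndexIso : Fin (Nat.card (PermIndex hA r ν)) ≃o PermIndex hA r ν :=
  letI := Fintype.ofFinite (PermIndex hA r ν)
  monoEquivOfFin _ Nat.card_eq_fintype_card.symm

/-- The labels of the permissible subquotients. -/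
noncomputable def permLabel (i : Fin (Nat.card (PermIndex hA r ν))) : perm r :=
  ⟨(hA.resFiltration r ν.1).label (permIndexIso hA r ν i).1, (permIndexIso hA r ν i).2⟩

omit [IsDomain R] [IsFractionRing R F] [IsDomain S] in
theorem permLabel_strictAnti : StrictAnti (permLabel hA r ν) := fun _ _ h =>
  hA.resFiltration_orderPreserving r ν.1 ((permIndexIso hA r ν).strictMono h)

omit [IsDomain R] [IsFractionRing R F] [IsDomain S] in
theorem permLabel_edge (i : Fin (Nat.card (PermIndex hA r ν))) :
    Edge ι C r (permLabel hA r ν i).1 ν.1 :=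
  ⟨_, hA.resFiltration_orderPreserving r ν.1, _, rfl⟩

omit [IsDomain S] in
theorem exists_permLabel_iff (l : perm r) : (∃ i, permLabel hA r ν i = l) ↔
    Edge ι C r l.1 ν.1 := by
  rw [edge_iff_label hA.trace_ne_zero (hA.resFiltration_orderPreserving r ν.1)]
  constructor
  · rintro ⟨i, rfl⟩
    exact ⟨_, rfl⟩
  · rintro ⟨i, hi⟩
    obtain ⟨k, hk⟩ := (permIndexIso hA r ν).surjective ⟨i, hi ▸ l.2⟩
    exact ⟨k, Subtype.ext ((congrArg (fun x : PermIndex hA r ν => (hA.resFiltration r ν.1).label x.1) hk).trans hi)⟩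

/-- Permissible paths to `ν` correspond to permissible paths to the permissible subquotients. -/
noncomputable def permPathEquiv :
    (Σ i, PermPath ι C perm r (permLabel hA r ν i).1) ≃ PermPath ι C perm (r + 1) ν.1 :=
  Equiv.ofBijective (fun t => ⟨t.2.1.snoc (permLabel_edge hA r ν t.1), t.2.2, ν.2⟩) (by
    constructor
    · rintro ⟨i, t, ht⟩ ⟨i', t', ht'⟩ h
      have h1 := congrArg Subtype.val h
      obtain rfl : i = i' := (permLabel_strictAnti hA r ν).injective
        (Subtype.ext (congrArg StdPath.pred h1))
      obtain rfl : t = t' := StdPath.snoc_injective _ h1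
      rfl
    · rintro ⟨v, hv⟩
      obtain ⟨l, t, e, rfl⟩ := v.exists_snoc
      obtain ⟨i, hi⟩ := (exists_permLabel_iff hA r ν ⟨l, hv.1.mem⟩).2 e
      obtain rfl : (permLabel hA r ν i).1 = l := congrArg Subtype.val hi
      exact ⟨⟨i, t, hv.1⟩, rfl⟩)

/-- The permissible paths, arranged according to their last vertex but one. -/
noncomputable def pathBasis (S : Type*) [CommRing S] :
    Module.Basis (Σ i, PermPath ι C perm r (permLabel hA r ν i).1) S
      (PermPath ι C perm (r + 1) ν.1 →₀ S) :=
  Finsupp.basisSingleOne.reindex (permPathEquiv hA r ν).symm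

theorem pathBasis_apply (i : Fin (Nat.card (PermIndex hA r ν)))
    (t : PermPath ι C perm r (permLabel hA r ν i).1) :
    pathBasis hA r ν S ⟨i, t⟩ =
      permLift S ν.2 (permLabel_edge hA r ν i) (Finsupp.single t 1) := by
  rw [pathBasis, Module.Basis.reindex_apply, Equiv.symm_symm, Finsupp.coe_basisSingleOne,
    permLift_single]
  rfl

theorem blockEmb_pathBasis (i : Fin (Nat.card (PermIndex hA r ν)))
    (z : PermPath ι C perm r (permLabel hA r ν i).1 →₀ S) :
    blockEmb (pathBasis hA r ν S) i z = permLift S ν.2 (permLabel_edge hA r ν i) z := by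
  induction z using Finsupp.induction_linear with
  | zero => simp
  | add z w hz hw => rw [_root_.map_add, hz, hw, _root_.map_add]
  | single t c =>
    rw [blockEmb_single, pathBasis_apply, ← _root_.map_smul, Finsupp.smul_single, smul_eq_mul,
      mul_one]

theorem permAbove_eq_flag (i : Fin (Nat.card (PermIndex hA r ν))) :
    permAbove S (permLabel hA r ν i).1 ν.1 = flag (pathBasis hA r ν S) i.castSucc := by
  ext z
  rw [mem_flag, permAbove, Finsupp.mem_supported']
  rw [← (permPathEquiv hA r ν).forall_congr_right]
  refine forall_congr' fun k => ?_
  rw [pathBasis, Module.Basis.repr_reindex_apply, Equiv.symm_symm, Fin.castSucc_le_castSucc_iff,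
    ← not_lt, ← (permLabel_strictAnti hA r ν).lt_iff_gt]
  rfl

theorem act_pathBasis_sub_mem (i : Fin (Nat.card (PermIndex hA r ν)))
    (t : PermPath ι C perm r (permLabel hA r ν i).1) (a : Q r) :
    (hQ.cellDatum hA hli (r + 1)).act ν (κ r a) (pathBasis hA r ν S ⟨i, t⟩) -
      blockEmb (pathBasis hA r ν S) i
        ((hQ.cellDatum hA hli r).act (permLabel hA r ν i) a (Finsupp.single t 1)) ∈
      flag (pathBasis hA r ν S) i.castSucc := by
  obtain ⟨a, rfl⟩ := hQ.surjective r a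
  have e := permLabel_edge hA r ν i
  rw [← permAbove_eq_flag, blockEmb_pathBasis, pathBasis_apply, ← hQ.map_incl, permLift_single,
    ← hQ.proj_basis hA hli (permLabel hA r ν i) t, ← hQ.proj_basis hA hli ν ⟨t.1.snoc e, t.2, ν.2⟩,
    hQ.act_proj hA hli, hQ.act_proj hA hli]
  have h1 := hQ.proj_lift_sub_mem hA hli (permLabel hA r ν i) ν e ((C r).act (permLabel hA r ν i).1 a (hA.murphyBasis r (permLabel hA r ν i).1 t.1))
  have h2 : hA.IsAbove (permLabel hA r ν i).1 ((C (r + 1)).act ν.1 (ι r a) (hA.murphyBasis (r + 1) ν.1 (t.1.snoc e)) -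
      hA.lift e ((C r).act (permLabel hA r ν i).1 a (hA.murphyBasis r (permLabel hA r ν i).1 t.1))) := by
    rw [hA.murphyBasis_apply, hA.murphyBasis_apply, ← CellDatum.act_mul, ← CellDatum.act_mul,
      StdPath.d, mul_assoc, ← map_mul]
    exact hA.isAbove_act_sub_lift e _
  have h3 := add_mem (hQ.proj_mem_of_isAbove hA hli ν h2) h1
  rw [map_sub, sub_add_sub_cancel] at h3
  exact h3

/-- The cell filtration of the restriction of a cell module of the quotient. -/
noncomputable def permFiltration : ResFiltration κ (hQ.cellDatum hA hli) r ν :=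
  .ofBasis (permLabel hA r ν) (pathBasis hA r ν S) (hQ.act_pathBasis_sub_mem hA hli r ν)

theorem permFiltration_orderPreserving :
    CellDatum.Filtration.OrderPreserving (hQ.permFiltration hA hli r ν) :=
  permLabel_strictAnti hA r ν

theorem permFiltration_down (i : Fin (Nat.card (PermIndex hA r ν))) :
    ∃ h : (hQ.cellDatum hA hli (r + 1)).act ν (ψ (r + 1) (B.d r (permLabel hA r ν i).1 ν.1))
        (hQ.proj hA hli (r + 1) ν (B.δ (r + 1) ν.1)) ∈ (hQ.permFiltration hA hli r ν).N i.succ,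
      (hQ.permFiltration hA hli r ν).iso i (Submodule.Quotient.mk ⟨_, h⟩) =
        hQ.proj hA hli r (permLabel hA r ν i) (B.δ r (permLabel hA r ν i).1) := by
  have e := permLabel_edge hA r ν i
  have h1 := hA.isAbove_act_sub_lift e 1
  rw [map_one, mul_one, CellDatum.act_one_apply] at h1
  have h2 := add_mem (hQ.proj_mem_of_isAbove hA hli ν h1)
    (hQ.proj_lift_sub_mem hA hli (permLabel hA r ν i) ν e (B.δ r (permLabel hA r ν i).1))
  rw [map_sub, sub_add_sub_cancel, ← hQ.act_proj hA hli, ← blockEmb_pathBasis,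
    permAbove_eq_flag] at h2
  have h3 := add_mem (flag_mono _ (Fin.castSucc_le_succ i) h2)
    (blockEmb_mem (pathBasis hA r ν S) i (hQ.proj hA hli r (permLabel hA r ν i) (B.δ r (permLabel hA r ν i).1)))
  rw [sub_add_cancel] at h3
  refine ⟨h3, ?_⟩
  have h4 := (blockCoord_eq_zero_iff _ (flag_mono _ (Fin.castSucc_le_succ i) h2)).2 h2
  rw [map_sub, blockCoord_emb, sub_eq_zero] at h4
  exact (CellDatum.Filtration.ofBasis_iso _ _ _ i _).trans h4

end Restriction

variable {K : Type*} [Field K] [Algebra S K] [IsFractionRing S K]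
  (hss : ∀ r, IsSplitSemisimple K (K ⊗[S] Q r))

include hss in
theorem trace_ne_zero (r : ℕ) (l : perm r) : ∃ a ∈ (hQ.cellDatum hA hli r).upper l,
    LinearMap.trace S _ ((hQ.cellDatum hA hli r).act l a) ≠ 0 :=
  (hQ.cellDatum hA hli r).exists_trace_ne_zero (IsFractionRing.injective S K)
    IsFractionRing.exists_mul_eq (hss r) l

include hss in
theorem edge_iff (r : ℕ) (l : perm r) (ν : perm (r + 1)) :
    Edge κ (hQ.cellDatum hA hli) r l ν ↔ Edge ι C r l.1 ν.1 := by
  rw [edge_iff_label (hQ.trace_ne_zero hA hli hss)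
    (hQ.permFiltration_orderPreserving hA hli r ν), ← exists_permLabel_iff hA r ν l]
  rfl

include hss in
/-- A quotient of a tower of diagram algebras is a tower of diagram algebras. -/
theorem isDiagramTower (hκ : ∀ r, Function.Injective (κ r)) :
    IsDiagramTower K κ (hQ.cellDatum hA hli) (hQ.branchingData hA hli) where
  injective := hκ
  invol_comm r a := by
    obtain ⟨a, rfl⟩ := hQ.surjective r a
    change κ r (hQ.invol r _) = hQ.invol (r + 1) _
    rw [hQ.invol_map, ← hQ.map_incl, ← hQ.map_incl, hQ.invol_map, hA.invol_comm]
  base := by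
    have hψ : ∀ c : R, ψ 0 (algebraMap R (A 0) c) = algebraMap S (Q 0) (algebraMap R S c) := by
      intro c
      rw [Algebra.algebraMap_eq_smul_one, hQ.map_smul, map_one, ← Algebra.algebraMap_eq_smul_one]
    constructor
    · rw [injective_iff_map_eq_zero]
      intro c hc
      obtain ⟨s⟩ : Nonempty (perm 0) := by
        by_contra hempty
        have h1 : IsEmpty (Λ 0) := ⟨fun l => hempty ⟨⟨l, hQ.permissible.root l⟩⟩⟩
        have h2 : (C 0).basis.repr 1 = 0 := Finsupp.ext fun i => h1.elim i.1
        rw [LinearEquiv.map_eq_zero_iff] at h2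
        have h3 := hA.base.1 ((map_one (algebraMap R (A 0))).trans
          (h2.trans (map_zero (algebraMap R (A 0))).symm))
        exact one_ne_zero h3
      obtain ⟨t⟩ := hQ.permissible.exists_permPath s
      have h1 : c • (hQ.basis hA hli 0) ⟨s, t, t⟩ = 0 := by
        rw [Algebra.smul_def, hc, zero_mul]
      have h2 := congrArg (fun x => (hQ.basis hA hli 0).repr x ⟨s, t, t⟩) h1
      simpa using h2
    · intro q
      obtain ⟨a, rfl⟩ := hQ.surjective 0 q
      obtain ⟨c, rfl⟩ := hA.base.2 a
      exact ⟨_, (hψ c).symm⟩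
  cyclic r ν := hQ.isCyclicGenerator hA hli ν
  cellGenerator r ν := hQ.isCellGenerator hA hli ν
  symmetric r ν := by
    change hQ.invol r (ψ r (B.m r ν.1)) = ψ r (B.m r ν.1)
    rw [hQ.invol_map, hA.symmetric]
  semisimple := hss
  coherent r ν := ⟨_, hQ.permFiltration_orderPreserving hA hli r ν⟩
  down r ν := ⟨_, hQ.permFiltration_orderPreserving hA hli r ν,
    hQ.permFiltration_down hA hli r ν⟩
  compatible r l ν h := by
    have e := (hQ.edge_iff hA hli hss r l ν).1 h
    change ψ (r + 1) (B.m (r + 1) ν.1) * ψ (r + 1) (B.d r l.1 ν.1) =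
      hQ.invol (r + 1) (ψ (r + 1) (B.u r l.1 ν.1)) * κ r (ψ r (B.m r l.1))
    rw [hQ.invol_map, ← hQ.map_incl, ← map_mul, ← map_mul, hA.compatible r l.1 ν.1 e]

end IsTowerQuotient

end Tower

/-! ### Extension of scalars -/

section Extension

variable {S K Q : Type*} [CommRing S] [Field K] [Algebra S K] [Ring Q] [Algebra K Q] [Algebra S Q]
  [IsScalarTower S K Q]

theorem Submodule.exists_one_tmul_of_mem_baseChange {R M : Type*} [CommRing R] [Algebra R S]
    (h : Function.Surjective (algebraMap R S)) [AddCommGroup M] [Module R M] {N : Submodule R M}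
    {x : S ⊗[R] M} (hx : x ∈ N.baseChange S) : ∃ y ∈ N, 1 ⊗ₜ[R] y = x := by
  rw [Submodule.baseChange_eq_span] at hx
  induction hx using Submodule.span_induction with
  | mem x hx => exact hx
  | zero => exact ⟨0, N.zero_mem, TensorProduct.tmul_zero _ _⟩
  | add x y _ _ hx hy =>
    obtain ⟨x, hx, rfl⟩ := hx
    obtain ⟨y, hy, rfl⟩ := hy
    exact ⟨x + y, N.add_mem hx hy, TensorProduct.tmul_add _ _ _⟩
  | smul c x _ hx =>
    obtain ⟨x, hx, rfl⟩ := hx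
    obtain ⟨c, rfl⟩ := h c
    refine ⟨c • x, N.smul_mem c hx, ?_⟩
    rw [TensorProduct.tmul_smul, algebraMap_smul]

/-- The canonical homomorphism to a `K`-algebra from the extension of scalars of an
`S`-subalgebra. -/
noncomputable def Subalgebra.extend (K : Type*) [Field K] [Algebra S K] [Algebra K Q]
    [IsScalarTower S K Q] (P : Subalgebra S Q) : K ⊗[S] P →ₐ[K] Q :=
  Algebra.TensorProduct.lift (Algebra.ofId K Q) P.val
    fun k p => show Commute (algebraMap K Q k) p from Algebra.commutes k (p : Q)

theorem Subalgebra.extend_tmul (P : Subalgebra S Q) (k : K) (p : P) :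
    P.extend K (k ⊗ₜ p) = k • (p : Q) := by
  refine (Algebra.TensorProduct.lift_tmul _ _ _ _ _).trans ?_
  rw [Algebra.smul_def]
  rfl

theorem Subalgebra.extend_bijective [IsDomain S] [IsFractionRing S K] (P : Subalgebra S Q)
    (hP : Submodule.span K (P : Set Q) = ⊤) : Function.Bijective (P.extend K) := by
  constructor
  · rw [injective_iff_map_eq_zero]
    intro X hX
    obtain ⟨s, hs, p, hp⟩ := exists_smul_eq_one_tmul IsFractionRing.exists_mul_eq X
    have h1 : P.extend K (s • X) = 0 := by
      rw [← algebraMap_smul K s X, map_smul, hX, smul_zero]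
    rw [hp, extend_tmul, one_smul, ZeroMemClass.coe_eq_zero] at h1
    rw [h1, TensorProduct.tmul_zero, ← algebraMap_smul K s X] at hp
    rw [← inv_smul_smul₀ hs X, hp, smul_zero]
  · refine LinearMap.range_eq_top (f := (P.extend K).toLinearMap).1 ?_
    rw [eq_top_iff, ← hP, Submodule.span_le]
    intro p hp
    exact ⟨1 ⊗ₜ ⟨p, hp⟩, (P.extend_tmul 1 ⟨p, hp⟩).trans (one_smul _ _)⟩

theorem IsSplitSemisimple.subalgebra [IsDomain S] [IsFractionRing S K]
    (h : IsSplitSemisimple K Q) (P : Subalgebra S Q)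
    (hP : Submodule.span K (P : Set Q) = ⊤) : IsSplitSemisimple K (K ⊗[S] P) := by
  obtain ⟨n, k, hk, ⟨e⟩⟩ := h
  exact ⟨n, k, hk, ⟨(AlgEquiv.ofBijective _ (P.extend_bijective hP)).trans e⟩⟩

theorem Subalgebra.linearIndependent_of_span_eq_top
    (hK : Function.Injective (algebraMap S K)) (P : Subalgebra S Q)
    (hP : Submodule.span K (P : Set Q) = ⊤) {I : Type*} [Finite I] (v : I → P)
    (hv : Submodule.span S (Set.range v) = ⊤) (hI : Nat.card I = Module.finrank K Q) :
    LinearIndependent S v := by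
  have := Fintype.ofFinite I
  have h1 : ⊤ ≤ Submodule.span K (Set.range fun i => (v i : Q)) := by
    rw [← hP, Submodule.span_le]
    intro p hp
    have h2 : (⟨p, hp⟩ : P) ∈ Submodule.span S (Set.range v) := hv ▸ Submodule.mem_top
    have h3 := Submodule.mem_map_of_mem (f := P.val.toLinearMap) h2
    rw [Submodule.map_span, ← Set.range_comp] at h3
    exact Submodule.span_subset_span S K _ h3
  have h2 := linearIndependent_of_top_le_span_of_card_eq_finrank h1
    (Nat.card_eq_fintype_card.symm.trans hI)
  have h3 : LinearIndependent S fun i => (v i : Q) := by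
    refine h2.restrict_scalars ?_
    intro a b hab
    refine hK ?_
    simpa [Algebra.smul_def] using hab
  exact LinearIndependent.of_comp P.val.toLinearMap h3

end Extension

/-! ### Quotient towers -/

section Tower

variable {R S K : Type*} [CommRing R] [CommRing S] [Field K] [Algebra S K] [Algebra R S]
  [Algebra R K] [IsScalarTower R S K]
  {A : ℕ → Type*} [∀ r, Ring (A r)] [∀ r, Algebra R (A r)]
  {Λ : ℕ → Type*} [∀ r, PartialOrder (Λ r)] {Std : ∀ r, Λ r → Type*}
  {ι : ∀ r, A r →ₐ[R] A (r + 1)} {C : ∀ r, CellDatum R (A r) (Λ r) (Std r)}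
  {B : BranchingData C}
  {Q : ℕ → Type*} [∀ r, Ring (Q r)] [∀ r, Algebra K (Q r)]
  [∀ r, Algebra S (Q r)] [∀ r, IsScalarTower S K (Q r)]
  {j : ∀ r, Q r →ₐ[K] Q (r + 1)} {φ : ∀ r, K ⊗[R] A r →ₐ[K] Q r}
  {perm : ∀ r, Set (Λ r)}

/-- The homomorphism `a ↦ φ (1 ⊗ a)` from `A r` to the integral form of `Q r`. -/
noncomputable def reductionHom (S : Type*) [CommRing S] [Algebra R S] [Algebra S K]
    [IsScalarTower R S K] [∀ r, Algebra S (Q r)] [∀ r, IsScalarTower S K (Q r)]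
    (φ : ∀ r, K ⊗[R] A r →ₐ[K] Q r) (r : ℕ) : A r →+* IntegralQuotient S φ r :=
  (integralProj S φ r : S ⊗[R] A r →+* IntegralQuotient S φ r).comp
    (Algebra.TensorProduct.includeRight : A r →ₐ[R] S ⊗[R] A r)

theorem coe_reductionHom (r : ℕ) (a : A r) :
    (reductionHom S φ r a : Q r) = φ r (1 ⊗ₜ a) := by
  change φ r (toGeneric R S K (A r) (1 ⊗ₜ a)) = _
  rw [toGeneric, Algebra.TensorProduct.map_tmul, map_one]
  rfl

theorem reductionHom_smul (r : ℕ) (c : R) (a : A r) :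
    reductionHom S φ r (c • a) = algebraMap R S c • reductionHom S φ r a := by
  change integralProj S φ r (1 ⊗ₜ (c • a)) = algebraMap R S c • integralProj S φ r (1 ⊗ₜ a)
  rw [TensorProduct.tmul_smul, ← algebraMap_smul S c, map_smul]

theorem map_smul_one_tmul (r : ℕ) (c : R) (a : A r) :
    φ r (1 ⊗ₜ (c • a)) = algebraMap R K c • φ r (1 ⊗ₜ a) := by
  rw [TensorProduct.tmul_smul, ← algebraMap_smul K c, map_smul]

theorem reductionHom_surjective (hπ : Function.Surjective (algebraMap R S)) (r : ℕ) :
    Function.Surjective (reductionHom S φ r) := fun q => by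
  obtain ⟨x, rfl⟩ := (integralMap S φ r).rangeRestrict_surjective q
  obtain ⟨a, rfl⟩ := TensorProduct.mk_surjective R (A r) S hπ x
  exact ⟨a, rfl⟩

theorem span_range_map_one_tmul (hφ : ∀ r, Function.Surjective (φ r)) (r : ℕ) :
    Submodule.span K (Set.range fun a : A r => φ r (1 ⊗ₜ a)) = ⊤ := by
  rw [eq_top_iff]
  intro q _
  obtain ⟨x, rfl⟩ := hφ r q
  induction x using TensorProduct.induction_on with
  | zero => rw [map_zero]; exact zero_mem _
  | add x y hx hy => rw [map_add]; exact add_mem (hx trivial) (hy trivial)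
  | tmul k a =>
    rw [← mul_one k, ← smul_eq_mul, ← TensorProduct.smul_tmul', map_smul]
    exact Submodule.smul_mem _ _ (Submodule.subset_span ⟨a, rfl⟩)

theorem span_integralQuotient (hφ : ∀ r, Function.Surjective (φ r)) (r : ℕ) :
    Submodule.span K (IntegralQuotient S φ r : Set (Q r)) = ⊤ := by
  rw [eq_top_iff, ← span_range_map_one_tmul hφ r]
  refine Submodule.span_mono ?_
  rintro _ ⟨a, rfl⟩
  change φ r (1 ⊗ₜ a) ∈ IntegralQuotient S φ r
  rw [← coe_reductionHom (S := S)]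
  exact (reductionHom S φ r a).2

theorem integralIncl_injective (hcons : IsConsistent ι j φ) (hj : ∀ r, Function.Injective (j r))
    (r : ℕ) : Function.Injective (integralIncl S hcons r) := fun _ _ h =>
  Subtype.ext (hj r (congrArg Subtype.val h))

variable [IsFractionRing S K]

theorem algebraMap_eq_zero_iff_of_isFractionRing (c : R) :
    algebraMap R K c = 0 ↔ algebraMap R S c = 0 := by
  rw [IsScalarTower.algebraMap_apply R S K,
    map_eq_zero_iff _ (IsFractionRing.injective S K)]

variable [IsDomain S]

theorem IsQuotientTower.exists_mem_strictUpper (hQ : IsQuotientTower S ι C B φ perm)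
    (hπ : Function.Surjective (algebraMap R S)) {r : ℕ} {μ : Λ (r + 1)}
    (hμ : IsMarginal ι C perm r μ) :
    ∃ y ∈ (C (r + 1)).strictUpper μ, reductionHom S φ (r + 1) (B.m (r + 1) μ + y) = 0 ∧
      ∃ s : R, algebraMap R S s ≠ 0 ∧ ∃ a, s • y - B.m (r + 1) μ * a ∈
        RingHom.ker (algebraMap R S) • (⊤ : Submodule R (A (r + 1))) := by
  obtain ⟨b, b', hb, hb0, ⟨β, hβ⟩, hb'⟩ := hQ.marginal r μ hμ
  obtain ⟨y, hy, rfl⟩ := Submodule.exists_one_tmul_of_mem_baseChange hπ hb'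
  obtain ⟨s, hs, a, ha⟩ := exists_smul_eq_one_tmul (R := R) (K := K) (fun k => by
    obtain ⟨x, s, hs, h⟩ := IsFractionRing.exists_mul_eq (S := S) k
    obtain ⟨x, rfl⟩ := hπ x
    obtain ⟨s, rfl⟩ := hπ s
    rw [← IsScalarTower.algebraMap_apply, ← IsScalarTower.algebraMap_apply] at h
    rw [← IsScalarTower.algebraMap_apply] at hs
    exact ⟨x, s, hs, h⟩) β
  refine ⟨y, hy, ?_, s, fun h => hs ((algebraMap_eq_zero_iff_of_isFractionRing s).2 h), a, ?_⟩
  · rw [eq_sub_iff_add_eq, ← TensorProduct.tmul_add] at hb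
    change integralProj S φ (r + 1) (1 ⊗ₜ (B.m (r + 1) μ + y)) = 0
    rw [hb]
    exact Subtype.ext hb0
  · have hker : RingHom.ker (algebraMap R S) = RingHom.ker (algebraMap R K) :=
      Ideal.ext fun c => (algebraMap_eq_zero_iff_of_isFractionRing c).symm
    rw [hker]
    refine mem_smul_top_of_one_tmul_eq_zero (C (r + 1)).basis ?_
    have h1 : (1 : K) ⊗ₜ[R] y = (1 ⊗ₜ[R] B.m (r + 1) μ) * β := by
      rw [← hβ, toGeneric, Algebra.TensorProduct.map_tmul, map_one]
      rfl
    rw [TensorProduct.tmul_sub, TensorProduct.tmul_smul, h1, ← mul_smul_comm, ha,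
      Algebra.TensorProduct.tmul_mul_tmul, one_mul, sub_self]

theorem IsQuotientTower.isTowerQuotient (hQ : IsQuotientTower S ι C B φ perm)
    (hπ : Function.Surjective (algebraMap R S)) (hφ : ∀ r, Function.Surjective (φ r))
    (hcons : IsConsistent ι j φ) (hss : ∀ r, IsSplitSemisimple K (Q r)) :
    IsTowerQuotient ι C B perm (integralIncl S hcons) (reductionHom S φ) where
  scalar_surjective := hπ
  surjective := reductionHom_surjective hπ
  map_smul := reductionHom_smul
  map_incl r a := by
    refine Subtype.ext ?_
    change _ = j r (reductionHom S φ r a)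
    rw [coe_reductionHom, coe_reductionHom, ← hcons, Algebra.TensorProduct.map_tmul]
    rfl
  map_invol r a h := by
    refine Subtype.ext ?_
    rw [coe_reductionHom]
    refine (C r).map_invol_eq_zero (hss r)
      (ψ := (φ r : K ⊗[R] A r →+* Q r).comp
        (Algebra.TensorProduct.includeRight : A r →ₐ[R] K ⊗[R] A r))
      (map_smul_one_tmul r) (span_range_map_one_tmul hφ r) ?_
    exact (coe_reductionHom (S := S) r a).symm.trans (congrArg Subtype.val h)
  permissible := hQ.permissible
  marginal _ _ hμ := hQ.exists_mem_strictUpper hπ hμ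

variable [IsDomain R] {F : Type*} [Field F] [Algebra R F] [IsFractionRing R F]

theorem IsQuotientTower.linearIndependent_permMurphy (hQ : IsQuotientTower S ι C B φ perm)
    (hA : IsDiagramTower F ι C B)
    (hπ : Function.Surjective (algebraMap R S)) (hφ : ∀ r, Function.Surjective (φ r))
    (hcons : IsConsistent ι j φ) (hss : ∀ r, IsSplitSemisimple K (Q r)) (r : ℕ) :
    LinearIndependent S (permMurphy ι B perm (reductionHom S φ) r) := by
  have := (C r).finite_shapes
  have := Fintype.ofFinite (perm r)
  have := fun ν : Λ r => StdPath.finite (ι := ι) (C := C) ν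
  refine (IntegralQuotient S φ r).linearIndependent_of_span_eq_top (IsFractionRing.injective S K)
    (span_integralQuotient hφ r) _
    ((hQ.isTowerQuotient hπ hφ hcons hss).span_permMurphy hA r) ?_
  rw [← Module.finrank_baseChange (R := AlgebraicClosure K), hQ.dimension, Nat.card_sigma,
    finsum_eq_sum_of_fintype]
  exact Finset.sum_congr rfl fun ν _ => by rw [Nat.card_prod, sq]

end Tower

theorem mainTheorem10 {R S F K : Type*} [CommRing R] [IsDomain R] [CommRing S] [IsDomain S]
    [Field F] [Algebra R F] [IsFractionRing R F] [Field K] [Algebra S K] [IsFractionRing S K]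
    [Algebra R S] [Algebra R K] [IsScalarTower R S K]
    (hπ : Function.Surjective (algebraMap R S))
    {A : ℕ → Type*} [∀ r, Ring (A r)] [∀ r, Algebra R (A r)]
    {Λ : ℕ → Type*} [∀ r, PartialOrder (Λ r)] {Std : ∀ r, Λ r → Type*}
    (ι : ∀ r, A r →ₐ[R] A (r + 1)) (C : ∀ r, CellDatum R (A r) (Λ r) (Std r))
    (B : BranchingData C) (hA : IsDiagramTower F ι C B)
    {Q : ℕ → Type*} [∀ r, Ring (Q r)] [∀ r, Algebra K (Q r)]
    [∀ r, Algebra S (Q r)] [∀ r, IsScalarTower S K (Q r)]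
    (j : ∀ r, Q r →ₐ[K] Q (r + 1)) (hj : ∀ r, Function.Injective (j r))
    (φ : ∀ r, K ⊗[R] A r →ₐ[K] Q r) (hφ : ∀ r, Function.Surjective (φ r))
    (hcons : IsConsistent ι j φ)
    (perm : ∀ r, Set (Λ r)) (hQ : IsQuotientTower S ι C B φ perm)
    (hss : ∀ r, IsSplitSemisimple K (Q r)) :
    ∃ (C' : ∀ r, CellDatum S (IntegralQuotient S φ r) (perm r)
          (fun ν => {t : StdPath ι C r ν.1 // t.IsPermissible perm}))
      (δ' : ∀ r (ν : perm r), {t : StdPath ι C r ν.1 // t.IsPermissible perm} →₀ S),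
      -- the involution of `Q_r^S` is induced by that of `A_r`
      (∀ r x, (C' r).invol (integralProj S φ r x) =
        integralProj S φ r (((C r).invol).baseChange S x)) ∧
      -- the cellular basis consists of the images of the Murphy basis elements
      (∀ r ν s t, (C' r).basis ⟨ν, s, t⟩ = integralProj S φ r (1 ⊗ₜ[R] murphy B s.1 t.1)) ∧
      -- `δ' ν` is the class of `φ (m_ν)`, the class of `φ (m_ν d_t)` being the basis element `t`
      (∀ r ν, integralProj S φ r (1 ⊗ₜ[R] B.m r ν.1) -
          (δ' r ν).sum (fun t x => x • integralProj S φ r (1 ⊗ₜ[R] (B.m r ν.1 * t.1.d B))) ∈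
        (C' r).strictUpper ν) ∧
      -- the axioms, with branching factors `φ (d)` and `φ (u)`
      IsDiagramTower K (integralIncl S hcons) C'
        { δ := δ'
          m := fun r ν => integralProj S φ r (1 ⊗ₜ[R] B.m r ν.1)
          d := fun r μ ν => integralProj S φ (r + 1) (1 ⊗ₜ[R] B.d r μ.1 ν.1)
          u := fun r μ ν => integralProj S φ (r + 1) (1 ⊗ₜ[R] B.u r μ.1 ν.1) } ∧
      -- the branching diagram is the permissible part of the original one
      (∀ r (μ : perm r) (ν : perm (r + 1)),
        Edge (integralIncl S hcons) C' r μ ν ↔ Edge ι C r μ.1 ν.1) := by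
  have hT := hQ.isTowerQuotient hπ hφ hcons hss
  have hli := hQ.linearIndependent_permMurphy hA hπ hφ hcons hss
  refine ⟨hT.cellDatum hA hli, fun r ν => hT.proj hA hli r ν (B.δ r ν.1), fun r x => ?_,
    fun r ν s t => hT.cellDatum_basis hA hli ν s t, fun r ν => ?_,
    hT.isDiagramTower hA hli (fun r => (hss r).subalgebra _ (span_integralQuotient hφ r))
      (integralIncl_injective hcons hj),
    hT.edge_iff hA hli fun r => (hss r).subalgebra _ (span_integralQuotient hφ r)⟩
  · obtain ⟨a, rfl⟩ := TensorProduct.mk_surjective R (A r) S hπ x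
    exact hT.invol_map a
  · rw [hT.cellDatum_strictUpper hA hli ν]
    exact hT.map_m_sub_rowEmb_mem hA hli ν
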